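/- **Definitions.** Let $U$ be a finite set with $n$ elements; $A\uplus B$ denotes the union of two sets that are required to be disjoint. A *$\gamma$-family* is a family of subsets of $U$ of cardinality exactly $\gamma$. For $\mathcal H\subseteq 2^U$ let $\mathcal B(\mathcal H)=\{H_1\uplus\dots\uplus H_i \mid i\in\mathbb N,\ H_1,\dots,H_i\in\mathcal H\}$ (so $\emptyset\in\mathcal B(\mathcal H)$). A function $\mathbf w\colon\mathcal B(\mathcal H)\to\mathbb R$ is an *inductive union maximizing function* with *generating function* $\mathbf g\colon\mathbb R\times\mathcal H\to\mathbb R$ if $\mathbf g$ is non-decreasing in its first argument and, for each nonempty $X\in\mathcal B(\mathcal H)$, $$\mathbf w(X)=\max\{\mathbf g(\mathbf w(S),H)\mid H\in\mathcal H,\ S\in\mathcal B(\mathcal H),\ S\uplus H=X\}.$$ Given matroids $M_i=(U,\mathcal I_i)$, $1\le i\le m$, a family $\mathcal S\subseteq 2^U$ and $w\colon\mathcal S\to\mathbb R$, a subfamily $\widehat{\mathcal S}\subseteq\mathcal S$ is *max intersection $q$-representative* for $\mathcal S$ with respect to $w$ if for each $Y\subseteq U$ with $|Y|\le q$ and each $X\in\mathcal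 S$ with $X\uplus Y\in\bigcap_{i=1}^m\mathcal I_i$ there is $\widehat X\in\widehat{\mathcal S}$ with $\widehat X\uplus Y\in\bigcap_{i=1}^m\mathcal I_i$ and $w(\widehat X)\ge w(X)$. **Machine model.** Algorithms are programs of a random access machine whose memory holds natural numbers, elements of a field $\mathbb F$, and real numbers. It can add, (truncatedly) subtract and compare natural numbers, perform field operations and equality tests in $\mathbb F$, copy and compare real numbers, and call an oracle for $\mathbf g$ on a stored real number and a member of $\mathcal H$ (given by its index in the input list). Every operation, memory access, test and oracle call takes one unit of time. **Theorem.** There are a single algorithm, independent of the field and of all parameters, and an absolute constant $C$ such that the following holds. Let $m\ge 1$, let $\alpha,\beta,\gamma\in\mathbb N$ with $r:=(\alpha+\beta)\gamma\ge 1$, let $M_i=(U,\mathcal I_i)$, $1\le i\le m$, be matroids of rank $r$ with $|U|=n$, let $\mathcal H\subseteq 2^U$ be a $\gamma$-family of size $t$, and let $\mathbf w\colon\mathcal B(\mathcal H)\to\mathbb R$ be an inductive union maximizing function with generating function $\mathbf g$. Given, for each $i$, an $(r\times n)$-matrix $A_i$ over a common field $\mathbb F$ whose columns represent $M_i$, together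 with a list of the members of $\mathcal H$, the value $\mathbf w(\emptyset)$ and oracle access to $\mathbf g$, the algorithm computes a max intersection $\beta\gamma$-representative of size at most $\binom{rm}{\alpha\gamma m}$ of the family $$\mathcal S=\Bigl\{S=H_1\uplus\dots\uplus H_\alpha \Bigm| S\in\bigcap_{i=1}^m\mathcal I_i,\ H_1,\dots,H_\alpha\in\mathcal H\Bigr\}$$ with respect to $\mathbf w$, in time at most $2^{C\,rm}\cdot t+C\,m^2rn$, that is, using $2^{O(rm)}\cdot t+O(m^2rn)$ operations over $\mathbb F$ and calls to $\mathbf g$, all other operations of the algorithm being counted as well. -/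

import Mathlib

namespace RepFam

/-! ## Set families, matroid representations, representative families -/

section Combinatorics

variable {U : Type*} [DecidableEq U]

/-- The sets `H₁ ⊎ ⋯ ⊎ Hₖ` that are disjoint unions of exactly `k` members of `𝓗`
(for `k = 0`, only the empty set). -/
def disjointUnions (𝓗 : Finset (Finset U)) (k : ℕ) : Set (Finset U) :=
  {X | ∃ H : Fin k → Finset U, (∀ j, H j ∈ 𝓗) ∧ Pairwise (fun i j => Disjoint (H i) (H j)) ∧
    X = Finset.univ.biUnion H}

/-- `𝓑(𝓗)`: all disjoint unions of finitely many members of `𝓗`. -/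
def unionFamily (𝓗 : Finset (Finset U)) : Set (Finset U) :=
  {X | ∃ k, X ∈ disjointUnions 𝓗 k}

/-- `w : 𝓑(𝓗) → ℝ` is an inductive union maximizing function with generating function
`g : ℝ × 𝓗 → ℝ`. Both are given as total functions; only the values of `w` on `𝓑(𝓗)` and those
of `g` on `ℝ × 𝓗` are used. -/
structure Generates (𝓗 : Finset (Finset U)) (g : ℝ → Finset U → ℝ) (w : Finset U → ℝ) :
    Prop where
  mono : ∀ H ∈ 𝓗, Monotone fun x => g x H
  isGreatest : ∀ X ∈ unionFamily 𝓗, X ≠ ∅ →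
    IsGreatest {x | ∃ H ∈ 𝓗, ∃ S ∈ unionFamily 𝓗, Disjoint S H ∧ S ∪ H = X ∧ x = g (w S) H} (w X)

/-- The columns of `A` represent the matroid `M`, whose ground set is all of `U`. -/
def Represents {F : Type*} [Field F] {r : ℕ} (A : Matrix (Fin r) U F) (M : Matroid U) : Prop :=
  M.E = Set.univ ∧ ∀ S : Set U, M.Indep S ↔ LinearIndepOn F A.col S

/-- The members of `disjointUnions 𝓗 α` that are independent in all the matroids `M i`. -/
def commonIndepUnions {m : ℕ} (M : Fin m → Matroid U) (𝓗 : Finset (Finset U)) (α : ℕ) :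
    Set (Finset U) :=
  {S | S ∈ disjointUnions 𝓗 α ∧ ∀ i, (M i).Indep (S : Set U)}

/-- `𝓡` is a max intersection `q`-representative family for `𝓢` with respect to `w`. -/
def IsMaxIntersectionRep {m : ℕ} (M : Fin m → Matroid U) (q : ℕ) (w : Finset U → ℝ)
    (𝓢 𝓡 : Set (Finset U)) : Prop :=
  𝓡 ⊆ 𝓢 ∧ ∀ Y : Finset U, Y.card ≤ q →
    ∀ X ∈ 𝓢, Disjoint X Y → (∀ i, (M i).Indep ((X ∪ Y : Finset U) : Set U)) →
      ∃ X' ∈ 𝓡, Disjoint X' Y ∧ (∀ i, (M i).Indep ((X' ∪ Y : Finset U) : Set U)) ∧ w X ≤ w X'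

end Combinatorics

/-! ## The machine model

A random access machine with structured control flow. Its memory consists of arrays of natural
numbers (addresses, counters), arrays of elements of the field `F`, and arrays of real numbers
(weights). The arrays are named by constants of the program; the addresses within an array are
computed. On natural numbers it can add, subtract (truncated) and compare; on field elements it has
the field operations and the equality test; real numbers can only be copied, compared, and passed to
an oracle `(x, j) ↦ O x j`. Every operation, memory access, test, oracle call and constant is
charged one unit of time. -/

/-- Memory contents: the cell with address `i` in array `a` of each of the three sorts. -/
structure State (F : Type*) where
  nat : ℕ → ℕ → ℕ
  fld : ℕ → ℕ → F
  real : ℕ → ℕ → ℝ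

/-- Expressions for natural numbers; `get a i` is the content of the cell `i` of array `a`. -/
inductive NatExp : Type
  | lit (k : ℕ)
  | get (a : ℕ) (i : NatExp)
  | add (x y : NatExp)
  | sub (x y : NatExp)

/-- Expressions for field elements. -/
inductive FldExp : Type
  | zero
  | one
  | get (a : ℕ) (i : NatExp)
  | add (x y : FldExp)
  | sub (x y : FldExp)
  | mul (x y : FldExp)
  | inv (x : FldExp)

/-- Expressions for real numbers; `call x j` is an oracle call. -/
inductive RealExp : Type
  | get (a : ℕ) (i : NatExp)
  | call (x : RealExp) (j : NatExp)

/-- Tests. -/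
inductive Test : Type
  | natLe (x y : NatExp)
  | fldEq (x y : FldExp)
  | realLe (x y : RealExp)
  | not (b : Test)

/-- Programs; `setNat a i e` stores the value of `e` in the cell `i` of array `a`. -/
inductive Program : Type
  | skip
  | setNat (a : ℕ) (i e : NatExp)
  | setFld (a : ℕ) (i : NatExp) (e : FldExp)
  | setReal (a : ℕ) (i : NatExp) (e : RealExp)
  | seq (p q : Program)
  | cond (b : Test) (p q : Program)
  | loop (b : Test) (p : Program)

section Semantics

variable {F : Type*}

/-- The array memory `mem` after storing `v` in cell `i` of array `a`. -/
def store {V : Type*} (mem : ℕ → ℕ → V) (a i : ℕ) (v : V) : ℕ → ℕ → V :=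
  Function.update mem a (Function.update (mem a) i v)

def NatExp.eval (s : State F) : NatExp → ℕ
  | .lit k => k
  | .get a i => s.nat a (i.eval s)
  | .add x y => x.eval s + y.eval s
  | .sub x y => x.eval s - y.eval s

def NatExp.cost : NatExp → ℕ
  | .lit _ => 1
  | .get _ i => i.cost + 1
  | .add x y => x.cost + y.cost + 1
  | .sub x y => x.cost + y.cost + 1

def FldExp.eval [Field F] (s : State F) : FldExp → F
  | .zero => 0
  | .one => 1
  | .get a i => s.fld a (i.eval s)
  | .add x y => x.eval s + y.eval s
  | .sub x y => x.eval s - y.eval s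
  | .mul x y => x.eval s * y.eval s
  | .inv x => (x.eval s)⁻¹

def FldExp.cost : FldExp → ℕ
  | .zero => 1
  | .one => 1
  | .get _ i => i.cost + 1
  | .add x y => x.cost + y.cost + 1
  | .sub x y => x.cost + y.cost + 1
  | .mul x y => x.cost + y.cost + 1
  | .inv x => x.cost + 1

def RealExp.eval (O : ℝ → ℕ → ℝ) (s : State F) : RealExp → ℝ
  | .get a i => s.real a (i.eval s)
  | .call x j => O (x.eval O s) (j.eval s)

def RealExp.cost : RealExp → ℕ
  | .get _ i => i.cost + 1
  | .call x j => x.cost + j.cost + 1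

def Test.holds [Field F] (O : ℝ → ℕ → ℝ) (s : State F) : Test → Prop
  | .natLe x y => x.eval s ≤ y.eval s
  | .fldEq x y => x.eval s = y.eval s
  | .realLe x y => x.eval O s ≤ y.eval O s
  | .not b => ¬ b.holds O s

def Test.cost : Test → ℕ
  | .natLe x y => x.cost + y.cost + 1
  | .fldEq x y => x.cost + y.cost + 1
  | .realLe x y => x.cost + y.cost + 1
  | .not b => b.cost + 1

/-- `Runs O p s s' T`: with oracle `O`, the program `p` started in the state `s` halts in the
state `s'` after time `T`. -/
inductive Runs [Field F] (O : ℝ → ℕ → ℝ) : Program → State F → State F → ℕ → Prop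
  | skip (s : State F) : Runs O .skip s s 1
  | setNat (s : State F) (a : ℕ) (i e : NatExp) :
      Runs O (.setNat a i e) s { s with nat := store s.nat a (i.eval s) (e.eval s) }
        (i.cost + e.cost + 1)
  | setFld (s : State F) (a : ℕ) (i : NatExp) (e : FldExp) :
      Runs O (.setFld a i e) s { s with fld := store s.fld a (i.eval s) (e.eval s) }
        (i.cost + e.cost + 1)
  | setReal (s : State F) (a : ℕ) (i : NatExp) (e : RealExp) :
      Runs O (.setReal a i e) s { s with real := store s.real a (i.eval s) (e.eval O s) }
        (i.cost + e.cost + 1)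
  | seq {p q : Program} {s s' s'' : State F} {T T' : ℕ} :
      Runs O p s s' T → Runs O q s' s'' T' → Runs O (.seq p q) s s'' (T + T')
  | condTrue {b : Test} {p q : Program} {s s' : State F} {T : ℕ} :
      b.holds O s → Runs O p s s' T → Runs O (.cond b p q) s s' (b.cost + T)
  | condFalse {b : Test} {p q : Program} {s s' : State F} {T : ℕ} :
      ¬ b.holds O s → Runs O q s s' T → Runs O (.cond b p q) s s' (b.cost + T)
  | loopDone {b : Test} {p : Program} {s : State F} :
      ¬ b.holds O s → Runs O (.loop b p) s s b.cost
  | loopStep {b : Test} {p : Program} {s s' s'' : State F} {T T' : ℕ} :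
      b.holds O s → Runs O p s s' T → Runs O (.loop b p) s' s'' T' →
        Runs O (.loop b p) s s'' (b.cost + T + T')

end Semantics

/-! ## Input and output formats -/

/-- The set written as the `j`-th block of length `q` of the array `a`. -/
def block (a : ℕ → ℕ) (q j : ℕ) : Finset ℕ :=
  (Finset.range q).image fun i => a (j * q + i)

/-- The first `k` blocks of length `q` of the array `a` list the members of the family `𝓐` of
`q`-element subsets of `Fin n`, in an arbitrary order and without repetitions, and with the elements
of each member in an arbitrary order. -/
structure ListsFamily {n : ℕ} (a : ℕ → ℕ) (q k : ℕ) (𝓐 : Finset (Finset (Fin n))) : Prop where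
  card_mem : ∀ X ∈ 𝓐, X.card = q
  card_eq : 𝓐.card = k
  blocks : 𝓐.image (fun X => X.image Fin.val) = (Finset.range k).image (block a q)

/-- The state `s` holds the input: the numbers `n, m, r, α, β, γ, t`, the matrices `A i` one after
the other and row by row, a list of the `t` members of `𝓗`, and the weight `w₀` of the empty set.
All other memory cells have arbitrary contents. -/
structure IsInput {F : Type*} {n m r : ℕ} (s : State F) (α β γ t : ℕ)
    (A : Fin m → Matrix (Fin r) (Fin n) F) (𝓗 : Finset (Finset (Fin n))) (w₀ : ℝ) : Prop where
  n_eq : s.nat 0 0 = n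
  m_eq : s.nat 0 1 = m
  r_eq : s.nat 0 2 = r
  α_eq : s.nat 0 3 = α
  β_eq : s.nat 0 4 = β
  γ_eq : s.nat 0 5 = γ
  t_eq : s.nat 0 6 = t
  matrices : ∀ (i : Fin m) (k : Fin r) (u : Fin n),
    s.fld 0 (((i : ℕ) * r + k) * n + u) = A i k u
  family : ListsFamily (s.nat 1) γ t 𝓗
  weight : s.real 0 0 = w₀

/-- A call `O x j` of the oracle returns `g x H` for the `j`-th set `H` of the list of `𝓗` held in
the input array of `s`. -/
def Answers {F : Type*} {n : ℕ} (O : ℝ → ℕ → ℝ) (s : State F) (γ t : ℕ)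
    (𝓗 : Finset (Finset (Fin n))) (g : ℝ → Finset (Fin n) → ℝ) : Prop :=
  ∀ j < t, ∀ H ∈ 𝓗, H.image Fin.val = block (s.nat 1) γ j → ∀ x, O x j = g x H

/-- The state `s` holds the output `𝓡`: the number of its members, and a list of them. -/
def IsOutput {F : Type*} {n : ℕ} (s : State F) (q : ℕ) (𝓡 : Finset (Finset (Fin n))) : Prop :=
  ListsFamily (s.nat 3) q (s.nat 2 0) 𝓡

end RepFam

open RepFam

/-! Split F^(rm) into m blocks of r coordinates and place column u of `A i` in block i. To a list l
of elements of U attach the exterior product λ(l) of all these vectors, for u in l and i < m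
(`colProd`). An exterior product stays nonzero under a further factor exactly when that factor is
outside the span of the previous ones, and the blocks do not interact. Hence λ(l) ≠ 0 if and only if
l has no repetition and its set is independent in every matroid (`colProd_ne_zero`). For a
concatenation of two repetition-free lists, one inequality thus expresses both that the two sets are
disjoint and that their union is independent in every matroid.

Multiplication by the columns of a list is linear. So if λ(X) lies in the span of products λ(X_k),
and X ⊎ Y is independent in every matroid, then some X_k can take the place of X
(`exists_extension`). If moreover only X_k of weight at least that of X are needed, a maximum weight
basis of the span of all λ(X) is a representative family. Since λ(X) is homogeneous of degree |X|m,
such a basis has at most binom(rm, |X|m) members.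

The family 𝓢 is too large to be listed, so a basis is kept for each number i ≤ α of united members
of 𝓗 (`LayerInv`). The candidates for i + 1 are the kept sets joined with each member of 𝓗, and
greedy elimination reduces them to a basis (`ElimInv`). This loses nothing (`LayerInv.step`): if w(S
⊎ H) = g(w(S), H), a kept set replaces S in the presence of H ⊎ Y, and monotonicity of g carries the
comparison of weights along. The weights stored may be smaller than the true w of the kept sets, but
never larger, and this suffices.

With D = 2^(rm), a layer has at most D·t candidates, each a vector of length D, so all work is
bounded by a polynomial in D times t. The rest is a program for this procedure, verified in a Hoare
logic for total correctness with time bounds (`Spec`). -/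

namespace RepFam

/-! ## Exterior products in coordinates

An element of the exterior algebra of `F ^ d` is a function on masks (sets of basis vectors, coded
in binary). Exterior multiplication by a vector and contraction with a functional are sums of
operators, each of which touches a single bit, with Jordan–Wigner signs. -/

section Exterior

variable {F : Type*} [Field F]

/-- An operator that touches only the bit `j`. -/
def site (j : ℕ) (a b : Bool → F) : Module.End F (ℕ → F) where
  toFun f z := a (z.testBit j) * f z + b (z.testBit j) * f (z ^^^ 2 ^ j)
  map_add' f g := by ext z; simp only [Pi.add_apply]; ring
  map_smul' c f := by ext z; simp only [Pi.smul_apply, smul_eq_mul, RingHom.id_apply]; ring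

lemma site_apply (j : ℕ) (a b : Bool → F) (f : ℕ → F) (z : ℕ) :
    site j a b f z = a (z.testBit j) * f z + b (z.testBit j) * f (z ^^^ 2 ^ j) := rfl

lemma testBit_flip_self (z j : ℕ) : (z ^^^ 2 ^ j).testBit j = !z.testBit j := by
  simp [Nat.testBit_xor, Nat.testBit_two_pow_self]

lemma testBit_flip_ne {z j k : ℕ} (h : j ≠ k) : (z ^^^ 2 ^ j).testBit k = z.testBit k := by
  simp [Nat.testBit_xor, h]

/-- Halving moves bit j + 1 to bit j and the parity is untouched. The subtraction matters because
the machine has no bit operations. -/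
lemma flip_of_testBit {z j : ℕ} (h : z.testBit j = true) : z ^^^ 2 ^ j = z - 2 ^ j := by
  induction j generalizing z with
  | zero => exact Nat.xor_one_of_odd (Nat.odd_iff.2 (by simpa using h))
  | succ j ih =>
    have h2 := ih (z := z / 2) (by rwa [← Nat.testBit_succ])
    have h3 : (z ^^^ 2 ^ (j + 1)) / 2 = z / 2 - 2 ^ j := by
      rw [Nat.xor_div_two, pow_succ, Nat.mul_div_cancel _ (by simp), h2]
    have h4 : (z ^^^ 2 ^ (j + 1)) % 2 = z % 2 := by
      rw [Nat.xor_mod_two_eq, pow_succ]; omega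
    have h5 : 2 ^ (j + 1) ≤ z := by
      by_contra h5
      rw [Nat.testBit_lt_two_pow (not_le.1 h5)] at h
      exact absurd h (by simp)
    have h6 : 2 ^ (j + 1) = 2 * 2 ^ j := by ring
    omega

lemma site_mul_site (j : ℕ) (a b a' b' : Bool → F) :
    site j a b * site j a' b' =
      site j (fun β => a β * a' β + b β * b' (!β)) (fun β => a β * b' β + b β * a' (!β)) := by
  ext f z
  simp only [Module.End.mul_apply, site_apply, testBit_flip_self, Nat.xor_assoc, Nat.xor_self,
    Nat.xor_zero]
  ring

lemma site_commute {j k : ℕ} (h : j ≠ k) (a b a' b' : Bool → F) :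
    Commute (site j a b) (site k a' b') := by
  ext f z
  simp only [Module.End.mul_apply, site_apply, testBit_flip_ne h, testBit_flip_ne h.symm]
  rw [Nat.xor_assoc, Nat.xor_comm (2 ^ j) (2 ^ k), ← Nat.xor_assoc]
  ring

/-- The sign of a bit. -/
def bitSign (β : Bool) : F := if β then -1 else 1

lemma end_neg_mul (S T : Module.End F (ℕ → F)) : -S * T = -(S * T) := by
  ext; simp

lemma end_mul_neg (S T : Module.End F (ℕ → F)) : S * -T = -(S * T) := by
  ext; simp

/-- The off-diagonal operator flips the very bit whose sign is read. -/
lemma site_mul_sign (d : ℕ) (b : Bool → F) :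
    site d 0 b * site d bitSign 0 = - (site d bitSign 0 * site d 0 b) := by
  rw [site_mul_site, site_mul_site]
  ext f z
  simp only [site_apply, LinearMap.neg_apply, Pi.neg_apply, bitSign, Pi.zero_apply]
  cases z.testBit d <;> simp

lemma sign_mul_sign (d : ℕ) : (site d bitSign 0 * site d bitSign 0 : Module.End F (ℕ → F)) = 1 := by
  rw [site_mul_site]
  ext f z
  simp only [site_apply, bitSign, Pi.zero_apply, Module.End.one_apply]
  cases z.testBit d <;> simp

/-- The sum over `j < d` of the operators with off-diagonal part `b j` at the bit `j`, with signs
for the higher bits. -/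
def ferm (b : ℕ → Bool → F) : ℕ → Module.End F (ℕ → F)
  | 0 => 0
  | d + 1 => site d 0 (b d) + site d bitSign 0 * ferm b d

lemma site_commute_ferm {j d : ℕ} (h : d ≤ j) (a b : Bool → F) (b' : ℕ → Bool → F) :
    Commute (site j a b) (ferm b' d) := by
  induction d with
  | zero => exact Commute.zero_right _
  | succ d ih =>
    exact (site_commute (by omega) _ _ _ _).add_right
      ((site_commute (by omega) _ _ _ _).mul_right (ih (by omega)))

/-- The canonical anticommutation relations. The sign N at the bit d anticommutes with off-diagonal
operators at d, so the cross terms between d and the lower bits cancel; N² = 1 leaves the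
anticommutator of the lower bits, and the terms at d add up to a scalar. -/
lemma ferm_anticomm (b b' : ℕ → Bool → F) (d : ℕ) :
    ferm b d * ferm b' d + ferm b' d * ferm b d =
      (∑ j ∈ Finset.range d, (b j true * b' j false + b' j true * b j false)) •
        (1 : Module.End F (ℕ → F)) := by
  induction d with
  | zero => simp [ferm]
  | succ d ih =>
    have hU := site_commute_ferm (le_refl d) 0 (b d) b'
    have hV := site_commute_ferm (le_refl d) 0 (b' d) b
    have hN := site_commute_ferm (le_refl d) (bitSign (F := F)) 0 b
    have hN' := site_commute_ferm (le_refl d) (bitSign (F := F)) 0 b'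
    have e1 := site_mul_sign d (b d)
    have e2 := site_mul_sign d (b' d)
    have e3 : site d 0 (b d) * site d 0 (b' d) + site d 0 (b' d) * site d 0 (b d) =
        (b d true * b' d false + b' d true * b d false) • (1 : Module.End F (ℕ → F)) := by
      rw [site_mul_site, site_mul_site]; ext f z; simp [site_apply]
      cases z.testBit d <;> simp <;> ring
    have e4 := sign_mul_sign (F := F) d
    rw [Finset.sum_range_succ, add_smul, ← ih, ← e3]
    simp only [ferm]
    generalize ferm b d = K at *
    generalize ferm b' d = K' at *
    generalize (site d bitSign 0 : Module.End F (ℕ → F)) = N at *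
    generalize site d 0 (b d) = X at *
    generalize site d 0 (b' d) = Y at *
    have a1 : X * (N * K') = - (N * K' * X) := by
      rw [← mul_assoc, e1, end_neg_mul, mul_assoc, hU.eq, mul_assoc]
    have a2 : Y * (N * K) = - (N * K * Y) := by
      rw [← mul_assoc, e2, end_neg_mul, mul_assoc, hV.eq, mul_assoc]
    have a3 : N * K * (N * K') = K * K' := by
      rw [mul_assoc, ← mul_assoc K, ← hN.eq, ← mul_assoc, ← mul_assoc, e4, one_mul]
    have a4 : N * K' * (N * K) = K' * K := by
      rw [mul_assoc, ← mul_assoc K', ← hN'.eq, ← mul_assoc, ← mul_assoc, e4, one_mul]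
    simp only [add_mul, mul_add, a1, a2, a3, a4]
    abel

/-- Exterior multiplication by the vector `x`. -/
def wedge (d : ℕ) (x : ℕ → F) : Module.End F (ℕ → F) :=
  ferm (fun j β => if β then x j else 0) d

/-- Contraction with the functional `φ`. -/
def contract (d : ℕ) (φ : ℕ → F) : Module.End F (ℕ → F) :=
  ferm (fun j β => if β then 0 else φ j) d

lemma wedge_zero_apply (x f : ℕ → F) (z : ℕ) : wedge 0 x f z = 0 := rfl

/-- The recursion that `wedgeCoord` executes: the new entry at z needs only the old entry at z and
one entry of f, so the product can be updated in place. -/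
lemma wedge_succ_apply (d : ℕ) (x f : ℕ → F) (z : ℕ) :
    wedge (d + 1) x f z =
      if z.testBit d then x d * f (z - 2 ^ d) - wedge d x f z else wedge d x f z := by
  have h1 : wedge (d + 1) x f z = site d 0 (fun β => if β then x d else 0) f z +
      site d bitSign 0 (wedge d x f) z := rfl
  rw [h1, site_apply, site_apply]
  cases h : z.testBit d
  · simp [bitSign]
  · simp [bitSign, flip_of_testBit h, sub_eq_add_neg]

lemma wedge_add (d : ℕ) (x y : ℕ → F) : wedge d (x + y) = wedge d x + wedge d y := by
  induction d with
  | zero => simp [wedge, ferm]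
  | succ d ih =>
    ext f z
    simp only [LinearMap.add_apply, Pi.add_apply, wedge_succ_apply, ih]
    split_ifs <;> ring

lemma wedge_smul (d : ℕ) (c : F) (x : ℕ → F) : wedge d (c • x) = c • wedge d x := by
  induction d with
  | zero => simp [wedge, ferm]
  | succ d ih =>
    ext f z
    simp only [LinearMap.smul_apply, Pi.smul_apply, wedge_succ_apply, ih, smul_eq_mul]
    split_ifs <;> ring

lemma wedge_anticomm (d : ℕ) (x y : ℕ → F) : wedge d x * wedge d y = - (wedge d y * wedge d x) := by
  rw [eq_neg_iff_add_eq_zero, wedge, wedge, ferm_anticomm]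
  simp

/-- Anticommutation yields only that twice the square vanishes, which says nothing in characteristic
2; hence a separate induction. -/
lemma wedge_sq (d : ℕ) (x : ℕ → F) : wedge d x * wedge d x = 0 := by
  induction d with
  | zero => simp [wedge, ferm]
  | succ d ih =>
    have hU := site_commute_ferm (le_refl d) 0 (fun β => if β then x d else 0)
      (fun j β => if β then x j else 0)
    have hN := site_commute_ferm (le_refl d) (bitSign (F := F)) 0
      (fun j β => if β then x j else 0)
    have e1 := site_mul_sign d (fun β => if β then x d else 0)
    have e3 : site d 0 (fun β => if β then x d else 0) *
        site d 0 (fun β => if β then x d else 0) = 0 := by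
      rw [site_mul_site]
      ext f z
      simp only [site_apply]
      cases z.testBit d <;> simp
    have e4 := sign_mul_sign (F := F) d
    simp only [wedge, ferm] at ih ⊢
    generalize ferm (fun j β => if β = true then x j else 0) d = K at *
    generalize (site d bitSign 0 : Module.End F (ℕ → F)) = N at *
    generalize site d 0 (fun β => if β = true then x d else 0) = X at *
    have a1 : X * (N * K) = - (N * K * X) := by
      rw [← mul_assoc, e1, end_neg_mul, mul_assoc, hU.eq, mul_assoc]
    have a3 : N * K * (N * K) = 0 := by
      rw [mul_assoc, ← mul_assoc K, ← hN.eq, ← mul_assoc, ← mul_assoc, e4, one_mul, ih]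
    simp only [add_mul, mul_add, a1, a3, e3]
    abel

/-- The graded Leibniz rule. The entries of `wedge` sit at set bits and those of `contract` at clear
bits, so the scalar in `ferm_anticomm` is the pairing of φ with x. -/
lemma contract_wedge (d : ℕ) (φ x f : ℕ → F) :
    contract d φ (wedge d x f) + wedge d x (contract d φ f) =
      (∑ j ∈ Finset.range d, φ j * x j) • f := by
  have h := congrArg (fun T : Module.End F (ℕ → F) => T f)
    (ferm_anticomm (fun j β => if β then 0 else φ j) (fun j β => if β then x j else 0) d)
  simpa [contract, wedge, mul_comm] using h

/-- The unit of the exterior algebra. -/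
def unitVec : ℕ → F := Pi.single 0 1

/-- A nonzero entry would come from the empty mask by clearing a bit that it does not have. -/
lemma contract_unitVec (d : ℕ) (φ : ℕ → F) : contract d φ unitVec = 0 := by
  induction d with
  | zero => rfl
  | succ d ih =>
    have : contract (d + 1) φ unitVec = site d 0 (fun β => if β then 0 else φ d) unitVec +
        site d bitSign 0 (contract d φ unitVec) := rfl
    rw [this, ih, map_zero, add_zero]
    ext z
    simp only [site_apply, unitVec, Pi.zero_apply, zero_mul, zero_add]
    split_ifs with h
    · simp
    · have : z ^^^ 2 ^ d ≠ 0 := by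
        intro h0
        have := testBit_flip_self z d
        rw [h0] at this
        simp at this
        exact h this
      simp [this]

/-- The exterior product of a list of vectors, as an operator; the last vector acts last. -/
def wedgeList (d : ℕ) : List (ℕ → F) → Module.End F (ℕ → F)
  | [] => 1
  | x :: l => wedgeList d l * wedge d x

lemma wedgeList_append (d : ℕ) (l l' : List (ℕ → F)) :
    wedgeList d (l ++ l') = wedgeList d l' * wedgeList d l := by
  induction l with
  | nil => simp [wedgeList]
  | cons x l ih => simp [wedgeList, ih, mul_assoc]

lemma wedgeList_concat (d : ℕ) (l : List (ℕ → F)) (x : ℕ → F) :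
    wedgeList d (l ++ [x]) = wedge d x * wedgeList d l := by
  simp [wedgeList_append, wedgeList]

lemma wedgeList_perm (d : ℕ) {l l' : List (ℕ → F)} (h : l.Perm l') :
    wedgeList d l = wedgeList d l' ∨ wedgeList d l = - wedgeList d l' := by
  induction h with
  | nil => exact Or.inl rfl
  | cons x _ ih => rcases ih with ih | ih <;> simp [wedgeList, ih, end_neg_mul]
  | swap x y l =>
    right
    simp only [wedgeList, mul_assoc, wedge_anticomm d x y, end_mul_neg]
  | trans _ _ ih ih' => rcases ih with ih | ih <;> rcases ih' with ih' | ih' <;> simp [ih, ih']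

lemma wedge_wedgeList_of_mem (d : ℕ) {l : List (ℕ → F)} {x : ℕ → F} (h : x ∈ l) :
    wedge d x * wedgeList d l = 0 := by
  induction l using List.reverseRecOn with
  | nil => simp at h
  | append_singleton l y ih =>
    rw [wedgeList_concat]
    rcases List.mem_append.1 h with h | h
    · rw [← mul_assoc, wedge_anticomm, end_neg_mul, mul_assoc, ih h, mul_zero, neg_zero]
    · rw [List.mem_singleton.1 h, ← mul_assoc, wedge_sq, zero_mul]

lemma wedge_wedgeList_of_mem_span (d : ℕ) {l : List (ℕ → F)} {x : ℕ → F}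
    (h : x ∈ Submodule.span F {y | y ∈ l}) : wedge d x * wedgeList d l = 0 := by
  induction h using Submodule.span_induction with
  | mem x h => exact wedge_wedgeList_of_mem d h
  | zero =>
    have : wedge d (0 : ℕ → F) = 0 := by simpa using wedge_smul d (0 : F) 0
    rw [this, zero_mul]
  | add x y _ _ hx hy => rw [wedge_add, add_mul, hx, hy, add_zero]
  | smul c x _ hx => rw [wedge_smul, smul_mul_assoc, hx, smul_zero]

lemma contract_wedgeList (d : ℕ) (φ : ℕ → F) (l : List (ℕ → F))
    (h : ∀ x ∈ l, ∑ j ∈ Finset.range d, φ j * x j = 0) :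
    contract d φ (wedgeList d l unitVec) = 0 := by
  induction l using List.reverseRecOn with
  | nil => exact contract_unitVec d φ
  | append_singleton l y ih =>
    rw [wedgeList_concat, Module.End.mul_apply]
    have h1 := contract_wedge d φ y (wedgeList d l unitVec)
    rw [ih (fun x hx => h x (by simp [hx])), map_zero, add_zero, h y (by simp), zero_smul] at h1
    exact h1

/-- If x is outside the span of l, some functional f kills l but not x. With ω the product of l,
contraction by f annihilates ω, so the Leibniz rule reduces to: contracting x ∧ ω by f gives f(x)·ω,
which is nonzero when ω is. -/
lemma wedgeList_concat_ne_zero (d : ℕ) (l : List (ℕ → F)) (x : ℕ → F)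
    (hs : ∀ y ∈ l ++ [x], ∀ j, d ≤ j → y j = 0) :
    wedgeList d (l ++ [x]) unitVec ≠ 0 ↔
      wedgeList d l unitVec ≠ 0 ∧ x ∉ Submodule.span F {y | y ∈ l} := by
  constructor
  · intro h
    refine ⟨fun h0 => h ?_, fun hx => h ?_⟩
    · rw [wedgeList_concat, Module.End.mul_apply, h0, map_zero]
    · rw [wedgeList_concat, wedge_wedgeList_of_mem_span d hx, LinearMap.zero_apply]
  · rintro ⟨h0, hx⟩ h
    obtain ⟨f, hfx, hf⟩ := Submodule.exists_le_ker_of_notMem hx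
    -- All factors are supported on the first d coordinates, where f is determined by its values on
    -- basis vectors; this is the form that `contract` takes.
    have key : ∀ y ∈ l ++ [x], ∑ j ∈ Finset.range d, f (Pi.single j 1) * y j = f y := by
      intro y hy
      have : y = ∑ j ∈ Finset.range d, y j • (Pi.single j 1 : ℕ → F) := by
        ext k
        simp only [Finset.sum_apply, Pi.smul_apply, smul_eq_mul, Pi.single_apply, mul_ite, mul_one,
          mul_zero, Finset.sum_ite_eq, Finset.mem_range]
        split_ifs with hk
        · rfl
        · exact hs y hy k (by omega)
      conv_rhs => rw [this]
      simp [mul_comm]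
    have h1 := contract_wedge d (fun j => f (Pi.single j 1)) x (wedgeList d l unitVec)
    rw [wedgeList_concat, Module.End.mul_apply] at h
    rw [h, map_zero, contract_wedgeList, map_zero, zero_add, key x (by simp)] at h1
    · exact (smul_ne_zero hfx h0) h1.symm
    · intro y hy
      rw [key y (by simp [hy])]
      exact hf (Submodule.subset_span hy)

/-- The masks of `p` of the first `d` basis vectors. -/
def masks (d p : ℕ) : Finset ℕ :=
  (Finset.range (2 ^ d)).filter fun z => ((Finset.range d).filter fun j => z.testBit j).card = p

lemma card_masks_le (d p : ℕ) : (masks d p).card ≤ d.choose p := by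
  have : ((Finset.range d).powersetCard p).card = d.choose p := by simp
  rw [← this]
  apply Finset.card_le_card_of_injOn (fun z => (Finset.range d).filter fun j => z.testBit j)
  · intro z hz
    simp only [masks, Finset.coe_filter, Finset.mem_range, Set.mem_ofPred_eq] at hz
    simp [Finset.mem_powersetCard, hz.2, Finset.filter_subset]
  · intro z hz z' hz' h
    simp only [masks, Finset.coe_filter, Finset.mem_range, Set.mem_ofPred_eq] at hz hz'
    apply Nat.eq_of_testBit_eq
    intro j
    by_cases hj : j < d
    · have := congrArg (fun s => j ∈ s) h
      simp only [Finset.mem_filter, Finset.mem_range, hj, true_and, eq_iff_iff] at this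
      exact Bool.eq_iff_iff.2 this
    · rw [Nat.testBit_lt_two_pow (hz.1.trans_le (Nat.pow_le_pow_right (by simp) (by omega))),
        Nat.testBit_lt_two_pow (hz'.1.trans_le (Nat.pow_le_pow_right (by simp) (by omega)))]

/-- The functions supported on `masks d p`. -/
def homogeneous (F : Type*) [Field F] (d p : ℕ) : Submodule F (ℕ → F) where
  carrier := {f | ∀ z ∉ masks d p, f z = 0}
  add_mem' hf hg z hz := by simp [hf z hz, hg z hz]
  zero_mem' _ _ := rfl
  smul_mem' c f hf z hz := by simp [hf z hz]

lemma wedge_mem_homogeneous {d p : ℕ} (x : ℕ → F) {f : ℕ → F} (hf : f ∈ homogeneous F d p) :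
    wedge d x f ∈ homogeneous F d (p + 1) := by
  -- The recursion runs over the number e of coordinates used, while the masks still range over all
  -- d bits.
  suffices ∀ e ≤ d, wedge e x f ∈ homogeneous F d (p + 1) from this d le_rfl
  intro e he
  induction e with
  | zero => exact Submodule.zero_mem _
  | succ e ih =>
    have ih := ih (by omega)
    intro z hz
    rw [wedge_succ_apply, ih z hz, sub_zero]
    split_ifs with h
    · rw [hf, mul_zero]
      rw [← flip_of_testBit h]
      contrapose! hz
      simp only [masks, Finset.mem_filter, Finset.mem_range] at hz ⊢
      refine ⟨?_, ?_⟩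
      · have : z = (z ^^^ 2 ^ e) ^^^ 2 ^ e := by rw [Nat.xor_assoc, Nat.xor_self, Nat.xor_zero]
        rw [this]
        exact Nat.xor_lt_two_pow hz.1 (Nat.pow_lt_pow_right (by simp) (by omega))
      · rw [← hz.2]
        have : ((Finset.range d).filter fun j => z.testBit j) =
            insert e ((Finset.range d).filter fun j => (z ^^^ 2 ^ e).testBit j) := by
          ext j
          simp only [Finset.mem_filter, Finset.mem_range, Finset.mem_insert]
          by_cases hj : j = e
          · subst hj; simp [h]; omega
          · simp [testBit_flip_ne (Ne.symm hj), hj]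
        rw [this, Finset.card_insert_of_notMem]
        simp [h]
    · rfl

lemma unitVec_mem_homogeneous (d : ℕ) : (unitVec : ℕ → F) ∈ homogeneous F d 0 := by
  intro z hz
  have : z ≠ 0 := by
    rintro rfl
    apply hz
    simp [masks]
  simp [unitVec, this]

lemma wedgeList_mem_homogeneous (d : ℕ) (l : List (ℕ → F)) :
    wedgeList d l unitVec ∈ homogeneous F d l.length := by
  induction l using List.reverseRecOn with
  | nil => exact unitVec_mem_homogeneous d
  | append_singleton l y ih =>
    rw [wedgeList_concat, Module.End.mul_apply, List.length_append]
    exact wedge_mem_homogeneous y ih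

end Exterior

/-! ## Exterior products of the columns of several matrices -/

section Columns

variable {F : Type*} [Field F]

/-- The column `u` of the `i`-th of several `(r × n)`-matrices written one after the other and row
by row in `a`, as a vector with `r` coordinates for each matrix. -/
def blockCol (a : ℕ → F) (n r i u : ℕ) : ℕ → F :=
  fun j => if i * r ≤ j ∧ j < i * r + r then a (j * n + u) else 0

/-- The columns of the elements of `l` in all the matrices. -/
def columns (a : ℕ → F) (n r m : ℕ) (l : List ℕ) : List (ℕ → F) :=
  l.flatMap fun u => (List.range m).map fun i => blockCol a n r i u

/-- The exterior product of the columns of the elements of `l` in all the matrices. -/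
def colProd (a : ℕ → F) (n r m : ℕ) (l : List ℕ) : ℕ → F :=
  wedgeList (r * m) (columns a n r m l) unitVec

lemma columns_append (a : ℕ → F) (n r m : ℕ) (l l' : List ℕ) :
    columns a n r m (l ++ l') = columns a n r m l ++ columns a n r m l' := by
  simp [columns]

lemma colProd_append (a : ℕ → F) (n r m : ℕ) (l l' : List ℕ) :
    colProd a n r m (l ++ l') =
      wedgeList (r * m) (columns a n r m l') (colProd a n r m l) := by
  rw [colProd, columns_append, wedgeList_append, Module.End.mul_apply, colProd]

/-- Reordering changes only the sign. Consequently lists with non-proportional products enumerate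
different sets. -/
lemma colProd_perm (a : ℕ → F) (n r m : ℕ) {l l' : List ℕ} (h : l.Perm l') :
    colProd a n r m l ∈ Submodule.span F {colProd a n r m l'} := by
  have hp : (columns a n r m l).Perm (columns a n r m l') := h.flatMap_right _
  unfold colProd
  rcases wedgeList_perm (r * m) hp with h | h <;> rw [h]
  · exact Submodule.mem_span_singleton_self _
  · exact Submodule.neg_mem _ (Submodule.mem_span_singleton_self _)

lemma length_columns (a : ℕ → F) (n r m : ℕ) (l : List ℕ) :
    (columns a n r m l).length = l.length * m := by
  simp [columns, List.length_flatMap]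

lemma colProd_mem_homogeneous (a : ℕ → F) (n r m : ℕ) (l : List ℕ) :
    colProd a n r m l ∈ homogeneous F (r * m) (l.length * m) := by
  rw [← length_columns a n r m l]
  exact wedgeList_mem_homogeneous _ _

lemma block_index_unique {r i i' k : ℕ} (hk : k < r) (h1 : i' * r ≤ i * r + k)
    (h2 : i * r + k < i' * r + r) : i' = i := by
  have h3 : i' * r < (i + 1) * r := by rw [add_mul]; omega
  have h4 : i * r < (i' + 1) * r := by rw [add_mul]; omega
  have h5 := Nat.lt_of_mul_lt_mul_right h3
  have h6 := Nat.lt_of_mul_lt_mul_right h4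
  omega

lemma blockCol_support (a : ℕ → F) (n r m i u : ℕ) (hi : i < m) (j : ℕ) (hj : r * m ≤ j) :
    blockCol a n r i u j = 0 := by
  have : (i + 1) * r ≤ r * m := by rw [mul_comm r]; exact Nat.mul_le_mul_right _ hi
  rw [add_mul, one_mul] at this
  exact if_neg (by omega)

/-- The coordinates of the `i`-th block. -/
def blockProj (F : Type*) [Field F] (r i : ℕ) : (ℕ → F) →ₗ[F] (Fin r → F) where
  toFun f k := f (i * r + k)
  map_add' _ _ := rfl
  map_smul' _ _ := rfl

/-- A vector with nonzero coordinates only in the `i`-th block. -/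
def blockEmb (F : Type*) [Field F] (r i : ℕ) : (Fin r → F) →ₗ[F] (ℕ → F) where
  toFun f j := if h : i * r ≤ j ∧ j < i * r + r then f ⟨j - i * r, by omega⟩ else 0
  map_add' f g := by ext j; by_cases h : i * r ≤ j ∧ j < i * r + r <;> simp [h]
  map_smul' c f := by ext j; by_cases h : i * r ≤ j ∧ j < i * r + r <;> simp [h]

variable {n m r : ℕ} {A : Fin m → Matrix (Fin r) (Fin n) F} {a : ℕ → F}

/-- The array `a` holds the matrices `A i` one after the other and row by row. -/
def HoldsMatrices (a : ℕ → F) (A : Fin m → Matrix (Fin r) (Fin n) F) : Prop :=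
  ∀ (i : Fin m) (k : Fin r) (u : Fin n), a (((i : ℕ) * r + k) * n + u) = A i k u

lemma blockEmb_col (hA : HoldsMatrices a A) (i : Fin m) (u : Fin n) :
    blockEmb F r i ((A i).col u) = blockCol a n r i u := by
  ext j
  simp only [blockEmb, blockCol, LinearMap.coe_mk, AddHom.coe_mk]
  split_ifs with h
  · rw [Matrix.col_apply, ← hA]
    congr 3
    simp only
    omega
  · rfl

lemma blockProj_blockCol (hA : HoldsMatrices a A) (i : Fin m) (i' : ℕ) (u : Fin n) :
    blockProj F r i (blockCol a n r i' u) = if i' = i then (A i).col u else 0 := by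
  ext k
  simp only [blockProj, blockCol, LinearMap.coe_mk, AddHom.coe_mk]
  by_cases h : i' = i
  · rw [if_pos h, if_pos (by rw [h]; constructor <;> omega), hA, Matrix.col_apply]
  · rw [if_neg h, if_neg (fun h' => h (block_index_unique k.2 h'.1 h'.2)), Pi.zero_apply]

/-- Projection to block i kills every vector of another block, and embedding into block i goes back.
Thus neither the other matrices nor the columns of u already multiplied in affect the question. -/
lemma blockCol_mem_span_iff (hA : HoldsMatrices a A) (l : List (Fin n)) (u : Fin n) (i : Fin m) :
    blockCol a n r i u ∈ Submodule.span F {y | y ∈ columns a n r m (l.map Fin.val) ++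
        (List.range i).map fun i' => blockCol a n r i' u} ↔
      (A i).col u ∈ Submodule.span F ((A i).col '' {x | x ∈ l}) := by
  constructor
  · intro h
    have h1 := Submodule.mem_map_of_mem (f := blockProj F r i) h
    rw [blockProj_blockCol hA, if_pos rfl, Submodule.map_span] at h1
    refine Submodule.span_le.2 ?_ h1
    rintro _ ⟨y, hy, rfl⟩
    rcases List.mem_append.1 hy with hy | hy
    · simp only [columns, List.mem_flatMap, List.mem_map] at hy
      obtain ⟨_, ⟨v, hv, rfl⟩, i', -, rfl⟩ := hy
      rw [blockProj_blockCol hA]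
      split_ifs
      · exact Submodule.subset_span ⟨v, hv, rfl⟩
      · exact Submodule.zero_mem _
    · simp only [List.mem_map, List.mem_range] at hy
      obtain ⟨i', hi', rfl⟩ := hy
      rw [blockProj_blockCol hA, if_neg (by omega)]
      exact Submodule.zero_mem _
  · intro h
    have h1 := Submodule.mem_map_of_mem (f := blockEmb F r i) h
    rw [blockEmb_col hA, Submodule.map_span] at h1
    refine Submodule.span_mono ?_ h1
    rintro _ ⟨_, ⟨v, hv, rfl⟩, rfl⟩
    rw [blockEmb_col hA]
    refine List.mem_append.2 (Or.inl ?_)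
    simp only [columns, List.mem_flatMap, List.mem_map]
    exact ⟨v, ⟨v, hv, rfl⟩, i, List.mem_range.2 i.2, rfl⟩

/-- The columns of u are multiplied in one matrix at a time; each preserves nonvanishing exactly
when it is outside the span in its own matrix. -/
lemma colProd_concat_ne_zero (hA : HoldsMatrices a A) (l : List (Fin n)) (u : Fin n) :
    colProd a n r m ((l ++ [u]).map Fin.val) ≠ 0 ↔ colProd a n r m (l.map Fin.val) ≠ 0 ∧
      ∀ i, (A i).col u ∉ Submodule.span F ((A i).col '' {x | x ∈ l}) := by
  have key : ∀ k ≤ m, wedgeList (r * m) (columns a n r m (l.map Fin.val) ++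
      (List.range k).map fun i' => blockCol a n r i' u) unitVec ≠ 0 ↔
      colProd a n r m (l.map Fin.val) ≠ 0 ∧
      ∀ i : Fin m, (i : ℕ) < k → (A i).col u ∉ Submodule.span F ((A i).col '' {x | x ∈ l}) := by
    intro k hk
    induction k with
    | zero => simp [colProd]
    | succ k ih =>
      rw [List.range_succ, List.map_append, List.map_singleton, ← List.append_assoc,
        wedgeList_concat_ne_zero, ih (by omega),
        blockCol_mem_span_iff hA l u ⟨k, hk⟩, and_assoc, and_congr_right_iff]
      · intro _
        constructor
        · rintro ⟨h1, h2⟩ i hi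
          rcases Nat.lt_succ_iff_lt_or_eq.1 hi with hi | hi
          · exact h1 i hi
          · obtain rfl : i = ⟨k, hk⟩ := Fin.ext hi
            exact h2
        · exact fun h => ⟨fun i hi => h i (by omega), h _ (Nat.lt_succ_self k)⟩
      · intro y hy j hj
        simp only [columns, List.mem_append, List.mem_flatMap, List.mem_map, List.mem_range,
          List.mem_singleton] at hy
        rcases hy with (⟨_, -, i, hi, rfl⟩ | ⟨i, hi, rfl⟩) | rfl
        · exact blockCol_support _ _ _ _ _ _ hi _ hj
        · exact blockCol_support _ _ _ _ _ _ (by omega) _ hj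
        · exact blockCol_support _ _ _ _ _ _ (by omega) _ hj
  have h := key m le_rfl
  rw [colProd, List.map_append, columns_append]
  simp only [columns, List.map_singleton, List.flatMap_cons, List.flatMap_nil,
    List.append_nil] at h ⊢
  rw [h]
  simp

/-- A repeated element makes its column in the matrix with index 0 dependent, so repetition is
detected as soon as there is a matrix at all; this is where m ≥ 1 enters. -/
lemma colProd_map_ne_zero (hA : HoldsMatrices a A) (hm : 1 ≤ m) (l : List (Fin n)) :
    colProd a n r m (l.map Fin.val) ≠ 0 ↔
      l.Nodup ∧ ∀ i, LinearIndepOn F (A i).col {x | x ∈ l} := by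
  induction l using List.reverseRecOn with
  | nil =>
    simp [colProd, columns, wedgeList, unitVec]
  | append_singleton l u ih =>
    rw [colProd_concat_ne_zero hA, ih]
    have hset : {x | x ∈ l ++ [u]} = insert u {x | x ∈ l} := by
      ext x; simp [or_comm]
    rw [hset]
    constructor
    · rintro ⟨⟨h1, h2⟩, h3⟩
      have hu : u ∉ l := fun hu =>
        h3 ⟨0, hm⟩ (Submodule.subset_span ⟨u, hu, rfl⟩)
      refine ⟨by simpa [List.nodup_append] using ⟨h1, fun a ha h => hu (h ▸ ha)⟩, fun i => ?_⟩
      exact (linearIndepOn_insert (s := {x | x ∈ l}) hu).2 ⟨h2 i, h3 i⟩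
    · rintro ⟨h1, h2⟩
      have h1' : l.Nodup ∧ u ∉ l := by
        simp only [List.nodup_append, List.mem_singleton] at h1
        exact ⟨h1.1, fun hu => h1.2.2 u hu u rfl rfl⟩
      have h3 := fun i => (linearIndepOn_insert (s := {x | x ∈ l}) h1'.2).1 (h2 i)
      exact ⟨⟨h1'.1, fun i => (h3 i).1⟩, fun i => (h3 i).2⟩

/-- The list `l` lists the elements of `X`. -/
def Lists (l : List ℕ) (X : Finset (Fin n)) : Prop := l.toFinset = X.image Fin.val

lemma colProd_ne_zero (hA : HoldsMatrices a A) (hm : 1 ≤ m) {M : Fin m → Matroid (Fin n)}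
    (hM : ∀ i, Represents (A i) (M i)) {l : List ℕ} {X : Finset (Fin n)} (h : Lists l X) :
    colProd a n r m l ≠ 0 ↔ l.Nodup ∧ ∀ i, (M i).Indep (X : Set (Fin n)) := by
  have hl : ∀ x ∈ l, x < n := by
    intro x hx
    have : x ∈ l.toFinset := List.mem_toFinset.2 hx
    rw [h] at this
    obtain ⟨y, -, rfl⟩ := Finset.mem_image.1 this
    exact y.2
  obtain ⟨l, rfl⟩ : ∃ l' : List (Fin n), l'.map Fin.val = l :=
    ⟨l.pmap Fin.mk hl, by simp [List.map_pmap]⟩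
  have hX : {x | x ∈ l} = (X : Set (Fin n)) := by
    ext x
    have := congrArg (fun s => (x : ℕ) ∈ s) h
    simpa [Fin.val_inj] using this
  rw [colProd_map_ne_zero hA hm, List.nodup_map_iff Fin.val_injective, hX]
  exact and_congr_right fun _ => forall_congr' fun i => ((hM i).2 _).symm

lemma Lists.append {l l' : List ℕ} {X Y : Finset (Fin n)} (h : Lists l X) (h' : Lists l' Y) :
    Lists (l ++ l') (X ∪ Y) := by
  rw [Lists, List.toFinset_append, h, h', Finset.image_union]

lemma Lists.disjoint {l l' : List ℕ} {X Y : Finset (Fin n)} (h : Lists l X) (h' : Lists l' Y)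
    (hd : l.Disjoint l') : Disjoint X Y := by
  rw [Finset.disjoint_left]
  intro x hx hy
  have hx' : (x : ℕ) ∈ l.toFinset := h ▸ Finset.mem_image_of_mem _ hx
  have hy' : (x : ℕ) ∈ l'.toFinset := h' ▸ Finset.mem_image_of_mem _ hy
  exact hd (List.mem_toFinset.1 hx') (List.mem_toFinset.1 hy')

lemma Lists.list_disjoint {l l' : List ℕ} {X Y : Finset (Fin n)} (h : Lists l X) (h' : Lists l' Y)
    (hd : Disjoint X Y) : l.Disjoint l' := by
  intro x hx hy
  rw [← List.mem_toFinset, h, Finset.mem_image] at hx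
  rw [← List.mem_toFinset, h', Finset.mem_image] at hy
  obtain ⟨x', hx, rfl⟩ := hx
  obtain ⟨y, hy, hxy⟩ := hy
  rw [Fin.val_inj] at hxy
  exact Finset.disjoint_left.1 hd hx (hxy ▸ hy)

lemma Lists.card {l : List ℕ} {X : Finset (Fin n)} (h : Lists l X) (hl : l.Nodup) :
    X.card = l.length := by
  rw [← List.toFinset_card_of_nodup hl, h, Finset.card_image_of_injective _ Fin.val_injective]

lemma exists_lists (X : Finset (Fin n)) : ∃ l : List ℕ, l.Nodup ∧ Lists l X :=
  ⟨X.toList.map Fin.val, X.nodup_toList.map Fin.val_injective, by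
    ext x; simp⟩

/-- If `X` is in the span of some products, one of these can replace `X` in an extension. -/
lemma exists_extension {l l' : List ℕ} {s : Set (List ℕ)}
    (h : colProd a n r m l ∈ Submodule.span F (colProd a n r m '' s))
    (h' : colProd a n r m (l ++ l') ≠ 0) : ∃ k ∈ s, colProd a n r m (k ++ l') ≠ 0 := by
  by_contra! hk
  apply h'
  rw [colProd_append]
  -- If every extension vanished, the linear operator of multiplication by the columns of l' would
  -- kill all generators, hence their span, which contains the product of l.
  have : Submodule.span F (colProd a n r m '' s) ≤
      LinearMap.ker (wedgeList (r * m) (columns a n r m l')) := by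
    rw [Submodule.span_le]
    rintro _ ⟨k, hks, rfl⟩
    have := hk k hks
    rwa [colProd_append] at this
  exact this h

end Columns

/-! ## Greedy elimination -/

section Elimination

variable {F : Type*} [Field F]

/-- The state of the elimination after the coordinates below `q` have been treated. The vectors
`cur c` are what is left of the vectors `orig c` of weight `wt c`, where `c < N`; the vectors with
the indices `sel k`, `k < K`, have been selected. -/
structure ElimInv (P : Finset ℕ) (orig : ℕ → ℕ → F) (wt : ℕ → ℝ) (N q K : ℕ) (sel : ℕ → ℕ)
    (cur : ℕ → ℕ → F) : Prop where
  sel_lt : ∀ k < K, sel k < N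
  support : ∀ c < N, ∀ z ∉ P, cur c z = 0
  vanish : ∀ c < N, ∀ z < q, cur c z = 0
  rep : ∀ c < N, orig c - cur c ∈
    Submodule.span F ((fun k => orig (sel k)) '' {k | k < K ∧ wt c ≤ wt (sel k)})
  inj : ∀ f ∈ Submodule.span F ((fun k => orig (sel k)) '' {k | k < K}),
    (∀ z < q, f z = 0) → f = 0
  count : K ≤ (P.filter (· < q)).card
  indep : ∀ k < K, orig (sel k) ∉ Submodule.span F ((fun k => orig (sel k)) '' {j | j < k})

variable {P : Finset ℕ} {orig : ℕ → ℕ → F} {wt : ℕ → ℝ} {N q K : ℕ} {sel : ℕ → ℕ}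
  {cur : ℕ → ℕ → F}

lemma ElimInv.init (h : ∀ c < N, ∀ z ∉ P, orig c z = 0) :
    ElimInv P orig wt N 0 0 sel orig where
  sel_lt := by simp
  support := h
  vanish := by simp
  rep := by simp
  inj := by
    intro f hf _
    simpa using hf
  count := by simp
  indep := by simp

lemma ElimInv.skip (h : ElimInv P orig wt N q K sel cur) (hq : ∀ c < N, cur c q = 0) :
    ElimInv P orig wt N (q + 1) K sel cur where
  sel_lt := h.sel_lt
  support := h.support
  vanish c hc z hz := by
    rcases Nat.lt_succ_iff_lt_or_eq.1 hz with hz | rfl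
    · exact h.vanish c hc z hz
    · exact hq c hc
  rep := h.rep
  inj f hf hz := h.inj f hf fun z hz' => hz z (by omega)
  count := h.count.trans (Finset.card_le_card fun z => by
    simp only [Finset.mem_filter]
    exact fun h => ⟨h.1, Nat.lt_succ_of_lt h.2⟩)
  indep := h.indep

lemma ElimInv.sub_mem (h : ElimInv P orig wt N q K sel cur) {c : ℕ} (hc : c < N) :
    orig c - cur c ∈ Submodule.span F ((fun k => orig (sel k)) '' {k | k < K}) :=
  Submodule.span_mono (Set.image_mono fun _ hk => hk.1) (h.rep c hc)

/-- The pivot b is heaviest only among the candidates with a nonzero coordinate q, which is enough: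
only these are changed, and what is subtracted from them is a multiple of `cur b`, a combination of
selected vectors of weight at least `wt b`. No sorting by weight is needed. -/
lemma ElimInv.step (h : ElimInv P orig wt N q K sel cur) {b : ℕ} (hb : b < N) (hbq : cur b q ≠ 0)
    (hmax : ∀ c < N, cur c q ≠ 0 → wt c ≤ wt b) :
    ElimInv P orig wt N (q + 1) (K + 1) (Function.update sel K b)
      (fun c z => cur c z - cur c q * (cur b q)⁻¹ * cur b z) := by
  have hold : ∀ k < K, Function.update sel K b k = sel k := fun k hk =>
    Function.update_of_ne (by omega) _ _
  have hnew : Function.update sel K b K = b := Function.update_self _ _ _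
  have himg : ∀ p : ℕ → Prop, (∀ k, p k → k < K) →
      (fun k => orig (Function.update sel K b k)) '' {k | p k} =
        (fun k => orig (sel k)) '' {k | p k} := by
    intro p hp
    apply Set.image_congr
    intro k hk
    rw [hold k (hp k hk)]
  have hW : (fun k => orig (Function.update sel K b k)) '' {k | k < K + 1} =
      insert (orig b) ((fun k => orig (sel k)) '' {k | k < K}) := by
    have : {k | k < K + 1} = insert K {k | k < K} := by ext k; simp; omega
    rw [this, Set.image_insert_eq, hnew, himg _ (fun _ h => h)]
  refine ⟨?_, ?_, ?_, ?_, ?_, ?_, ?_⟩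
  · intro k hk
    rcases Nat.lt_succ_iff_lt_or_eq.1 hk with hk | rfl
    · rw [hold k hk]; exact h.sel_lt k hk
    · rwa [hnew]
  · intro c hc z hz
    simp only [h.support c hc z hz, h.support b hb z hz, mul_zero, sub_zero]
  · intro c hc z hz
    rcases Nat.lt_succ_iff_lt_or_eq.1 hz with hz | rfl
    · simp only [h.vanish c hc z hz, h.vanish b hb z hz, mul_zero, sub_zero]
    · field_simp
      simp
  · intro c hc
    have hmono : ∀ c' : ℕ, wt c ≤ wt c' → orig c' - cur c' ∈
        Submodule.span F ((fun k => orig (sel k)) '' {k | k < K ∧ wt c' ≤ wt (sel k)}) →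
        orig c' - cur c' ∈ Submodule.span F ((fun k => orig (Function.update sel K b k)) ''
          {k | k < K + 1 ∧ wt c ≤ wt (Function.update sel K b k)}) := by
      intro c' hc' hmem
      refine Submodule.span_mono ?_ hmem
      rintro _ ⟨k, ⟨hk, hk'⟩, rfl⟩
      refine ⟨k, ⟨by omega, ?_⟩, ?_⟩
      · rw [hold k hk]; exact hc'.trans hk'
      · simp only [hold k hk]
    have h1 := hmono c le_rfl (h.rep c hc)
    by_cases hcq : cur c q = 0
    · have : (orig c - fun z => cur c z - cur c q * (cur b q)⁻¹ * cur b z) = orig c - cur c := by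
        ext z; simp [hcq]
      rw [this]
      exact h1
    · have hcb := hmax c hc hcq
      have h2 := hmono b hcb (h.rep b hb)
      have h3 : orig b ∈ Submodule.span F ((fun k => orig (Function.update sel K b k)) ''
          {k | k < K + 1 ∧ wt c ≤ wt (Function.update sel K b k)}) :=
        Submodule.subset_span ⟨K, ⟨by omega, by rwa [hnew]⟩, by simp only [hnew]⟩
      have : (orig c - fun z => cur c z - cur c q * (cur b q)⁻¹ * cur b z) =
          (orig c - cur c) + (cur c q * (cur b q)⁻¹) • (orig b - (orig b - cur b)) := by
        ext z; simp; ring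
      rw [this]
      exact Submodule.add_mem _ h1 (Submodule.smul_mem _ _ (Submodule.sub_mem _ h3 h2))
  -- Let f = x·orig b + s vanish up to coordinate q. Replacing `orig b` by `cur b` changes f within
  -- the old span, where injectivity below q gives f = x·cur b. The coordinate q then forces x = 0.
  · intro f hf hz
    rw [hW, Submodule.mem_span_insert] at hf
    obtain ⟨x, s, hs, rfl⟩ := hf
    have h1 : x • (orig b - cur b) + s = 0 := by
      apply h.inj
      · exact Submodule.add_mem _ (Submodule.smul_mem _ _ (h.sub_mem hb)) hs
      · intro z hzq
        have := hz z (by omega)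
        simp only [Pi.add_apply, Pi.smul_apply, Pi.sub_apply, smul_eq_mul,
          h.vanish b hb z hzq] at this ⊢
        simpa using this
    have h2 : x • orig b + s = x • cur b := by
      rw [smul_sub] at h1
      rw [← sub_eq_zero, ← h1]; abel
    rw [h2] at hz ⊢
    have := hz q (by omega)
    simp only [Pi.smul_apply, smul_eq_mul, mul_eq_zero, hbq, or_false] at this
    rw [this, zero_smul]
  -- Each selection uses up its own coordinate of P, which bounds the number of selections.
  · have hqP : q ∈ P := by
      by_contra hqP
      exact hbq (h.support b hb q hqP)
    have : P.filter (· < q + 1) = insert q (P.filter (· < q)) := by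
      ext z
      simp only [Finset.mem_filter, Finset.mem_insert]
      constructor
      · rintro ⟨h1, h2⟩
        by_cases hz : z = q
        · exact Or.inl hz
        · exact Or.inr ⟨h1, by omega⟩
      · rintro (rfl | ⟨h1, h2⟩)
        · exact ⟨hqP, by omega⟩
        · exact ⟨h1, by omega⟩
    rw [this, Finset.card_insert_of_notMem (by simp)]
    have := h.count
    omega
  · intro k hk
    rcases Nat.lt_succ_iff_lt_or_eq.1 hk with hk | rfl
    · rw [hold k hk, himg _ (fun _ h => h.trans hk)]
      exact h.indep k hk
    -- If `orig b` were in the old span, so would be `cur b`; vanishing below q, it would be zero,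
    -- contrary to the choice of b.
    · rw [hnew, himg _ (fun _ h => h)]
      intro hmem
      have h1 : cur b = 0 := by
        apply h.inj
        · have := Submodule.sub_mem _ hmem (h.sub_mem hb)
          rwa [sub_sub_cancel] at this
        · exact fun z hz => h.vanish b hb z hz
      exact hbq (by rw [h1]; rfl)

/-- Once all coordinates of P are treated, nothing is left of any candidate, so the selected vectors
form a maximum weight basis. -/
lemma ElimInv.mem_span (h : ElimInv P orig wt N q K sel cur) (hP : ∀ z ∈ P, z < q) {c : ℕ}
    (hc : c < N) : orig c ∈
      Submodule.span F ((fun k => orig (sel k)) '' {k | k < K ∧ wt c ≤ wt (sel k)}) := by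
  have h1 : cur c = 0 := by
    ext z
    by_cases hz : z ∈ P
    · exact h.vanish c hc z (hP z hz)
    · exact h.support c hc z hz
  have := h.rep c hc
  rwa [h1, sub_zero] at this

end Elimination

/-! ## Disjoint unions -/

section Unions

variable {U : Type*} [DecidableEq U] {𝓗 : Finset (Finset U)}

lemma disjointUnions_zero : disjointUnions 𝓗 0 = {∅} := by
  ext X
  simp only [disjointUnions, Set.mem_ofPred_eq, Set.mem_singleton_iff]
  constructor
  · rintro ⟨H, -, -, rfl⟩
    simp
  · rintro rfl
    exact ⟨fun _ => ∅, fun j => j.elim0, fun j => j.elim0, by simp⟩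

lemma card_of_mem_disjointUnions {γ k : ℕ} (h𝓗 : ∀ H ∈ 𝓗, H.card = γ) {X : Finset U}
    (hX : X ∈ disjointUnions 𝓗 k) : X.card = k * γ := by
  obtain ⟨H, hH, hd, rfl⟩ := hX
  rw [Finset.card_biUnion (fun i _ j _ hij => hd hij), Finset.sum_congr rfl
    (fun j _ => h𝓗 _ (hH j))]
  simp

lemma union_mem_disjointUnions {k : ℕ} {S H : Finset U} (hS : S ∈ disjointUnions 𝓗 k)
    (hH : H ∈ 𝓗) (hd : Disjoint S H) : S ∪ H ∈ disjointUnions 𝓗 (k + 1) := by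
  obtain ⟨G, hG, hG', rfl⟩ := hS
  have hdj : ∀ j, Disjoint (G j) H := fun j =>
    hd.mono_left (Finset.subset_biUnion_of_mem G (Finset.mem_univ j))
  refine ⟨Fin.snoc G H, ?_, ?_, ?_⟩
  · intro j
    refine Fin.lastCases ?_ (fun j => ?_) j
    · simpa using hH
    · simpa using hG j
  · intro i j hij
    induction i using Fin.lastCases with
    | last =>
      induction j using Fin.lastCases with
      | last => exact absurd rfl hij
      | cast j => simpa using (hdj j).symm
    | cast i =>
      induction j using Fin.lastCases with
      | last => simpa using hdj i
      | cast j => simpa using hG' (fun h => hij (congrArg Fin.castSucc h))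
  · ext x
    simp only [Finset.mem_union, Finset.mem_biUnion, Finset.mem_univ, true_and,
      Fin.exists_fin_succ', Fin.snoc_castSucc, Fin.snoc_last]

end Unions

/-! ## One layer of the dynamic program -/

section Layer

variable {F : Type*} [Field F] {n m r α β γ t : ℕ} {M : Fin m → Matroid (Fin n)}
  {A : Fin m → Matrix (Fin r) (Fin n) F} {a : ℕ → F} {𝓗 : Finset (Finset (Fin n))}
  {w : Finset (Fin n) → ℝ} {g : ℝ → Finset (Fin n) → ℝ} {O : ℝ → ℕ → ℝ} {Hl : ℕ → List ℕ}

/-- The lists `Hl j` list the members of `𝓗`, and the oracle refers to this list. -/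
structure ListsOracle (𝓗 : Finset (Finset (Fin n))) (g : ℝ → Finset (Fin n) → ℝ) (O : ℝ → ℕ → ℝ)
    (t γ : ℕ) (Hl : ℕ → List ℕ) : Prop where
  length : ∀ j < t, (Hl j).length = γ
  mem : ∀ j < t, ∃ H ∈ 𝓗, Lists (Hl j) H ∧ ∀ x, O x j = g x H
  surj : ∀ H ∈ 𝓗, ∃ j < t, (Hl j).Nodup ∧ Lists (Hl j) H ∧ ∀ x, O x j = g x H

/-- The lists `S k` with weights at most `wt k`, `k < K`, represent the disjoint unions of `i`
members of `𝓗`. -/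
structure LayerInv (M : Fin m → Matroid (Fin n)) (a : ℕ → F) (r γ : ℕ)
    (𝓗 : Finset (Finset (Fin n))) (w : Finset (Fin n) → ℝ) (i K : ℕ) (S : ℕ → List ℕ)
    (wt : ℕ → ℝ) : Prop where
  length : ∀ k < K, (S k).length = i * γ
  ne_zero : ∀ k < K, colProd a n r m (S k) ≠ 0
  sound : ∀ k < K, ∃ X ∈ disjointUnions 𝓗 i, Lists (S k) X ∧ wt k ≤ w X
  distinct : ∀ k < K, ∀ j < k,
    colProd a n r m (S k) ∉ Submodule.span F {colProd a n r m (S j)}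
  complete : ∀ X ∈ disjointUnions 𝓗 i, ∀ (Y : Finset (Fin n)) (l : List ℕ), l.Nodup → Lists l Y →
    Disjoint X Y → (∀ i, (M i).Indep ((X ∪ Y : Finset (Fin n)) : Set (Fin n))) →
      ∃ k < K, colProd a n r m (S k ++ l) ≠ 0 ∧ w X ≤ wt k
  bound : K ≤ (r * m).choose (i * γ * m)

lemma LayerInv.init (hA : HoldsMatrices a A) (hm : 1 ≤ m) (hM : ∀ i, Represents (A i) (M i))
    {S : ℕ → List ℕ} {wt : ℕ → ℝ} (hS : S 0 = []) (hwt : wt 0 = w ∅) :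
    LayerInv M a r γ 𝓗 w 0 1 S wt where
  length k hk := by
    obtain rfl : k = 0 := by omega
    simp [hS]
  ne_zero k hk := by
    obtain rfl : k = 0 := by omega
    rw [hS, colProd_ne_zero hA hm hM (X := ∅) (by simp [Lists])]
    simp
  sound k hk := by
    obtain rfl : k = 0 := by omega
    exact ⟨∅, by simp [disjointUnions_zero], by simp [Lists, hS], hwt.le⟩
  distinct k hk j hj := by omega
  complete X hX Y l hl hY _ hi := by
    obtain rfl : X = ∅ := by simpa [disjointUnions_zero] using hX
    refine ⟨0, by omega, ?_, hwt.ge⟩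
    rw [hS, List.nil_append, colProd_ne_zero hA hm hM hY]
    exact ⟨hl, by simpa using hi⟩
  bound := by simp

/-- Soundness: g(wt k, H) ≤ g(w(X), H) ≤ w(X ⊎ H), by monotonicity and by the maximum defining w.
Completeness: decompose X as S' ⊎ H attaining w(X), let a kept set replace S' in the presence of H ⊎
Y, then let a selected candidate replace that kept set joined with H. -/
lemma LayerInv.step (hA : HoldsMatrices a A) (hm : 1 ≤ m) (hM : ∀ i, Represents (A i) (M i))
    (hγ : 1 ≤ γ) (h𝓗 : ∀ H ∈ 𝓗, H.card = γ) (hg : Generates 𝓗 g w)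
    (hO : ListsOracle 𝓗 g O t γ Hl) {i K K' : ℕ} {S cl : ℕ → List ℕ} {wt cw : ℕ → ℝ}
    {sel : ℕ → ℕ} {cur : ℕ → ℕ → F} (h : LayerInv M a r γ 𝓗 w i K S wt)
    (hcl : ∀ k < K, ∀ j < t, cl (k * t + j) = S k ++ Hl j)
    (hcw : ∀ k < K, ∀ j < t, cw (k * t + j) = O (wt k) j)
    (hE : ElimInv (masks (r * m) ((i + 1) * γ * m)) (fun c => colProd a n r m (cl c)) cw
      (K * t) (2 ^ (r * m)) K' sel cur) :
    LayerInv M a r γ 𝓗 w (i + 1) K' (fun k => cl (sel k)) (fun k => cw (sel k)) := by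
  have hcand : ∀ c < K * t, ∃ k < K, ∃ j < t, c = k * t + j := by
    intro c hc
    have ht : 0 < t := by
      rcases Nat.eq_zero_or_pos t with rfl | ht
      · simp at hc
      · exact ht
    exact ⟨c / t, Nat.div_lt_of_lt_mul (by rwa [mul_comm]), c % t, Nat.mod_lt _ ht,
      by rw [mul_comm, Nat.div_add_mod]⟩
  -- A zero product is never selected. Candidates whose parts overlap, or whose union is dependent
  -- in some matroid, thus disappear without any test.
  have hne : ∀ k < K', colProd a n r m (cl (sel k)) ≠ 0 := by
    intro k hk h0
    apply hE.indep k hk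
    simp only [h0]
    exact Submodule.zero_mem _
  refine ⟨?_, hne, ?_, ?_, ?_, ?_⟩
  · intro k hk
    obtain ⟨k', hk', j, hj, he⟩ := hcand _ (hE.sel_lt k hk)
    simp only [he, hcl k' hk' j hj, List.length_append, h.length k' hk', hO.length j hj]
    ring
  · intro k hk
    obtain ⟨k', hk', j, hj, he⟩ := hcand _ (hE.sel_lt k hk)
    have h0 := hne k hk
    simp only [he, hcl k' hk' j hj, hcw k' hk' j hj] at h0 ⊢
    obtain ⟨X, hX, hlX, hwX⟩ := h.sound k' hk'
    obtain ⟨H, hH, hlH, hOH⟩ := hO.mem j hj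
    have hl := hlX.append hlH
    rw [colProd_ne_zero hA hm hM hl] at h0
    have hd := hlX.disjoint hlH (List.disjoint_of_nodup_append h0.1)
    have hmem := union_mem_disjointUnions hX hH hd
    refine ⟨X ∪ H, hmem, hl, ?_⟩
    rw [hOH]
    refine (hg.mono H hH hwX).trans ((hg.isGreatest (X ∪ H) ⟨_, hmem⟩ ?_).2
      ⟨H, hH, X, ⟨_, hX⟩, hd, rfl, rfl⟩)
    intro h0
    have := card_of_mem_disjointUnions h𝓗 hmem
    rw [h0, Finset.card_empty, add_mul] at this
    omega
  · intro k hk j hj hmem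
    refine hE.indep k hk (Submodule.span_mono ?_ hmem)
    rintro _ rfl
    exact ⟨j, hj, rfl⟩
  · intro X hX Y l hl hlY hd hi
    have hcX := card_of_mem_disjointUnions h𝓗 hX
    have hX0 : X ≠ ∅ := by
      rintro rfl
      rw [Finset.card_empty, add_mul] at hcX
      omega
    obtain ⟨H, hH, S', ⟨i', hS'⟩, hdS, rfl, hw⟩ := (hg.isGreatest X ⟨_, hX⟩ hX0).1
    -- The maximum defining w ranges over unions of any number of members; since γ ≥ 1, the
    -- cardinality fixes that number.
    obtain rfl : i' = i := by
      rw [Finset.card_union_of_disjoint hdS, card_of_mem_disjointUnions h𝓗 hS', h𝓗 H hH,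
        add_mul, one_mul] at hcX
      exact Nat.eq_of_mul_eq_mul_right hγ (by omega)
    obtain ⟨j, hj, hjn, hlH, hOH⟩ := hO.surj H hH
    rw [Finset.disjoint_union_left] at hd
    -- The member H is treated as part of the set to be avoided, so that the replacement of S'
    -- remains compatible with both H and Y.
    obtain ⟨k, hk, hk0, hkw⟩ := h.complete S' hS' (H ∪ Y) (Hl j ++ l)
      (hjn.append hl (hlH.list_disjoint hlY hd.2)) (hlH.append hlY)
      (Finset.disjoint_union_right.2 ⟨hdS, hd.1⟩) (by rwa [← Finset.union_assoc])
    have hcN : k * t + j < K * t := by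
      have : (k + 1) * t ≤ K * t := Nat.mul_le_mul_right _ hk
      rw [add_mul] at this
      omega
    have hspan := hE.mem_span (fun z hz => by
      simpa using Finset.mem_range.1 (Finset.filter_subset _ _ hz)) hcN
    rw [← List.append_assoc, ← hcl k hk j hj] at hk0
    obtain ⟨_, ⟨k', ⟨hk', hw'⟩, rfl⟩, hne'⟩ := exists_extension
      (s := (fun k => cl (sel k)) '' {k' | k' < K' ∧ cw (k * t + j) ≤ cw (sel k')})
      (by rwa [Set.image_image]) hk0
    refine ⟨k', hk', hne', ?_⟩
    rw [hw]
    refine le_trans ?_ hw'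
    rw [hcw k hk j hj, hOH]
    exact hg.mono H hH hkw
  · exact hE.count.trans ((Finset.card_filter_le _ _).trans (card_masks_le _ _))

/-- The lists of a layer describe a representative family. -/
lemma LayerInv.isMaxIntersectionRep (hA : HoldsMatrices a A) (hm : 1 ≤ m)
    (hM : ∀ i, Represents (A i) (M i)) {i K q : ℕ} {S : ℕ → List ℕ} {wt : ℕ → ℝ}
    (h : LayerInv M a r γ 𝓗 w i K S wt) :
    ∃ 𝓡 : Finset (Finset (Fin n)), 𝓡.card = K ∧ (∀ X ∈ 𝓡, X.card = i * γ) ∧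
      𝓡.image (fun X => X.image Fin.val) = (Finset.range K).image (fun k => (S k).toFinset) ∧
      IsMaxIntersectionRep M q w (commonIndepUnions M 𝓗 i) (𝓡 : Set (Finset (Fin n))) := by
  choose! X hX hlX hwX using h.sound
  have hnod := fun k hk => (colProd_ne_zero hA hm hM (hlX k hk)).1 (h.ne_zero k hk)
  refine ⟨(Finset.range K).image X, ?_, ?_, ?_, ?_, ?_⟩
  · rw [Finset.card_image_of_injOn, Finset.card_range]
    -- Two enumerations of one set have proportional products, which `distinct` excludes; hence the
    -- K lists give K sets.
    have key : ∀ k < K, ∀ j < k, X k ≠ X j := by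
      intro k hk j hj he
      apply h.distinct k hk j hj
      apply colProd_perm
      rw [List.perm_ext_iff_of_nodup (hnod k hk).1 (hnod j (hj.trans hk)).1]
      intro x
      rw [← List.mem_toFinset, ← List.mem_toFinset, hlX k hk, hlX j (hj.trans hk), he]
    intro k hk j hj he
    simp only [Finset.coe_range, Set.mem_Iio] at hk hj
    rcases lt_trichotomy k j with hkj | hkj | hkj
    · exact absurd he.symm (key j hj k hkj)
    · exact hkj
    · exact absurd he (key k hk j hkj)
  · intro Y hY
    obtain ⟨k, hk, rfl⟩ := Finset.mem_image.1 hY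
    have hk := Finset.mem_range.1 hk
    rw [(hlX k hk).card (hnod k hk).1, h.length k hk]
  · rw [Finset.image_image]
    apply Finset.image_congr
    intro k hk
    simp only [Finset.coe_range, Set.mem_Iio] at hk
    exact (hlX k hk).symm
  · intro Y hY
    obtain ⟨k, hk, rfl⟩ := Finset.mem_image.1 (Finset.mem_coe.1 hY)
    have hk := Finset.mem_range.1 hk
    exact ⟨hX k hk, (hnod k hk).2⟩
  -- The weights are compared by w(Z) ≤ wt k ≤ w(X k), from completeness and soundness.
  · intro Y _ Z hZ hd hi
    obtain ⟨l, hl, hlY⟩ := exists_lists Y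
    obtain ⟨k, hk, hk0, hw⟩ := h.complete Z hZ.1 Y l hl hlY hd hi
    rw [colProd_ne_zero hA hm hM ((hlX k hk).append hlY)] at hk0
    exact ⟨X k, Finset.mem_coe.2 (Finset.mem_image_of_mem _ (Finset.mem_range.2 hk)),
      (hlX k hk).disjoint hlY (List.disjoint_of_nodup_append hk0.1), hk0.2,
      hw.trans (hwX k hk)⟩

end Layer

/-! ## Verification of programs -/

section Verification

variable {F : Type*}

def State.setN (s : State F) (a i v : ℕ) : State F := { s with nat := store s.nat a i v }

def State.setF (s : State F) (a i : ℕ) (v : F) : State F := { s with fld := store s.fld a i v }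

def State.setR (s : State F) (a i : ℕ) (v : ℝ) : State F := { s with real := store s.real a i v }

section Lookup

variable (s : State F) (a b i : ℕ)

@[simp] lemma setN_nat_self (v : ℕ) : (s.setN a i v).nat a = Function.update (s.nat a) i v := by
  simp [State.setN, store]

@[simp] lemma setN_nat_ne (v : ℕ) (h : b ≠ a) : (s.setN a i v).nat b = s.nat b := by
  simp [State.setN, store, h]

@[simp] lemma setN_fld (v : ℕ) : (s.setN a i v).fld = s.fld := rfl

@[simp] lemma setN_real (v : ℕ) : (s.setN a i v).real = s.real := rfl

@[simp] lemma setF_fld_self (v : F) : (s.setF a i v).fld a = Function.update (s.fld a) i v := by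
  simp [State.setF, store]

@[simp] lemma setF_fld_ne (v : F) (h : b ≠ a) : (s.setF a i v).fld b = s.fld b := by
  simp [State.setF, store, h]

@[simp] lemma setF_nat (v : F) : (s.setF a i v).nat = s.nat := rfl

@[simp] lemma setR_real_self (v : ℝ) : (s.setR a i v).real a = Function.update (s.real a) i v := by
  simp [State.setR, store]

@[simp] lemma setR_real_ne (v : ℝ) (h : b ≠ a) : (s.setR a i v).real b = s.real b := by
  simp [State.setR, store, h]

@[simp] lemma setR_nat (v : ℝ) : (s.setR a i v).nat = s.nat := rfl

@[simp] lemma setR_fld (v : ℝ) : (s.setR a i v).fld = s.fld := rfl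

end Lookup

/-- The program does not write to the array `a` of natural numbers. -/
def Program.keepsNat (a : ℕ) : Program → Bool
  | .skip => true
  | .setNat b _ _ => !Nat.beq b a
  | .setFld _ _ _ => true
  | .setReal _ _ _ => true
  | .seq p q => p.keepsNat a && q.keepsNat a
  | .cond _ p q => p.keepsNat a && q.keepsNat a
  | .loop _ p => p.keepsNat a

/-- The program does not write to the array `a` of field elements. -/
def Program.keepsFld (a : ℕ) : Program → Bool
  | .skip => true
  | .setNat _ _ _ => true
  | .setFld b _ _ => !Nat.beq b a
  | .setReal _ _ _ => true
  | .seq p q => p.keepsFld a && q.keepsFld a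
  | .cond _ p q => p.keepsFld a && q.keepsFld a
  | .loop _ p => p.keepsFld a

/-- The program does not write to the array `a` of real numbers. -/
def Program.keepsReal (a : ℕ) : Program → Bool
  | .skip => true
  | .setNat _ _ _ => true
  | .setFld _ _ _ => true
  | .setReal b _ _ => !Nat.beq b a
  | .seq p q => p.keepsReal a && q.keepsReal a
  | .cond _ p q => p.keepsReal a && q.keepsReal a
  | .loop _ p => p.keepsReal a

/-- The states `s` and `s'` agree on the arrays to which `p` does not write. -/
structure Frame (p : Program) (s s' : State F) : Prop where
  nat : ∀ a, p.keepsNat a = true → s'.nat a = s.nat a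
  fld : ∀ a, p.keepsFld a = true → s'.fld a = s.fld a
  real : ∀ a, p.keepsReal a = true → s'.real a = s.real a

lemma Frame.refl (p : Program) (s : State F) : Frame p s s :=
  ⟨fun _ _ => rfl, fun _ _ => rfl, fun _ _ => rfl⟩

lemma Frame.trans {p : Program} {s s' s'' : State F} (h : Frame p s s') (h' : Frame p s' s'') :
    Frame p s s'' :=
  ⟨fun a ha => (h'.nat a ha).trans (h.nat a ha), fun a ha => (h'.fld a ha).trans (h.fld a ha),
    fun a ha => (h'.real a ha).trans (h.real a ha)⟩

lemma Frame.mono {p q : Program} {s s' : State F} (h : Frame p s s')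
    (hn : ∀ a, q.keepsNat a = true → p.keepsNat a = true)
    (hf : ∀ a, q.keepsFld a = true → p.keepsFld a = true)
    (hr : ∀ a, q.keepsReal a = true → p.keepsReal a = true) : Frame q s s' :=
  ⟨fun a ha => h.nat a (hn a ha), fun a ha => h.fld a (hf a ha), fun a ha => h.real a (hr a ha)⟩

/-- The parameters of the input, the number `d` of coordinates and the number `D` of masks. -/
structure Params (s : State F) (n m r γ t d D : ℕ) : Prop where
  n_eq : s.nat 0 0 = n
  m_eq : s.nat 0 1 = m
  r_eq : s.nat 0 2 = r
  γ_eq : s.nat 0 5 = γ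
  t_eq : s.nat 0 6 = t
  d_eq : s.nat 0 7 = d
  D_eq : s.nat 0 8 = D

lemma Params.of_frame {n m r γ t d D : ℕ} {p : Program} {s' : State F}
    (h : Params s n m r γ t d D) (hf : Frame p s s') (hp : p.keepsNat 0 = true) :
    Params s' n m r γ t d D := by
  have := hf.nat 0 hp
  constructor <;> rw [this]
  exacts [h.n_eq, h.m_eq, h.r_eq, h.γ_eq, h.t_eq, h.d_eq, h.D_eq]

variable [Field F] {O : ℝ → ℕ → ℝ}

/-- Whether a program writes to an array is a Boolean computed from its text, so for concrete
programs the side conditions hold by `rfl`, and loop invariants need to mention only what changes.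
-/
lemma Runs.frame {p : Program} {s s' : State F} {T : ℕ} (h : Runs O p s s' T) : Frame p s s' := by
  induction h with
  | skip s => exact Frame.refl _ _
  | setNat s a i e =>
    refine ⟨fun b hb => ?_, fun _ _ => rfl, fun _ _ => rfl⟩
    have : b ≠ a := by rintro rfl; simp [Program.keepsNat] at hb
    exact setN_nat_ne s a b _ _ this
  | setFld s a i e =>
    refine ⟨fun _ _ => rfl, fun b hb => ?_, fun _ _ => rfl⟩
    have : b ≠ a := by rintro rfl; simp [Program.keepsFld] at hb
    exact setF_fld_ne s a b _ _ this
  | setReal s a i e =>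
    refine ⟨fun _ _ => rfl, fun _ _ => rfl, fun b hb => ?_⟩
    have : b ≠ a := by rintro rfl; simp [Program.keepsReal] at hb
    exact setR_real_ne s a b _ _ this
  | seq _ _ ih ih' =>
    refine (ih.mono (q := .seq _ _) ?_ ?_ ?_).trans (ih'.mono ?_ ?_ ?_)
    · exact fun _ ha => (Bool.and_eq_true_iff.1 ha).1
    · exact fun _ ha => (Bool.and_eq_true_iff.1 ha).1
    · exact fun _ ha => (Bool.and_eq_true_iff.1 ha).1
    · exact fun _ ha => (Bool.and_eq_true_iff.1 ha).2
    · exact fun _ ha => (Bool.and_eq_true_iff.1 ha).2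
    · exact fun _ ha => (Bool.and_eq_true_iff.1 ha).2
  | condTrue _ _ ih =>
    exact ih.mono (fun _ ha => (Bool.and_eq_true_iff.1 ha).1)
      (fun _ ha => (Bool.and_eq_true_iff.1 ha).1) (fun _ ha => (Bool.and_eq_true_iff.1 ha).1)
  | condFalse _ _ ih =>
    exact ih.mono (fun _ ha => (Bool.and_eq_true_iff.1 ha).2)
      (fun _ ha => (Bool.and_eq_true_iff.1 ha).2) (fun _ ha => (Bool.and_eq_true_iff.1 ha).2)
  | loopDone _ => exact Frame.refl _ _
  | loopStep _ _ _ ih ih' =>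
    exact (ih.mono (q := .loop _ _) (fun _ ha => ha) (fun _ ha => ha) (fun _ ha => ha)).trans ih'

/-- Started in `s`, the program `p` halts after time at most `T` in a state that satisfies `Q`. -/
def Spec (O : ℝ → ℕ → ℝ) (p : Program) (s : State F) (T : ℕ) (Q : State F → Prop) : Prop :=
  ∃ s' T', Runs O p s s' T' ∧ T' ≤ T ∧ Q s'

variable {s : State F} {T : ℕ} {Q : State F → Prop}

lemma Spec.conseq {p : Program} {T₁ : ℕ} {Q₁ : State F → Prop} (h : Spec O p s T₁ Q₁)
    (hT : T₁ ≤ T) (hQ : ∀ s', Frame p s s' → Q₁ s' → Q s') : Spec O p s T Q := by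
  obtain ⟨s', T', hr, hT', hq⟩ := h
  exact ⟨s', T', hr, hT'.trans hT, hQ s' hr.frame hq⟩

lemma Spec.skip (hT : 1 ≤ T) (hQ : Q s) : Spec O .skip s T Q :=
  ⟨s, 1, .skip s, hT, hQ⟩

lemma Spec.setNat {a : ℕ} {i e : NatExp} (hT : i.cost + e.cost + 1 ≤ T)
    (hQ : Q (s.setN a (i.eval s) (e.eval s))) : Spec O (.setNat a i e) s T Q :=
  ⟨_, _, .setNat s a i e, hT, hQ⟩

lemma Spec.setFld {a : ℕ} {i : NatExp} {e : FldExp} (hT : i.cost + e.cost + 1 ≤ T)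
    (hQ : Q (s.setF a (i.eval s) (e.eval s))) : Spec O (.setFld a i e) s T Q :=
  ⟨_, _, .setFld s a i e, hT, hQ⟩

lemma Spec.setReal {a : ℕ} {i : NatExp} {e : RealExp} (hT : i.cost + e.cost + 1 ≤ T)
    (hQ : Q (s.setR a (i.eval s) (e.eval O s))) : Spec O (.setReal a i e) s T Q :=
  ⟨_, _, .setReal s a i e, hT, hQ⟩

lemma Spec.seq {p q : Program} {T₁ T₂ : ℕ} {Q₁ : State F → Prop} (hp : Spec O p s T₁ Q₁)
    (hT : T₁ + T₂ ≤ T) (hq : ∀ s', Frame p s s' → Q₁ s' → Spec O q s' T₂ Q) :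
    Spec O (.seq p q) s T Q := by
  obtain ⟨s', T', hr, hT', h1⟩ := hp
  obtain ⟨s'', T'', hr', hT'', h2⟩ := hq s' hr.frame h1
  exact ⟨s'', T' + T'', .seq hr hr', by omega, h2⟩

lemma Spec.cond {b : Test} {p q : Program} {T₁ : ℕ} (hT : b.cost + T₁ ≤ T)
    (hp : b.holds O s → Spec O p s T₁ Q) (hq : ¬ b.holds O s → Spec O q s T₁ Q) :
    Spec O (.cond b p q) s T Q := by
  by_cases h : b.holds O s
  · obtain ⟨s', T', hr, hT', h1⟩ := hp h
    exact ⟨s', _, .condTrue h hr, by omega, h1⟩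
  · obtain ⟨s', T', hr, hT', h1⟩ := hq h
    exact ⟨s', _, .condFalse h hr, by omega, h1⟩

/-- The cell `0` of an array of natural numbers. -/
def NatExp.var (a : ℕ) : NatExp := .get a (.lit 0)

/-- `v := e` -/
def Program.assign (v : ℕ) (e : NatExp) : Program := .setNat v (.lit 0) e

/-- `v := v + e` -/
def Program.incr (v : ℕ) (e : NatExp) : Program := .assign v (.add (.var v) e)

lemma Spec.assign {v : ℕ} {e : NatExp} (hT : e.cost + 2 ≤ T) (hQ : Q (s.setN v 0 (e.eval s))) :
    Spec O (.assign v e) s T Q :=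
  Spec.setNat (by simp only [NatExp.cost]; omega) hQ

lemma Spec.assign_seq {v : ℕ} {e : NatExp} {q : Program} {T₂ : ℕ} (hT : e.cost + 2 + T₂ ≤ T)
    (hq : Spec O q (s.setN v 0 (e.eval s)) T₂ Q) : Spec O (.seq (.assign v e) q) s T Q :=
  Spec.seq (Q₁ := fun s' => s' = s.setN v 0 (e.eval s)) (Spec.assign le_rfl rfl) hT
    fun _ _ h => h ▸ hq

lemma Spec.setReal_seq {a : ℕ} {i : NatExp} {e : RealExp} {q : Program} {T₂ : ℕ}
    (hT : i.cost + e.cost + 1 + T₂ ≤ T)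
    (hq : Spec O q (s.setR a (i.eval s) (e.eval O s)) T₂ Q) :
    Spec O (.seq (.setReal a i e) q) s T Q :=
  Spec.seq (Q₁ := fun s' => s' = s.setR a (i.eval s) (e.eval O s)) (Spec.setReal le_rfl rfl) hT
    fun _ _ h => h ▸ hq

lemma Spec.setFld_seq {a : ℕ} {i : NatExp} {e : FldExp} {q : Program} {T₂ : ℕ}
    (hT : i.cost + e.cost + 1 + T₂ ≤ T)
    (hq : Spec O q (s.setF a (i.eval s) (e.eval s)) T₂ Q) :
    Spec O (.seq (.setFld a i e) q) s T Q :=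
  Spec.seq (Q₁ := fun s' => s' = s.setF a (i.eval s) (e.eval s)) (Spec.setFld le_rfl rfl) hT
    fun _ _ h => h ▸ hq

/-- `for v < e do p`, where `e` is the content of the cell `i` of the array `a`. -/
def Program.forLoop (v a i : ℕ) (p : Program) : Program :=
  .seq (.setNat v (.lit 0) (.lit 0))
    (.loop (.not (.natLe (.get a (.lit i)) (.get v (.lit 0))))
      (.seq p (.setNat v (.lit 0) (.add (.get v (.lit 0)) (.lit 1)))))

/-- An iteration costs 6 for the test and 6 for the increment besides the body; the initialization
costs 3 and the final failing test 6. Neither the bound nor, within the body, the counter may be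
overwritten. The invariant is established after the increment. -/
lemma Spec.forLoop {v a i : ℕ} {p : Program} {B N : ℕ} (Inv : ℕ → State F → Prop)
    (hN : s.nat a i = N) (ha : (Program.forLoop v a i p).keepsNat a = true)
    (hv : p.keepsNat v = true) (h0 : Inv 0 (s.setN v 0 0))
    (hstep : ∀ k < N, ∀ s', Frame (Program.forLoop v a i p) s s' → s'.nat v 0 = k → Inv k s' →
      Spec O p s' B (fun s'' => Inv (k + 1) (s''.setN v 0 (k + 1))))
    (hT : N * (B + 12) + 9 ≤ T)
    (hQ : ∀ s', Frame (Program.forLoop v a i p) s s' → Inv N s' → Q s') :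
    Spec O (Program.forLoop v a i p) s T Q := by
  have hf0 : Frame (Program.forLoop v a i p) s (s.setN v 0 0) := by
    have := (Runs.setNat (O := O) s v (.lit 0) (.lit 0)).frame
    exact this.mono (fun _ h => (Bool.and_eq_true_iff.1 h).1) (fun _ _ => rfl) (fun _ _ => rfl)
  have hfp : ∀ {s' s'' : State F}, Frame p s' s'' → Frame (Program.forLoop v a i p) s' s'' := by
    intro s' s'' h
    refine h.mono ?_ ?_ ?_ <;> intro b hb
    · simp only [Program.forLoop, Program.keepsNat, Bool.and_eq_true] at hb
      exact hb.2.1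
    · simp only [Program.forLoop, Program.keepsFld, Bool.and_eq_true] at hb
      exact hb.2.1
    · simp only [Program.forLoop, Program.keepsReal, Bool.and_eq_true] at hb
      exact hb.2.1
  have hfv : ∀ (s' : State F) (k : ℕ), Frame (Program.forLoop v a i p) s' (s'.setN v 0 k) := by
    intro s' k
    have := (Runs.setNat (O := O) s' v (.lit 0) (.lit k)).frame
    exact this.mono (fun _ h => (Bool.and_eq_true_iff.1 h).1) (fun _ _ => rfl) (fun _ _ => rfl)
  -- Induction on the number j of iterations still to be made.
  have key : ∀ j k, j + k = N → ∀ s', Frame (Program.forLoop v a i p) s s' → s'.nat v 0 = k →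
      Inv k s' → Spec O (.loop (.not (.natLe (.get a (.lit i)) (.get v (.lit 0))))
        (.seq p (.setNat v (.lit 0) (.add (.get v (.lit 0)) (.lit 1))))) s' (j * (B + 12) + 6) Q := by
    intro j
    induction j with
    | zero =>
      intro k hk s' hf hk' hI
      obtain rfl : k = N := by omega
      refine ⟨s', _, .loopDone ?_, ?_, hQ s' hf hI⟩
      · simp only [Test.holds, NatExp.eval, hf.nat a ha, hN, hk', le_refl, not_true,
          not_false_eq_true]
      · simp [Test.cost, NatExp.cost]
    | succ j ih =>
      intro k hk s' hf hk' hI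
      obtain ⟨s'', T', hr, hT', hI'⟩ := hstep k (by omega) s' hf hk' hI
      have hv' : s''.nat v 0 = k := by rw [hr.frame.nat v hv, hk']
      obtain ⟨s₃, T₃, hr₃, hT₃, hq⟩ := ih (k + 1) (by omega) (s''.setN v 0 (k + 1))
        ((hf.trans (hfp hr.frame)).trans (hfv _ _)) (by simp) hI'
      refine ⟨s₃, _, .loopStep ?_ (.seq hr (.setNat s'' v _ _)) (s'' := s₃) (T' := T₃) ?_, ?_, hq⟩
      · simp only [Test.holds, NatExp.eval, hf.nat a ha, hN, hk']
        omega
      · simp only [NatExp.eval, hv']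
        exact hr₃
      · simp only [Test.cost, NatExp.cost]
        rw [add_mul, one_mul]
        omega
  obtain ⟨s', T', hr, hT', hq⟩ := key N 0 (by omega) _ hf0 (by simp) h0
  refine ⟨s', _, .seq (.setNat s v _ _) hr, ?_, hq⟩
  simp only [NatExp.cost]
  omega

end Verification

/-! ## Exterior products by programs

The program uses the following memory cells besides the input. The cells `7` and `8` of the array
`0` of natural numbers hold `d = r * m` and `D = 2 ^ d`. The arrays `4` of natural numbers, `3` of
field elements and `2` of real numbers hold the candidates of a layer, their exterior products and
their weights; the arrays `2` and `3` of natural numbers and `1` of real numbers hold the number of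
selected sets, these sets and their weights; the arrays `1` and `2` of field elements hold the
exterior product under construction. The arrays of natural numbers from `10` on, and the arrays of
field elements from `5` on, are used as single variables. -/

section Programs

/-- The entries of `b` from the address `o` on. -/
def listAt (b : ℕ → ℕ) (o len : ℕ) : List ℕ := (List.range len).map fun i => b (o + i)

lemma listAt_add (b : ℕ → ℕ) (o p q : ℕ) :
    listAt b o (p + q) = listAt b o p ++ listAt b (o + p) q := by
  simp [listAt, List.range_add, Function.comp_def, add_assoc]

lemma listAt_succ (b : ℕ → ℕ) (o p : ℕ) : listAt b o (p + 1) = listAt b o p ++ [b (o + p)] := by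
  simp [listAt, List.range_succ]

lemma listAt_congr {b b' : ℕ → ℕ} {o o' p : ℕ} (h : ∀ i < p, b (o + i) = b' (o' + i)) :
    listAt b o p = listAt b' o' p :=
  List.map_congr_left fun i hi => h i (List.mem_range.1 hi)

/-- Absorbs the overhead of a loop into one constant, 21 = 12 + 9, so that time bounds stay
monomials. Upper bounds Y ≥ 1 in place of N also cover loops that are never entered. -/
lemma loop_time {N B c X Y : ℕ} (hN : N ≤ Y) (hB : B ≤ c * X) (hX : 1 ≤ X) (hY : 1 ≤ Y) :
    N * (B + 12) + 9 ≤ (c + 21) * (Y * X) := by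
  have h1 : N * (B + 12) ≤ Y * (c * X + 12 * X) := Nat.mul_le_mul hN (by omega)
  have h2 : 1 ≤ Y * X := Nat.mul_pos hY hX
  calc N * (B + 12) + 9 ≤ Y * (c * X + 12 * X) + 9 * (Y * X) := by omega
    _ = _ := by ring

lemma block_lt {c N z D : ℕ} (hc : c < N) (hz : z < D) : c * D + z < N * D := by
  have : (c + 1) * D ≤ N * D := Nat.mul_le_mul_right _ hc
  rw [add_mul] at this
  omega

variable {F : Type*} [Field F] {O : ℝ → ℕ → ℝ} {s : State F}

/-- Copies entries of the array `src` to the array `dst`. -/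
def copyNat (v a i dst : ℕ) (e : NatExp) (src : ℕ) (e' : NatExp) : Program :=
  .forLoop v a i (.setNat dst (.add e (.var v)) (.get src (.add e' (.var v))))

lemma copyNat_spec {v a i dst src o o' N T : ℕ} {e e' : NatExp}
    (hN : s.nat a i = N) (ha : (copyNat v a i dst e src e').keepsNat a = true)
    (hs : (copyNat v a i dst e src e').keepsNat src = true) (hv : dst ≠ v)
    (he : ∀ s', Frame (copyNat v a i dst e src e') s s' → e.eval s' = o)
    (he' : ∀ s', Frame (copyNat v a i dst e src e') s s' → e'.eval s' = o')
    (hT : N * (e.cost + e'.cost + 20) + 9 ≤ T) :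
    Spec O (copyNat v a i dst e src e') s T fun s' => ∀ x, s'.nat dst x =
      if o ≤ x ∧ x < o + N then s.nat src (o' + (x - o)) else s.nat dst x := by
  refine Spec.forLoop (B := e.cost + e'.cost + 8) (fun k s' => ∀ x, s'.nat dst x =
      if o ≤ x ∧ x < o + k then s.nat src (o' + (x - o)) else s.nat dst x) hN ha ?_ ?_ ?_ ?_ ?_
  · simpa [Program.keepsNat, ← Bool.not_eq_true, Nat.beq_eq] using hv
  · intro x
    rw [setN_nat_ne _ _ _ _ _ hv, if_neg (by omega)]
  · intro k hk s' hf hk' hI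
    refine Spec.setNat (by simp only [NatExp.cost, NatExp.var]; omega) ?_
    intro x
    rw [setN_nat_ne _ _ _ _ _ hv, setN_nat_self]
    simp only [NatExp.eval, NatExp.var, he s' hf, he' s' hf, hk', hf.nat src hs]
    by_cases hx : x = o + k
    · subst hx
      rw [Function.update_self, if_pos (by omega)]
      congr 1
      omega
    · rw [Function.update_of_ne hx, hI x]
      congr 1
      simp only [eq_iff_iff]
      omega
  · exact le_trans (by rw [show e.cost + e'.cost + 8 + 12 = e.cost + e'.cost + 20 by ring]) hT
  · exact fun s' _ h => h

/-- Copies entries of the array `src` to the array `dst`. -/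
def copyFld (v a i dst : ℕ) (e : NatExp) (src : ℕ) (e' : NatExp) : Program :=
  .forLoop v a i (.setFld dst (.add e (.var v)) (.get src (.add e' (.var v))))

lemma copyFld_spec {v a i dst src o o' N T : ℕ} {e e' : NatExp}
    (hN : s.nat a i = N) (ha : (copyFld v a i dst e src e').keepsNat a = true)
    (hs : (copyFld v a i dst e src e').keepsFld src = true)
    (he : ∀ s', Frame (copyFld v a i dst e src e') s s' → e.eval s' = o)
    (he' : ∀ s', Frame (copyFld v a i dst e src e') s s' → e'.eval s' = o')
    (hT : N * (e.cost + e'.cost + 20) + 9 ≤ T) :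
    Spec O (copyFld v a i dst e src e') s T fun s' => ∀ x, s'.fld dst x =
      if o ≤ x ∧ x < o + N then s.fld src (o' + (x - o)) else s.fld dst x := by
  refine Spec.forLoop (B := e.cost + e'.cost + 8) (fun k s' => ∀ x, s'.fld dst x =
      if o ≤ x ∧ x < o + k then s.fld src (o' + (x - o)) else s.fld dst x) hN ha ?_ ?_ ?_ ?_ ?_
  · rfl
  · intro x
    rw [setN_fld, if_neg (by omega)]
  · intro k hk s' hf hk' hI
    refine Spec.setFld (by simp only [NatExp.cost, FldExp.cost, NatExp.var]; omega) ?_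
    intro x
    rw [setN_fld, setF_fld_self]
    simp only [NatExp.eval, FldExp.eval, NatExp.var, he s' hf, he' s' hf, hk', hf.fld src hs]
    by_cases hx : x = o + k
    · subst hx
      rw [Function.update_self, if_pos (by omega)]
      congr 1
      omega
    · rw [Function.update_of_ne hx, hI x]
      congr 1
      simp only [eq_iff_iff]
      omega
  · exact le_trans (by rw [show e.cost + e'.cost + 8 + 12 = e.cost + e'.cost + 20 by ring]) hT
  · exact fun s' _ h => h

/-- Adds to the exterior product the contribution of the coordinate `j`, which is held in the
variable `5` of the field; the variable `27` holds `2 ^ j`, the variable `28` holds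
`2 ^ (j + 1)`. -/
def wedgeCoord : Program :=
  .forLoop 24 0 8
    (.seq (.cond (.natLe (.var 27) (.var 29))
        (.setFld 1 (.var 24) (.sub (.mul (.get 5 (.lit 0)) (.get 2 (.sub (.var 24) (.var 27))))
          (.get 1 (.var 24)))) .skip)
      (.seq (.incr 29 (.lit 1)) (.cond (.natLe (.var 28) (.var 29)) (.assign 29 (.lit 0)) .skip)))

/-- Together with `succ_mod_eq`, this replaces bit tests by a running counter modulo 2^(j+1) and a
comparison. -/
lemma testBit_iff_le_mod (k j : ℕ) : k.testBit j = true ↔ 2 ^ j ≤ k % 2 ^ (j + 1) := by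
  rw [Nat.testBit_eq_decide_div_mod_eq, decide_eq_true_iff, pow_succ, Nat.mod_mul]
  have h1 : k % 2 ^ j < 2 ^ j := Nat.mod_lt _ (by positivity)
  rcases Nat.mod_two_eq_zero_or_one (k / 2 ^ j) with h | h <;> rw [h] <;> omega

lemma succ_mod_eq (k M : ℕ) (hM : 0 < M) :
    (k + 1) % M = if M ≤ k % M + 1 then 0 else k % M + 1 := by
  have h1 := Nat.mod_lt k hM
  split_ifs with h
  · have : k % M + 1 = M := by omega
    rw [Nat.add_mod_eq_add_mod_right 1 (Nat.mod_mod k M).symm, this, Nat.mod_self]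
  · rw [Nat.add_mod_eq_add_mod_right 1 (Nat.mod_mod k M).symm, Nat.mod_eq_of_lt (by omega)]

/-- While the masks are scanned, the entries below k already include coordinate j and the others do
not yet. Array 2 keeps f itself, so overwriting array 1 destroys nothing that is still needed. -/
lemma wedgeCoord_spec {D j : ℕ} {x f : ℕ → F} (hD : s.nat 0 8 = D) (h27 : s.nat 27 0 = 2 ^ j)
    (h28 : s.nat 28 0 = 2 ^ (j + 1)) (h29 : s.nat 29 0 = 0) (hx : s.fld 5 0 = x j)
    (h2 : ∀ z < D, s.fld 2 z = f z) (h1 : ∀ z < D, s.fld 1 z = wedge j x f z) (hD1 : 1 ≤ D) :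
    Spec O wedgeCoord s (80 * D) fun s' => ∀ z < D, s'.fld 1 z = wedge (j + 1) x f z := by
  refine Spec.forLoop (B := 59) (fun k s' => (∀ z < k, s'.fld 1 z = wedge (j + 1) x f z) ∧
    (∀ z, k ≤ z → z < D → s'.fld 1 z = wedge j x f z) ∧ s'.nat 29 0 = k % 2 ^ (j + 1))
    hD rfl rfl ?_ ?_ ?_ ?_
  · simp only [setN_fld]
    exact ⟨by simp, fun z _ hz => h1 z hz, by simp [h29]⟩
  · rintro k hk s' hf hk' ⟨hI1, hI2, hI3⟩
    have e27 : s'.nat 27 = s.nat 27 := hf.nat 27 rfl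
    have e28 : s'.nat 28 = s.nat 28 := hf.nat 28 rfl
    have e5 : s'.fld 5 = s.fld 5 := hf.fld 5 rfl
    have e2 : s'.fld 2 = s.fld 2 := hf.fld 2 rfl
    refine Spec.seq (T₁ := 35) (T₂ := 24) (Q₁ := fun s'' => s''.nat = s'.nat ∧
      ∀ z, s''.fld 1 z = if z = k then wedge (j + 1) x f z else s'.fld 1 z) ?_ (by norm_num) ?_
    · refine Spec.cond (T₁ := 30) (by simp [Test.cost, NatExp.cost, NatExp.var]) ?_ ?_
      · intro hb
        simp only [Test.holds, NatExp.eval, NatExp.var, e27, h27, hI3] at hb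
        refine Spec.setFld (by simp [FldExp.cost, NatExp.cost, NatExp.var]) ⟨rfl, ?_⟩
        intro z
        simp only [setF_fld_self, NatExp.eval, NatExp.var, hk', FldExp.eval, Function.update_apply]
        split_ifs with hz
        · subst hz
          rw [wedge_succ_apply, if_pos ((testBit_iff_le_mod _ _).2 hb), hI2 z le_rfl hk, e5, hx,
            e2, e27, h27, h2 _ (by omega)]
        · rfl
      · intro hb
        simp only [Test.holds, NatExp.eval, NatExp.var, e27, h27, hI3] at hb
        refine Spec.skip (by norm_num) ⟨rfl, ?_⟩
        intro z
        split_ifs with hz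
        · subst hz
          rw [wedge_succ_apply, if_neg (fun h => hb ((testBit_iff_le_mod _ _).1 h)),
            hI2 z le_rfl hk]
        · rfl
    · rintro s₁ - ⟨hn, hI⟩
      refine Spec.seq (T₁ := 10) (T₂ := 14)
        (Spec.setNat (Q := fun s'' => s'' = s₁.setN 29 0 (k % 2 ^ (j + 1) + 1))
          (by simp [NatExp.cost, NatExp.var]) ?_) (by norm_num) ?_
      · simp [NatExp.eval, NatExp.var, hn, hI3]
      · rintro s₂ - rfl
        have hfin : ∀ s₃ : State F, s₃.fld = s₁.fld → s₃.nat 29 0 = (k + 1) % 2 ^ (j + 1) →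
            (∀ z < k + 1, (s₃.setN 24 0 (k + 1)).fld 1 z = wedge (j + 1) x f z) ∧
            (∀ z, k + 1 ≤ z → z < D → (s₃.setN 24 0 (k + 1)).fld 1 z = wedge j x f z) ∧
            (s₃.setN 24 0 (k + 1)).nat 29 0 = (k + 1) % 2 ^ (j + 1) := by
          intro s₃ h3 h3'
          simp only [setN_fld, h3, hI]
          refine ⟨fun z hz => ?_, fun z hz hz' => ?_, by simpa using h3'⟩
          · split_ifs with h
            · rfl
            · exact hI1 z (by omega)
          · rw [if_neg (by omega)]
            exact hI2 z (by omega) hz'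
        have hmod := succ_mod_eq k (2 ^ (j + 1)) (by positivity)
        refine Spec.cond (T₁ := 9) (by simp [Test.cost, NatExp.cost, NatExp.var]) ?_ ?_
        · intro hb
          refine Spec.setNat (by simp [NatExp.cost]) (hfin _ rfl ?_)
          simp [Test.holds, NatExp.eval, NatExp.var, hn, e28, h28] at hb
          rw [hmod, if_pos hb]
          simp [NatExp.eval]
        · intro hb
          refine Spec.skip (by norm_num) (hfin _ rfl ?_)
          simp [Test.holds, NatExp.eval, NatExp.var, hn, e28, h28] at hb
          rw [hmod, if_neg (by omega)]
          simp
  · have := loop_time (N := D) (B := 59) (c := 59) (X := 1) (Y := D) le_rfl le_rfl le_rfl hD1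
    simpa using this
  · exact fun s' _ h => h.1

end Programs

/-! ### Multiplication by a single column and by all columns of a list -/

section Products

variable {F : Type*} [Field F] {O : ℝ → ℕ → ℝ} {s : State F}

/-- Moves the exterior product from the array `1` to the array `2`. -/
def moveProd : Program :=
  .forLoop 24 0 8
    (.seq (.setFld 2 (.var 24) (.get 1 (.var 24))) (.setFld 1 (.var 24) .zero))

lemma moveProd_spec {D : ℕ} {f : ℕ → F} (hD : s.nat 0 8 = D) (h1 : ∀ z < D, s.fld 1 z = f z)
    (hD1 : 1 ≤ D) :
    Spec O moveProd s (34 * D) fun s' => ∀ z < D, s'.fld 2 z = f z ∧ s'.fld 1 z = 0 := by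
  refine Spec.forLoop (B := 13) (fun k s' => (∀ z < k, s'.fld 2 z = f z ∧ s'.fld 1 z = 0) ∧
    (∀ z, k ≤ z → z < D → s'.fld 1 z = f z)) hD rfl rfl ?_ ?_ ?_ ?_
  · exact ⟨by simp, fun z _ hz => h1 z hz⟩
  · rintro k hk s' hf hk' ⟨hI1, hI2⟩
    refine Spec.setFld_seq (T₂ := 5) (by simp [FldExp.cost, NatExp.cost, NatExp.var]) ?_
    refine Spec.setFld (by simp [FldExp.cost, NatExp.cost, NatExp.var]) ?_
    simp only [NatExp.eval, NatExp.var, FldExp.eval, setF_nat, hk', setN_fld, setF_fld_self]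
    simp only [setF_fld_self, setF_fld_ne _ 1 2 _ _ (by norm_num),
      setF_fld_ne _ 2 1 _ _ (by norm_num), Function.update_apply]
    refine ⟨fun z hz => ?_, fun z hz hz' => ?_⟩
    · split_ifs with h
      · exact ⟨by rw [hI2 k le_rfl hk, h], rfl⟩
      · exact hI1 z (by omega)
    · rw [if_neg (by omega)]
      exact hI2 z (by omega) hz'
  · have := loop_time (N := D) (B := 13) (c := 13) (X := 1) (Y := D) le_rfl le_rfl le_rfl hD1
    simpa using this
  · exact fun s' _ h => h.1

/-- Stores a coordinate of a column in the variable `5` of the field. -/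
def loadCoord : Program :=
  .cond (.natLe (.var 22) (.var 25))
    (.cond (.natLe (.add (.var 22) (.get 0 (.lit 2))) (.var 25))
      (.setFld 5 (.lit 0) .zero)
      (.setFld 5 (.lit 0) (.get 0 (.add (.var 26) (.var 21)))))
    (.setFld 5 (.lit 0) .zero)

lemma loadCoord_spec {n r i j u : ℕ} (h22 : s.nat 22 0 = i * r) (h25 : s.nat 25 0 = j)
    (hr : s.nat 0 2 = r) (h26 : s.nat 26 0 = j * n) (h21 : s.nat 21 0 = u) :
    Spec O loadCoord s 30 fun s' => s'.fld 5 0 = blockCol (s.fld 0) n r i u j := by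
  unfold loadCoord
  refine Spec.cond (T₁ := 25) (by simp [Test.cost, NatExp.cost, NatExp.var]) ?_ ?_
  · intro hb
    simp only [Test.holds, NatExp.eval, NatExp.var, h22, h25] at hb
    refine Spec.cond (T₁ := 15) (by simp [Test.cost, NatExp.cost, NatExp.var]) ?_ ?_
    · intro hb'
      simp only [Test.holds, NatExp.eval, NatExp.var, h22, h25, hr] at hb'
      refine Spec.setFld (by simp [FldExp.cost, NatExp.cost]) ?_
      simp only [NatExp.eval, FldExp.eval, setF_fld_self, Function.update_self]
      rw [blockCol, if_neg (by omega)]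
    · intro hb'
      simp only [Test.holds, NatExp.eval, NatExp.var, h22, h25, hr] at hb'
      refine Spec.setFld (by simp [FldExp.cost, NatExp.cost, NatExp.var]) ?_
      simp only [NatExp.eval, NatExp.var, FldExp.eval, setF_fld_self, Function.update_self, h26,
        h21]
      rw [blockCol, if_pos (by omega)]
  · intro hb
    simp only [Test.holds, NatExp.eval, NatExp.var, h22, h25] at hb
    refine Spec.setFld (by simp [FldExp.cost, NatExp.cost]) ?_
    simp only [NatExp.eval, FldExp.eval, setF_fld_self, Function.update_self]
    rw [blockCol, if_neg (by omega)]

/-- Multiplies the exterior product by the column `u`, held in the variable `21`, of the `i`-th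
matrix; the variable `22` holds `i * r`. -/
def wedgeStep : Program :=
  .seq moveProd <| .seq (.assign 26 (.lit 0)) <| .seq (.assign 27 (.lit 1)) <|
    .forLoop 25 0 7 <| .seq loadCoord <| .seq (.assign 28 (.add (.var 27) (.var 27))) <|
      .seq (.assign 29 (.lit 0)) <| .seq wedgeCoord <|
      .seq (.incr 26 (.get 0 (.lit 0))) (.assign 27 (.var 28))

/-- Array 1 is cleared, which is the product with no coordinate taken into account, and the d ≤ D
coordinates are then added, each by a scan of D masks. Without multiplication of numbers, the row
address j·n and the power 2^j are updated by addition. -/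
lemma wedgeStep_spec {n m r γ t d D i u : ℕ} {f : ℕ → F} (hp : Params s n m r γ t d D)
    (hdD : d ≤ D) (hD1 : 1 ≤ D) (h21 : s.nat 21 0 = u) (h22 : s.nat 22 0 = i * r)
    (h1 : ∀ z < D, s.fld 1 z = f z) :
    Spec O wedgeStep s (200 * (D * D)) fun s' =>
      ∀ z < D, s'.fld 1 z = wedge d (blockCol (s.fld 0) n r i u) f z := by
  have hDD : D ≤ D * D := Nat.le_mul_self D
  refine Spec.seq (moveProd_spec (f := f) hp.D_eq h1 hD1) (T₂ := 166 * (D * D)) (by omega) ?_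
  intro s₁ hf₁ hI₁
  refine Spec.assign_seq (T₂ := 163 * (D * D)) (by simp only [NatExp.cost]; omega) ?_
  refine Spec.assign_seq (T₂ := 160 * (D * D)) (by simp only [NatExp.cost]; omega) ?_
  simp only [NatExp.eval]
  have hp₁ := hp.of_frame hf₁ rfl
  refine Spec.forLoop (N := d) (B := 139 * D) (fun j s' => s'.nat 26 0 = j * n ∧
    s'.nat 27 0 = 2 ^ j ∧ ∀ z < D, s'.fld 1 z = wedge j (blockCol (s.fld 0) n r i u) f z)
    (by simpa using hp₁.d_eq) rfl rfl ?_ ?_ ?_ ?_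
  · simp only [setN_fld]
    exact ⟨by simp, by simp, fun z hz => by rw [(hI₁ z hz).2, wedge_zero_apply]⟩
  · rintro j hj s' hf hk' ⟨h26, h27, hI⟩
    have e0 : s'.nat 0 = s.nat 0 := by
      rw [hf.nat 0 rfl]; simpa using hf₁.nat 0 rfl
    have e21 : s'.nat 21 = s.nat 21 := by
      rw [hf.nat 21 rfl]; simpa using hf₁.nat 21 rfl
    have e22 : s'.nat 22 = s.nat 22 := by
      rw [hf.nat 22 rfl]; simpa using hf₁.nat 22 rfl
    have eA : s'.fld 0 = s.fld 0 := by
      rw [hf.fld 0 rfl]; simpa using hf₁.fld 0 rfl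
    have e2 : s'.fld 2 = s₁.fld 2 := by
      rw [hf.fld 2 rfl]; simp
    refine Spec.seq (loadCoord_spec (n := n) (r := r) (i := i) (u := u) (j := j) (by rw [e22, h22])
      hk' (by rw [e0, hp.r_eq]) h26 (by rw [e21, h21])) (T₂ := 109 * D) (by omega) ?_
    intro s₂ hf₂ hx
    refine Spec.assign_seq (T₂ := 102 * D) (by simp only [NatExp.cost, NatExp.var]; omega) ?_
    refine Spec.assign_seq (T₂ := 99 * D) (by simp only [NatExp.cost]; omega) ?_
    have e27 : s₂.nat 27 0 = 2 ^ j := by rw [hf₂.nat 27 rfl, h27]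
    simp only [NatExp.eval, NatExp.var, e27]
    refine Spec.seq (wedgeCoord_spec (D := D) (j := j) (x := blockCol (s.fld 0) n r i u) (f := f)
      ?_ ?_ ?_ ?_ ?_ ?_ ?_ hD1) (T₂ := 19 * D) (by omega) ?_
    · simp only [ne_eq, OfNat.zero_ne_ofNat, not_false_eq_true, setN_nat_ne]
      rw [hf₂.nat 0 rfl, e0, hp.D_eq]
    · simpa using e27
    · simp; ring
    · simp
    · simpa [eA] using hx
    · intro z hz
      simp only [setN_fld]
      rw [hf₂.fld 2 rfl, e2, (hI₁ z hz).1]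
    · intro z hz
      simp only [setN_fld]
      rw [hf₂.fld 1 rfl, hI z hz]
    · intro s₃ hf₃ hI₃
      refine Spec.assign_seq (T₂ := 4) (by simp only [NatExp.cost, NatExp.var]; omega) ?_
      refine Spec.assign (by simp [NatExp.cost]) ?_
      simp only [NatExp.eval, NatExp.var, setN_fld]
      have e0' : s₃.nat 0 0 = n := by
        rw [hf₃.nat 0 rfl]
        simp only [ne_eq, OfNat.zero_ne_ofNat, not_false_eq_true, setN_nat_ne]
        rw [hf₂.nat 0 rfl, e0, hp.n_eq]
      have e26' : s₃.nat 26 0 = j * n := by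
        rw [hf₃.nat 26 rfl]
        simp only [ne_eq, Nat.reduceEqDiff, not_false_eq_true, setN_nat_ne]
        rw [hf₂.nat 26 rfl, h26]
      have e28' : s₃.nat 28 0 = 2 ^ j + 2 ^ j := by
        rw [hf₃.nat 28 rfl]
        simp
      refine ⟨?_, ?_, hI₃⟩
      · simp [e0', e26']; ring
      · simp [e28']; ring
  · have := loop_time (N := d) (B := 139 * D) (c := 139) (X := D) (Y := D) hdD le_rfl hD1 hD1
    simpa using this
  · exact fun s' _ h => h.2.2

/-- Computes the exterior product of the columns of a list in all the matrices. The list starts at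
the address in the variable `17` in the array `4`; the variable `12` holds its length. -/
def prodSet : Program :=
  .seq (.forLoop 24 0 8 (.setFld 1 (.var 24) .zero)) <| .seq (.setFld 1 (.lit 0) .one) <|
    .forLoop 20 12 0 <| .seq (.assign 21 (.get 4 (.add (.var 17) (.var 20)))) <|
      .seq (.assign 22 (.lit 0)) <|
      .forLoop 23 0 1 (.seq wedgeStep (.incr 22 (.get 0 (.lit 2))))

/-- The exponent 4 counts the elements of the list, the matrices, the coordinates and the masks,
each at most D in number. The time is independent of n, since only the columns of elements of the
list are read. -/
lemma prodSet_spec {n m r γ t D o p : ℕ} (hp : Params s n m r γ t (r * m) D)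
    (hdD : r * m ≤ D) (hm : m ≤ D) (hpD : p ≤ D) (hD1 : 1 ≤ D) (h17 : s.nat 17 0 = o)
    (h12 : s.nat 12 0 = p) :
    Spec O prodSet s (400 * D ^ 4) fun s' =>
      ∀ z < D, s'.fld 1 z = colProd (s.fld 0) n r m (listAt (s.nat 4) o p) z := by
  have hD4 : D ≤ D ^ 4 := Nat.le_self_pow (by norm_num) D
  refine Spec.seq (T₁ := 30 * D) (Q₁ := fun s' => ∀ z < D, s'.fld 1 z = 0) ?_
    (T₂ := 370 * D ^ 4) (by omega) ?_
  · refine Spec.forLoop (B := 5) (fun k s' => ∀ z < k, s'.fld 1 z = 0) hp.D_eq rfl rfl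
      (by simp) ?_ ?_ fun _ _ h => h
    · intro k hk s' hf hk' hI
      refine Spec.setFld (by simp [FldExp.cost, NatExp.cost, NatExp.var]) ?_
      intro z hz
      simp only [NatExp.eval, NatExp.var, hk', setN_fld, setF_fld_self, FldExp.eval,
        Function.update_apply]
      split_ifs with h
      · rfl
      · exact hI z (by omega)
    · have := loop_time (N := D) (B := 5) (c := 5) (X := 1) (Y := D) le_rfl le_rfl le_rfl hD1
      simp only [mul_one] at this
      omega
  intro s₁ hf₁ hI₁
  refine Spec.setFld_seq (T₂ := 360 * D ^ 4) (by simp only [NatExp.cost, FldExp.cost]; omega) ?_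
  simp only [NatExp.eval, FldExp.eval]
  refine Spec.forLoop (N := p) (B := 260 * D ^ 3) (fun l s' => ∀ z < D, s'.fld 1 z =
    colProd (s.fld 0) n r m (listAt (s.nat 4) o l) z) ?_ rfl rfl ?_ ?_ ?_ fun _ _ h => h
  · simp only [setF_nat]
    rw [hf₁.nat 12 rfl, h12]
  · intro z hz
    simp only [setN_fld, setF_fld_self, Function.update_apply, hI₁ z hz]
    simp [colProd, columns, listAt, wedgeList, unitVec, Pi.single_apply]
  · intro l hl s' hf hk' hI
    have e0 : s'.nat 0 = s.nat 0 := by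
      rw [hf.nat 0 rfl]; simpa using hf₁.nat 0 rfl
    have e4 : s'.nat 4 = s.nat 4 := by
      rw [hf.nat 4 rfl]; simpa using hf₁.nat 4 rfl
    have e17 : s'.nat 17 = s.nat 17 := by
      rw [hf.nat 17 rfl]; simpa using hf₁.nat 17 rfl
    have eA : s'.fld 0 = s.fld 0 := by
      rw [hf.fld 0 rfl]
      simp only [ne_eq, zero_ne_one, not_false_eq_true, setF_fld_ne]
      exact hf₁.fld 0 rfl
    have hD3 : D ≤ D ^ 3 := Nat.le_self_pow (by norm_num) D
    refine Spec.assign_seq (T₂ := 250 * D ^ 3) (by simp only [NatExp.cost, NatExp.var]; omega) ?_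
    refine Spec.assign_seq (T₂ := 240 * D ^ 3) (by simp only [NatExp.cost]; omega) ?_
    simp only [NatExp.eval, NatExp.var, hk', e17, h17, e4]
    set u := s.nat 4 (o + l)
    refine Spec.forLoop (N := m) (B := 210 * (D * D)) (fun i s' => s'.nat 22 0 = i * r ∧
      ∀ z < D, s'.fld 1 z = wedgeList (r * m) ((List.range i).map fun i =>
        blockCol (s.fld 0) n r i u) (colProd (s.fld 0) n r m (listAt (s.nat 4) o l)) z)
        ?_ rfl rfl ?_ ?_ ?_ ?_
    · simp [e0, hp.m_eq]
    · simp only [setN_fld]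
      exact ⟨by simp, fun z hz => by simpa [wedgeList] using hI z hz⟩
    · rintro i hi s₂ hf₂ hi' ⟨h22, hI₂⟩
      have hp₂ : Params s₂ n m r γ t (r * m) D := by
        have : s₂.nat 0 = s.nat 0 := by rw [hf₂.nat 0 rfl]; simp [e0]
        constructor <;> rw [this]
        exacts [hp.n_eq, hp.m_eq, hp.r_eq, hp.γ_eq, hp.t_eq, hp.d_eq, hp.D_eq]
      have h21 : s₂.nat 21 0 = u := by rw [hf₂.nat 21 rfl]; simp
      have eA₂ : s₂.fld 0 = s.fld 0 := by rw [hf₂.fld 0 rfl]; simp [eA]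
      refine Spec.seq (wedgeStep_spec hp₂ hdD hD1 h21 h22 hI₂) (T₂ := 10 * (D * D))
        (by omega) ?_
      intro s₃ hf₃ hI₃
      have hDD : 1 ≤ D * D := Nat.mul_pos hD1 hD1
      refine Spec.assign (by simp only [NatExp.cost, NatExp.var]; omega) ?_
      simp only [NatExp.eval, NatExp.var, setN_fld]
      refine ⟨?_, ?_⟩
      · rw [setN_nat_ne _ _ _ _ _ (by norm_num), setN_nat_self, Function.update_self,
          hf₃.nat 22 rfl, h22, hf₃.nat 0 rfl, hp₂.r_eq]
        ring
      · intro z hz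
        rw [hI₃ z hz, eA₂, List.range_succ, List.map_append, List.map_singleton,
          wedgeList_concat, Module.End.mul_apply]
    · have := loop_time (N := m) (B := 210 * (D * D)) (c := 210) (X := D * D) (Y := D) hm le_rfl
        (Nat.mul_pos hD1 hD1) hD1
      rw [show D * (D * D) = D ^ 3 by ring] at this
      omega
    · rintro s₃ - ⟨-, hI₃⟩ z hz
      rw [setN_fld, hI₃ z hz, listAt_succ, colProd_append]
      simp [columns, u]
  · have := loop_time (N := p) (B := 260 * D ^ 3) (c := 260) (X := D ^ 3) (Y := D) hpD le_rfl
        (Nat.pow_pos hD1) hD1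
    rw [show D * D ^ 3 = D ^ 4 by ring] at this
    omega

end Products

/-! ## The candidates of a layer -/

section Candidates

variable {F : Type*}

/-- The first `N` candidates are the lists `cl c` with the weights `cw c`, and their exterior
products have been computed. -/
structure Cands (s : State F) [Field F] (a : ℕ → F) (n r m p D : ℕ) (cl : ℕ → List ℕ) (cw : ℕ → ℝ)
    (N : ℕ) : Prop where
  list : ∀ c < N, listAt (s.nat 4) (c * p) p = cl c
  weight : ∀ c < N, s.real 2 c = cw c
  prod : ∀ c < N, ∀ z < D, s.fld 3 (c * D + z) = colProd a n r m (cl c) z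

variable [Field F] {O : ℝ → ℕ → ℝ} {s : State F}

lemma Cands.congr {a : ℕ → F} {n r m p D : ℕ} {cl : ℕ → List ℕ} {cw : ℕ → ℝ} {N : ℕ}
    (h : Cands s a n r m p D cl cw N) {s' : State F} (h4 : s'.nat 4 = s.nat 4)
    (h2 : s'.real 2 = s.real 2) (h3 : s'.fld 3 = s.fld 3) : Cands s' a n r m p D cl cw N :=
  ⟨by rw [h4]; exact h.list, by rw [h2]; exact h.weight, by rw [h3]; exact h.prod⟩

/-- Adds the candidate that consists of the selected set with the index in the variable `13` and
the member of the input family with the index in the variable `14`. The variables `11` and `12`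
hold the cardinalities of the sets before and after, the variables `15`, `16`, `17` and `18` hold
the addresses of the set, the member, the candidate and its exterior product, and the variable `19`
holds the number of candidates. -/
def addCand : Program :=
  .seq (copyNat 20 11 0 4 (.var 17) 3 (.var 15)) <|
  .seq (copyNat 20 0 5 4 (.add (.var 17) (.var 11)) 1 (.var 16)) <|
  .seq (.setReal 2 (.var 19) (.call (.get 1 (.var 13)) (.var 14))) <|
  .seq prodSet <|
  .seq (copyFld 24 0 8 3 (.var 18) 1 (.lit 0)) <|
  .seq (.incr 16 (.get 0 (.lit 5))) <| .seq (.incr 17 (.var 12)) <|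
  .seq (.incr 18 (.get 0 (.lit 8))) (.incr 19 (.lit 1))

lemma addCand_spec {n m r γ t D p c k j : ℕ} {cl : ℕ → List ℕ} {cw : ℕ → ℝ}
    (hp : Params s n m r γ t (r * m) D) (hdD : r * m ≤ D) (hm : m ≤ D) (hpD : p + γ ≤ D)
    (hD1 : 1 ≤ D) (h11 : s.nat 11 0 = p) (h12 : s.nat 12 0 = p + γ) (h13 : s.nat 13 0 = k)
    (h14 : s.nat 14 0 = j) (h15 : s.nat 15 0 = k * p) (h16 : s.nat 16 0 = j * γ)
    (h17 : s.nat 17 0 = c * (p + γ)) (h18 : s.nat 18 0 = c * D) (h19 : s.nat 19 0 = c)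
    (hcl : cl c = listAt (s.nat 3) (k * p) p ++ listAt (s.nat 1) (j * γ) γ)
    (hcw : cw c = O (s.real 1 k) j) (hC : Cands s (s.fld 0) n r m (p + γ) D cl cw c) :
    Spec O addCand s (600 * D ^ 4) fun s' =>
      Cands s' (s.fld 0) n r m (p + γ) D cl cw (c + 1) ∧ s'.nat 16 0 = (j + 1) * γ ∧
      s'.nat 17 0 = (c + 1) * (p + γ) ∧ s'.nat 18 0 = (c + 1) * D ∧ s'.nat 19 0 = c + 1 := by
  have hD4 : D ≤ D ^ 4 := Nat.le_self_pow (by norm_num) D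
  refine Spec.seq (copyNat_spec (o := c * (p + γ)) (o' := k * p) h11 rfl rfl (by norm_num) ?_ ?_
    le_rfl) (T₂ := 560 * D ^ 4) (by simp only [NatExp.cost, NatExp.var]; omega) ?_
  · intro s' hf
    simp only [NatExp.eval, NatExp.var]
    rw [hf.nat 17 rfl, h17]
  · intro s' hf
    simp only [NatExp.eval, NatExp.var]
    rw [hf.nat 15 rfl, h15]
  intro s₁ hf₁ hI₁
  refine Spec.seq (copyNat_spec (o := c * (p + γ) + p) (o' := j * γ) (N := γ) ?_ rfl rfl
    (by norm_num) ?_ ?_ le_rfl) (T₂ := 520 * D ^ 4)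
    (by simp only [NatExp.cost, NatExp.var]; omega) ?_
  · rw [hf₁.nat 0 rfl, hp.γ_eq]
  · intro s' hf
    simp only [NatExp.eval, NatExp.var]
    rw [hf.nat 17 rfl, hf₁.nat 17 rfl, h17, hf.nat 11 rfl, hf₁.nat 11 rfl, h11]
  · intro s' hf
    simp only [NatExp.eval, NatExp.var]
    rw [hf.nat 16 rfl, hf₁.nat 16 rfl, h16]
  intro s₂ hf₂ hI₂
  have hn₂ : ∀ a, a ≠ 4 → a ≠ 20 → s₂.nat a = s.nat a := by
    intro a h4 h20
    have h4' : Nat.beq 4 a = false := by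
      rw [← Bool.not_eq_true, Nat.beq_eq]; exact fun h => h4 h.symm
    have h20' : Nat.beq 20 a = false := by
      rw [← Bool.not_eq_true, Nat.beq_eq]; exact fun h => h20 h.symm
    rw [hf₂.nat a (by simp [copyNat, Program.forLoop, Program.keepsNat, h4', h20']),
      hf₁.nat a (by simp [copyNat, Program.forLoop, Program.keepsNat, h4', h20'])]
  have hr₂ : s₂.real = s.real := by
    ext a i
    rw [hf₂.real a rfl, hf₁.real a rfl]
  have hfl₂ : s₂.fld = s.fld := by
    ext a i
    rw [hf₂.fld a rfl, hf₁.fld a rfl]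
  -- The new candidate is the kept set followed by the member of 𝓗; earlier candidates are
  -- untouched.
  have hI : ∀ x, s₂.nat 4 x = if c * (p + γ) ≤ x ∧ x < c * (p + γ) + p then
      s.nat 3 (k * p + (x - c * (p + γ))) else
      if c * (p + γ) + p ≤ x ∧ x < c * (p + γ) + p + γ then
      s.nat 1 (j * γ + (x - (c * (p + γ) + p))) else s.nat 4 x := by
    intro x
    rw [hI₂ x, hI₁ x, hf₁.nat 1 rfl]
    split_ifs <;> first | rfl | omega
  have hlist : listAt (s₂.nat 4) (c * (p + γ)) (p + γ) = cl c := by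
    rw [hcl, listAt_add]
    congr 1 <;> refine listAt_congr fun i hi => ?_ <;> rw [hI]
    · rw [if_pos (by omega)]
      congr 1; omega
    · rw [if_neg (by omega), if_pos (by omega)]
      congr 1; omega
  have hlist' : ∀ c' < c, listAt (s₂.nat 4) (c' * (p + γ)) (p + γ) = cl c' := by
    intro c' hc'
    rw [← hC.list c' hc']
    refine listAt_congr fun i hi => ?_
    have := block_lt hc' hi
    rw [hI, if_neg (by omega), if_neg (by omega)]
  refine Spec.setReal_seq (T₂ := 500 * D ^ 4)
    (by simp only [NatExp.cost, NatExp.var, RealExp.cost]; omega) ?_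
  have hwt : RealExp.eval O s₂ (.call (.get 1 (.var 13)) (.var 14)) = cw c := by
    simp only [RealExp.eval, NatExp.eval, NatExp.var, hr₂]
    rw [hn₂ 13 (by norm_num) (by norm_num), hn₂ 14 (by norm_num) (by norm_num), h13, h14, hcw]
  have hix : NatExp.eval s₂ (.var 19) = c := by
    simp only [NatExp.eval, NatExp.var]
    rw [hn₂ 19 (by norm_num) (by norm_num), h19]
  rw [hwt, hix]
  have hp₂ : Params (s₂.setR 2 c (cw c)) n m r γ t (r * m) D := by
    have := hn₂ 0 (by norm_num) (by norm_num)
    constructor <;> rw [setR_nat, this]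
    exacts [hp.n_eq, hp.m_eq, hp.r_eq, hp.γ_eq, hp.t_eq, hp.d_eq, hp.D_eq]
  refine Spec.seq (prodSet_spec (o := c * (p + γ)) (p := p + γ) hp₂ hdD hm hpD hD1 ?_ ?_)
    (T₂ := 100 * D ^ 4) (by omega) ?_
  · rw [setR_nat, hn₂ 17 (by norm_num) (by norm_num), h17]
  · rw [setR_nat, hn₂ 12 (by norm_num) (by norm_num), h12]
  intro s₃ hf₃ hI₃
  simp only [setR_fld, setR_nat, hlist, hfl₂] at hI₃
  refine Spec.seq (copyFld_spec (o := c * D) (o' := 0) (N := D) ?_ rfl rfl ?_ (fun _ _ => rfl)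
    le_rfl) (T₂ := 60 * D ^ 4) (by simp only [NatExp.cost, NatExp.var]; omega) ?_
  · rw [hf₃.nat 0 rfl, hp₂.D_eq]
  · intro s' hf
    simp only [NatExp.eval, NatExp.var]
    rw [hf.nat 18 rfl, hf₃.nat 18 rfl, setR_nat, hn₂ 18 (by norm_num) (by norm_num), h18]
  intro s₄ hf₄ hI₄
  have e0 : s₄.nat 0 = s.nat 0 := by
    rw [hf₄.nat 0 rfl, hf₃.nat 0 rfl, setR_nat, hn₂ 0 (by norm_num) (by norm_num)]
  have e4 : s₄.nat 4 = s₂.nat 4 := by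
    rw [hf₄.nat 4 rfl, hf₃.nat 4 rfl, setR_nat]
  have e12 : s₄.nat 12 = s.nat 12 := by
    rw [hf₄.nat 12 rfl, hf₃.nat 12 rfl, setR_nat, hn₂ 12 (by norm_num) (by norm_num)]
  have e16 : s₄.nat 16 = s.nat 16 := by
    rw [hf₄.nat 16 rfl, hf₃.nat 16 rfl, setR_nat, hn₂ 16 (by norm_num) (by norm_num)]
  have e17 : s₄.nat 17 = s.nat 17 := by
    rw [hf₄.nat 17 rfl, hf₃.nat 17 rfl, setR_nat, hn₂ 17 (by norm_num) (by norm_num)]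
  have e18 : s₄.nat 18 = s.nat 18 := by
    rw [hf₄.nat 18 rfl, hf₃.nat 18 rfl, setR_nat, hn₂ 18 (by norm_num) (by norm_num)]
  have e19 : s₄.nat 19 = s.nat 19 := by
    rw [hf₄.nat 19 rfl, hf₃.nat 19 rfl, setR_nat, hn₂ 19 (by norm_num) (by norm_num)]
  have er : ∀ i, s₄.real 2 i = if i = c then cw c else s.real 2 i := by
    intro i
    rw [hf₄.real 2 rfl, hf₃.real 2 rfl, setR_real_self, hr₂, Function.update_apply]
  have ef : ∀ x, s₄.fld 3 x = if c * D ≤ x ∧ x < c * D + D then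
      s₃.fld 1 (x - c * D) else s.fld 3 x := by
    intro x
    rw [hI₄ x, hf₃.fld 3 rfl, setR_fld, hfl₂, zero_add]
  refine Spec.assign_seq (T₂ := 50 * D ^ 4) (by simp only [NatExp.cost, NatExp.var]; omega) ?_
  refine Spec.assign_seq (T₂ := 40 * D ^ 4) (by simp only [NatExp.cost, NatExp.var]; omega) ?_
  refine Spec.assign_seq (T₂ := 30 * D ^ 4) (by simp only [NatExp.cost, NatExp.var]; omega) ?_
  refine Spec.assign (by simp only [NatExp.cost, NatExp.var]; omega) ?_
  refine ⟨Cands.congr (s := s₄) ⟨?_, ?_, ?_⟩ (by simp) (by simp) (by simp), ?_, ?_, ?_, ?_⟩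
  · intro c' hc'
    rw [e4]
    rcases Nat.lt_succ_iff_lt_or_eq.1 hc' with hc' | rfl
    · exact hlist' c' hc'
    · exact hlist
  · intro c' hc'
    rw [er]
    split_ifs with h
    · rw [h]
    · exact hC.weight c' (by omega)
  · intro c' hc' z hz
    rw [ef]
    rcases Nat.lt_succ_iff_lt_or_eq.1 hc' with hc' | rfl
    · have := block_lt hc' hz
      rw [if_neg (by omega)]
      exact hC.prod c' hc' z hz
    · rw [if_pos (by omega), Nat.add_sub_cancel_left]
      exact hI₃ z hz
  · simp [NatExp.eval, NatExp.var, e16, e0, hp.γ_eq, h16]; ring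
  · simp [NatExp.eval, NatExp.var, e17, e12, h17, h12]; ring
  · simp [NatExp.eval, NatExp.var, e18, e0, hp.D_eq, h18]; ring
  · simp [NatExp.eval, NatExp.var, e19, h19]

/-- Builds the candidates from all selected sets and all members of the input family. -/
def build : Program :=
  .seq (.assign 19 (.lit 0)) <| .seq (.assign 15 (.lit 0)) <| .seq (.assign 17 (.lit 0)) <|
  .seq (.assign 18 (.lit 0)) <|
  .forLoop 13 2 0 <| .seq (.assign 16 (.lit 0)) <| .seq (.forLoop 14 0 6 addCand) <|
    .incr 15 (.var 11)

/-- The kept set k and the member j give the candidate k·t + j. There are at most D·t pairs, each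
costing a multiple of D^4. -/
lemma build_spec {n m r γ t D p K : ℕ} {cl : ℕ → List ℕ} {cw : ℕ → ℝ}
    (hp : Params s n m r γ t (r * m) D) (hdD : r * m ≤ D) (hm : m ≤ D) (hpD : p + γ ≤ D)
    (hD1 : 1 ≤ D) (ht1 : 1 ≤ t) (hKD : K ≤ D) (h2 : s.nat 2 0 = K) (h11 : s.nat 11 0 = p)
    (h12 : s.nat 12 0 = p + γ)
    (hcl : ∀ k < K, ∀ j < t, cl (k * t + j) =
      listAt (s.nat 3) (k * p) p ++ listAt (s.nat 1) (j * γ) γ)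
    (hcw : ∀ k < K, ∀ j < t, cw (k * t + j) = O (s.real 1 k) j) :
    Spec O build s (700 * (D ^ 5 * t)) fun s' =>
      Cands s' (s.fld 0) n r m (p + γ) D cl cw (K * t) ∧ s'.nat 19 0 = K * t := by
  have hX : 1 ≤ D ^ 4 * t := Nat.mul_pos (Nat.pow_pos hD1) ht1
  have hX5 : 1 ≤ D ^ 5 * t := Nat.mul_pos (Nat.pow_pos hD1) ht1
  refine Spec.assign_seq (T₂ := 697 * (D ^ 5 * t)) (by simp only [NatExp.cost]; omega) ?_
  refine Spec.assign_seq (T₂ := 694 * (D ^ 5 * t)) (by simp only [NatExp.cost]; omega) ?_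
  refine Spec.assign_seq (T₂ := 691 * (D ^ 5 * t)) (by simp only [NatExp.cost]; omega) ?_
  refine Spec.assign_seq (T₂ := 688 * (D ^ 5 * t)) (by simp only [NatExp.cost]; omega) ?_
  simp only [NatExp.eval]
  refine Spec.forLoop (N := K) (B := 640 * (D ^ 4 * t)) (fun k s' =>
    Cands s' (s.fld 0) n r m (p + γ) D cl cw (k * t) ∧ s'.nat 15 0 = k * p ∧
      s'.nat 17 0 = k * t * (p + γ) ∧ s'.nat 18 0 = k * t * D ∧ s'.nat 19 0 = k * t)
    (by simpa using h2) rfl rfl ?_ ?_ ?_ fun s' _ h => ⟨h.1, h.2.2.2.2⟩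
  · refine ⟨⟨?_, ?_, ?_⟩, ?_⟩ <;> simp
  · rintro k hk s₁ hf₁ hk' ⟨hC, h15, h17, h18, h19⟩
    refine Spec.assign_seq (T₂ := 637 * (D ^ 4 * t)) (by simp only [NatExp.cost]; omega) ?_
    simp only [NatExp.eval]
    have eA : s₁.fld 0 = s.fld 0 := by rw [hf₁.fld 0 rfl]; simp
    refine Spec.seq (T₁ := 621 * (D ^ 4 * t)) (T₂ := 10) (Q₁ := fun s' =>
      Cands s' (s.fld 0) n r m (p + γ) D cl cw (k * t + t) ∧
      s'.nat 17 0 = (k * t + t) * (p + γ) ∧ s'.nat 18 0 = (k * t + t) * D ∧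
      s'.nat 19 0 = k * t + t) ?_ (by omega) ?_
    · refine Spec.forLoop (N := t) (B := 600 * D ^ 4) (fun j s' =>
        Cands s' (s.fld 0) n r m (p + γ) D cl cw (k * t + j) ∧ s'.nat 16 0 = j * γ ∧
        s'.nat 17 0 = (k * t + j) * (p + γ) ∧ s'.nat 18 0 = (k * t + j) * D ∧
        s'.nat 19 0 = k * t + j) ?_ rfl rfl ?_ ?_ ?_ fun s' _ h => ⟨h.1, h.2.2⟩
      · rw [setN_nat_ne _ _ _ _ _ (by norm_num), hf₁.nat 0 rfl]
        simpa using hp.t_eq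
      · refine ⟨hC.congr (by simp) (by simp) (by simp), ?_⟩
        simp [h17, h18, h19]
      · rintro j hj s₂ hf₂ hj' ⟨hC₂, g16, g17, g18, g19⟩
        -- An array that the whole of `build` leaves alone is also unchanged by each of its parts
        -- executed so far.
        have hn : ∀ a, build.keepsNat a = true → s₂.nat a = s.nat a := by
          intro a ha
          simp only [build, Program.forLoop, Program.keepsNat, Program.assign, Program.incr,
            Bool.and_eq_true, Bool.not_eq_true'] at ha
          have hne : ∀ b, Nat.beq b a = false → a ≠ b := by
            rintro b hb rfl
            simp at hb
          rw [hf₂.nat a (by simp [Program.forLoop, Program.keepsNat, ha]),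
            setN_nat_ne _ _ _ _ _ (hne 16 (by simp [ha])),
            hf₁.nat a (by simp [Program.forLoop, Program.keepsNat, Program.assign, Program.incr,
              ha]),
            setN_nat_ne _ _ _ _ _ (hne 18 (by simp [ha])),
            setN_nat_ne _ _ _ _ _ (hne 17 (by simp [ha])),
            setN_nat_ne _ _ _ _ _ (hne 15 (by simp [ha])),
            setN_nat_ne _ _ _ _ _ (hne 19 (by simp [ha]))]
        have eA₂ : s₂.fld 0 = s.fld 0 := by rw [hf₂.fld 0 rfl, setN_fld, eA]
        have eR₂ : s₂.real 1 = s.real 1 := by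
          rw [hf₂.real 1 rfl, setN_real, hf₁.real 1 rfl]; simp
        have hp₂ : Params s₂ n m r γ t (r * m) D := by
          have := hn 0 rfl
          constructor <;> rw [this]
          exacts [hp.n_eq, hp.m_eq, hp.r_eq, hp.γ_eq, hp.t_eq, hp.d_eq, hp.D_eq]
        rw [← eA₂] at hC₂
        refine (addCand_spec (p := p) (c := k * t + j) (k := k) (j := j) hp₂ hdD hm hpD hD1 ?_ ?_
          ?_ hj' ?_ g16 g17 g18 g19 ?_ ?_ hC₂).conseq le_rfl ?_
        · rw [hn 11 rfl, h11]
        · rw [hn 12 rfl, h12]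
        · rw [hf₂.nat 13 rfl, setN_nat_ne _ _ _ _ _ (by norm_num), hk']
        · rw [hf₂.nat 15 rfl, setN_nat_ne _ _ _ _ _ (by norm_num), h15]
        · rw [hcl k hk j hj, hn 3 rfl, hn 1 rfl]
        · rw [hcw k hk j hj, eR₂]
        · rintro s₃ - ⟨i1, i2, i3, i4, i5⟩
          rw [eA₂] at i1
          refine ⟨i1.congr (by simp) (by simp) (by simp), ?_⟩
          simp [i2, i3, i4, i5, add_assoc]
      · have := loop_time (N := t) (B := 600 * D ^ 4) (c := 600) (X := D ^ 4) (Y := t) le_rfl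
          le_rfl (Nat.pow_pos hD1) ht1
        rw [mul_comm t (D ^ 4)] at this
        exact this
    · rintro s₂ hf₂ ⟨i1, i2, i3, i4⟩
      refine Spec.assign (by simp [NatExp.cost, NatExp.var]) ?_
      have e15 : s₂.nat 15 0 = k * p := by
        rw [hf₂.nat 15 rfl, setN_nat_ne _ _ _ _ _ (by norm_num), h15]
      have e11 : s₂.nat 11 0 = p := by
        rw [hf₂.nat 11 rfl, setN_nat_ne _ _ _ _ _ (by norm_num), hf₁.nat 11 rfl]
        simpa using h11
      rw [add_mul k 1 t, one_mul]
      refine ⟨i1.congr (by simp) (by simp) (by simp), ?_⟩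
      simp [i2, i3, i4, NatExp.eval, NatExp.var, e15, e11]
      ring
  · have := loop_time (N := K) (B := 640 * (D ^ 4 * t)) (c := 640) (X := D ^ 4 * t) (Y := D) hKD
      le_rfl hX hD1
    rw [show D * (D ^ 4 * t) = D ^ 5 * t by ring] at this
    omega

end Candidates

/-! ## Elimination by programs -/

section Elimination

variable {F : Type*} [Field F] {O : ℝ → ℕ → ℝ} {s : State F}

/-- The state `s` holds the result of a search among the first `N` candidates for one of maximum
weight with a nonzero coordinate `q`. -/
def Found (v : ℕ → F) (wt : ℕ → ℝ) (q D p N : ℕ) (s : State F) : Prop :=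
  (s.nat 31 0 = 0 ∧ ∀ c < N, v (c * D + q) = 0) ∨
  (s.nat 31 0 = 1 ∧ ∃ b < N, s.nat 32 0 = b ∧ s.nat 33 0 = b * D ∧ s.nat 34 0 = b * p ∧
    v (b * D + q) ≠ 0 ∧ ∀ c < N, v (c * D + q) ≠ 0 → wt c ≤ wt b)

lemma Found.congr {v : ℕ → F} {wt : ℕ → ℝ} {q D p N : ℕ} (h : Found v wt q D p N s) {s' : State F}
    (h31 : s'.nat 31 = s.nat 31) (h32 : s'.nat 32 = s.nat 32) (h33 : s'.nat 33 = s.nat 33)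
    (h34 : s'.nat 34 = s.nat 34) : Found v wt q D p N s' := by
  unfold Found
  rw [h31, h32, h33, h34]
  exact h

/-- Makes the candidate in the variable `37` the best one. -/
def takeCand : Program :=
  .seq (.assign 31 (.lit 1)) <| .seq (.assign 32 (.var 37)) <| .seq (.assign 33 (.var 35)) <|
    .assign 34 (.var 36)

lemma takeCand_spec {v : ℕ → F} {wt : ℕ → ℝ} {q D p c : ℕ} (h37 : s.nat 37 0 = c)
    (h35 : s.nat 35 0 = c * D) (h36 : s.nat 36 0 = c * p) (hv : v (c * D + q) ≠ 0)
    (hwt : ∀ c' < c, v (c' * D + q) ≠ 0 → wt c' ≤ wt c) :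
    Spec O takeCand s 15 (Found v wt q D p (c + 1)) := by
  refine Spec.assign_seq (T₂ := 12) (by simp [NatExp.cost]) ?_
  refine Spec.assign_seq (T₂ := 8) (by simp [NatExp.cost, NatExp.var]) ?_
  refine Spec.assign_seq (T₂ := 4) (by simp [NatExp.cost, NatExp.var]) ?_
  refine Spec.assign (by simp [NatExp.cost, NatExp.var]) ?_
  refine Or.inr ⟨by simp [NatExp.eval], c, by omega, ?_, ?_, ?_, hv, ?_⟩
  · simp [NatExp.eval, NatExp.var, h37]
  · simp [NatExp.eval, NatExp.var, h35]
  · simp [NatExp.eval, NatExp.var, h36]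
  · intro c' hc' hv'
    rcases Nat.lt_succ_iff_lt_or_eq.1 hc' with hc' | rfl
    · exact hwt c' hc' hv'
    · exact le_rfl

/-- Searches for a candidate of maximum weight with a nonzero coordinate in the variable `30`. -/
def search : Program :=
  .seq (.assign 31 (.lit 0)) <| .seq (.assign 35 (.lit 0)) <| .seq (.assign 36 (.lit 0)) <|
  .forLoop 37 19 0 <|
    .seq (.cond (.fldEq (.get 3 (.add (.var 35) (.var 30))) .zero) .skip
        (.cond (.natLe (.lit 1) (.var 31))
          (.cond (.realLe (.get 2 (.var 32)) (.get 2 (.var 37))) takeCand .skip) takeCand)) <|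
    .seq (.incr 35 (.get 0 (.lit 8))) (.incr 36 (.var 12))

/-- The bound B ≥ 1 stands in for N, which is zero if the previous layer kept no set. -/
lemma search_spec {q D p N B : ℕ} (hD : s.nat 0 8 = D) (h12 : s.nat 12 0 = p)
    (h19 : s.nat 19 0 = N) (h30 : s.nat 30 0 = q) (hNB : N ≤ B) (hB : 1 ≤ B) :
    Spec O search s (120 * B) (Found (s.fld 3) (s.real 2) q D p N) := by
  refine Spec.assign_seq (T₂ := 117 * B) (by simp only [NatExp.cost]; omega) ?_
  refine Spec.assign_seq (T₂ := 114 * B) (by simp only [NatExp.cost]; omega) ?_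
  refine Spec.assign_seq (T₂ := 111 * B) (by simp only [NatExp.cost]; omega) ?_
  simp only [NatExp.eval]
  refine Spec.forLoop (N := N) (B := 80) (fun c s' => Found (s.fld 3) (s.real 2) q D p c s' ∧
    s'.nat 35 0 = c * D ∧ s'.nat 36 0 = c * p) (by simpa using h19) rfl rfl ?_ ?_ ?_
    fun _ _ h => h.1
  · refine ⟨Or.inl ?_, ?_⟩ <;> simp
  · rintro c hc s₁ hf hc' ⟨hI, h35, h36⟩
    have hn : s₁.nat 0 = s.nat 0 ∧ s₁.nat 12 = s.nat 12 ∧ s₁.nat 30 = s.nat 30 := by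
      refine ⟨?_, ?_, ?_⟩ <;> rw [hf.nat _ rfl] <;> simp
    have e3 : s₁.fld 3 = s.fld 3 := by rw [hf.fld 3 rfl]; simp
    have e2 : s₁.real 2 = s.real 2 := by rw [hf.real 2 rfl]; simp
    refine Spec.seq (T₁ := 50) (T₂ := 20) (Q₁ := Found (s.fld 3) (s.real 2) q D p (c + 1)) ?_
      (by norm_num) ?_
    · refine Spec.cond (T₁ := 40) (by simp [Test.cost, FldExp.cost, NatExp.cost, NatExp.var]) ?_ ?_
      · intro hb
        simp only [Test.holds, FldExp.eval, NatExp.eval, NatExp.var, e3, h35, hn, h30] at hb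
        refine Spec.skip (by norm_num) ?_
        rcases hI with ⟨h31, h⟩ | ⟨h31, b, hbN, h32, h33, h34, hv, h⟩
        · refine Or.inl ⟨h31, fun c' hc' => ?_⟩
          rcases Nat.lt_succ_iff_lt_or_eq.1 hc' with hc' | rfl
          · exact h c' hc'
          · exact hb
        · refine Or.inr ⟨h31, b, by omega, h32, h33, h34, hv, fun c' hc' hv' => ?_⟩
          rcases Nat.lt_succ_iff_lt_or_eq.1 hc' with hc' | rfl
          · exact h c' hc' hv'
          · exact absurd hb hv'
      · intro hb
        simp only [Test.holds, FldExp.eval, NatExp.eval, NatExp.var, e3, h35, hn, h30] at hb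
        refine Spec.cond (T₁ := 25) (by simp [Test.cost, NatExp.cost, NatExp.var]) ?_ ?_
        · intro hb'
          simp only [Test.holds, NatExp.eval, NatExp.var] at hb'
          rcases hI with ⟨h31, h⟩ | ⟨h31, b, hbN, h32, h33, h34, hv, h⟩
          · omega
          refine Spec.cond (T₁ := 15)
            (by simp [Test.cost, RealExp.cost, NatExp.cost, NatExp.var]) ?_ ?_
          · intro hb₂
            simp only [Test.holds, RealExp.eval, NatExp.eval, NatExp.var, e2, h32, hc'] at hb₂
            exact takeCand_spec hc' h35 h36 hb fun c' hc' hv' => (h c' hc' hv').trans hb₂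
          · intro hb₂
            simp only [Test.holds, RealExp.eval, NatExp.eval, NatExp.var, e2, h32, hc'] at hb₂
            refine Spec.skip (by norm_num) (Or.inr ⟨h31, b, by omega, h32, h33, h34, hv, ?_⟩)
            intro c' hc' hv'
            rcases Nat.lt_succ_iff_lt_or_eq.1 hc' with hc' | rfl
            · exact h c' hc' hv'
            · exact (not_le.1 hb₂).le
        · intro hb'
          simp only [Test.holds, NatExp.eval, NatExp.var] at hb'
          rcases hI with ⟨h31, h⟩ | ⟨h31, b, hbN, h32, h33, h34, hv, h⟩
          · refine (takeCand_spec hc' h35 h36 hb ?_).conseq (by norm_num) fun _ _ h => h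
            intro c' hc' hv'
            exact absurd (h c' hc') hv'
          · omega
    · intro s₂ hf₂ hI₂
      refine Spec.assign_seq (T₂ := 10) (by simp [NatExp.cost, NatExp.var]) ?_
      refine Spec.assign (by simp [NatExp.cost, NatExp.var]) ?_
      refine ⟨hI₂.congr (by simp) (by simp) (by simp) (by simp), ?_, ?_⟩
      · simp [NatExp.eval, NatExp.var, hf₂.nat 35 rfl, h35, hf₂.nat 0 rfl, hn, hD]; ring
      · simp [NatExp.eval, NatExp.var, hf₂.nat 36 rfl, h36, hf₂.nat 12 rfl, hn, h12]; ring
  · have := loop_time (N := N) (B := 80) (c := 80) (X := 1) (Y := B) hNB le_rfl le_rfl hB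
    omega

/-- Eliminates the coordinate in the variable `30` from all candidates. The array `4` of field
elements holds the pivot vector. -/
def reduceAll : Program :=
  .seq (.assign 35 (.lit 0)) <|
  .forLoop 37 19 0 <|
    .seq (.setFld 6 (.lit 0)
      (.mul (.get 3 (.add (.var 35) (.var 30))) (.inv (.get 4 (.var 30))))) <|
    .seq (.forLoop 24 0 8 (.setFld 3 (.add (.var 35) (.var 24))
      (.sub (.get 3 (.add (.var 35) (.var 24)))
        (.mul (.get 6 (.lit 0)) (.get 4 (.var 24)))))) <|
    .incr 35 (.get 0 (.lit 8))

/-- The factor is stored before the inner loop, since that loop changes the coordinate q from which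
it is computed. The vectors from c on still have their initial entries, as the last clause of the
invariant records. -/
lemma reduceAll_spec {q D N : ℕ} (hD : s.nat 0 8 = D) (h19 : s.nat 19 0 = N)
    (h30 : s.nat 30 0 = q) (hN1 : 1 ≤ N) (hqD : q < D) :
    Spec O reduceAll s (120 * (N * D)) fun s' => ∀ c < N, ∀ z < D, s'.fld 3 (c * D + z) =
      s.fld 3 (c * D + z) - s.fld 3 (c * D + q) * (s.fld 4 q)⁻¹ * s.fld 4 z := by
  have hD1 : 1 ≤ D := by omega
  have hND : 1 ≤ N * D := Nat.mul_pos hN1 hD1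
  refine Spec.assign_seq (T₂ := 117 * (N * D)) (by simp only [NatExp.cost]; omega) ?_
  simp only [NatExp.eval]
  refine Spec.forLoop (N := N) (B := 90 * D) (fun c s' => s'.nat 35 0 = c * D ∧
    (∀ c' < c, ∀ z < D, s'.fld 3 (c' * D + z) =
      s.fld 3 (c' * D + z) - s.fld 3 (c' * D + q) * (s.fld 4 q)⁻¹ * s.fld 4 z) ∧
    ∀ x, c * D ≤ x → s'.fld 3 x = s.fld 3 x) (by simpa using h19) rfl rfl ?_ ?_ ?_
    fun _ _ h => h.2.1
  · simp
  · rintro c hc s₁ hf hc' ⟨h35, hI, hI'⟩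
    have hn : s₁.nat 0 = s.nat 0 ∧ s₁.nat 30 = s.nat 30 := by
      refine ⟨?_, ?_⟩ <;> rw [hf.nat _ rfl] <;> simp
    have e4 : s₁.fld 4 = s.fld 4 := by rw [hf.fld 4 rfl]; simp
    refine Spec.setFld_seq (T₂ := 75 * D)
      (by simp only [FldExp.cost, NatExp.cost, NatExp.var]; omega) ?_
    simp only [FldExp.eval, NatExp.eval, NatExp.var, h35, hn, h30, e4]
    rw [hI' _ (by omega)]
    refine Spec.seq (T₁ := 50 * D) (T₂ := 10) (Q₁ := fun s' =>
      ∀ x, s'.fld 3 x = if c * D ≤ x ∧ x < c * D + D then s.fld 3 x -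
        s.fld 3 (c * D + q) * (s.fld 4 q)⁻¹ * s.fld 4 (x - c * D) else s₁.fld 3 x) ?_
      (by omega) ?_
    · refine Spec.forLoop (N := D) (B := 20) (fun z s' =>
        ∀ x, s'.fld 3 x = if c * D ≤ x ∧ x < c * D + z then s.fld 3 x -
        s.fld 3 (c * D + q) * (s.fld 4 q)⁻¹ * s.fld 4 (x - c * D) else s₁.fld 3 x) ?_ rfl rfl
        ?_ ?_ ?_ fun _ _ h => h
      · simp [hn, hD]
      · intro x
        rw [if_neg (by omega)]
        simp
      · rintro z hz s₂ hf₂ hz' hI₂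
        have e35 : s₂.nat 35 0 = c * D := by rw [hf₂.nat 35 rfl]; simpa using h35
        have e6 : s₂.fld 6 0 = s.fld 3 (c * D + q) * (s.fld 4 q)⁻¹ := by
          rw [hf₂.fld 6 rfl]; simp
        have e4' : s₂.fld 4 = s.fld 4 := by rw [hf₂.fld 4 rfl]; simp [e4]
        refine Spec.setFld (by simp [FldExp.cost, NatExp.cost]) ?_
        intro x
        simp only [FldExp.eval, NatExp.eval, setN_fld, setF_fld_self, e35, hz', e6,
          e4', Function.update_apply]
        by_cases hx : x = c * D + z
        · subst hx
          rw [if_pos rfl, if_pos (by omega), hI₂, if_neg (by omega), hI' _ (by omega),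
            Nat.add_sub_cancel_left]
        · rw [if_neg hx, hI₂ x]
          congr 1
          simp only [eq_iff_iff]
          omega
      · have := loop_time (N := D) (B := 20) (c := 20) (X := 1) (Y := D) le_rfl le_rfl le_rfl hD1
        omega
    · intro s₂ hf₂ hI₂
      refine Spec.assign (by simp [NatExp.cost, NatExp.var]) ?_
      refine ⟨?_, ?_, ?_⟩
      · simp [NatExp.eval, NatExp.var, hf₂.nat 35 rfl, h35, hf₂.nat 0 rfl, hn, hD]; ring
      · intro c' hc' z hz
        rw [setN_fld, setN_fld, hI₂]
        rcases Nat.lt_succ_iff_lt_or_eq.1 hc' with hc' | rfl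
        · have := block_lt hc' hz
          rw [if_neg (by omega)]
          exact hI c' hc' z hz
        · rw [if_pos (by omega), Nat.add_sub_cancel_left]
      · intro x hx
        rw [add_mul, one_mul] at hx
        rw [setN_fld, setN_fld, hI₂, if_neg (by omega)]
        exact hI' x (by omega)
  · have := loop_time (N := N) (B := 90 * D) (c := 90) (X := D) (Y := N) le_rfl le_rfl hD1 hN1
    omega

/-- Selects the candidate found by the search and eliminates with it. -/
def select : Program :=
  .seq (copyNat 20 12 0 3 (.var 38) 4 (.var 34)) <|
  .seq (.setReal 1 (.var 2) (.get 2 (.var 32))) <|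
  .seq (.incr 2 (.lit 1)) <| .seq (.incr 38 (.var 12)) <|
  .seq (copyFld 24 0 8 4 (.lit 0) 3 (.var 33)) reduceAll

lemma select_spec {q D N p K b : ℕ} (hD : s.nat 0 8 = D) (h2 : s.nat 2 0 = K)
    (h12 : s.nat 12 0 = p) (h19 : s.nat 19 0 = N) (h30 : s.nat 30 0 = q) (hN1 : 1 ≤ N)
    (hqD : q < D) (hpD : p ≤ D) (h32 : s.nat 32 0 = b) (h33 : s.nat 33 0 = b * D)
    (h34 : s.nat 34 0 = b * p) (h38 : s.nat 38 0 = K * p) :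
    Spec O select s (250 * (N * D)) fun s' =>
      s'.nat 2 0 = K + 1 ∧ s'.nat 38 0 = (K + 1) * p ∧
      (∀ c < N, ∀ z < D, s'.fld 3 (c * D + z) = s.fld 3 (c * D + z) -
        s.fld 3 (c * D + q) * (s.fld 3 (b * D + q))⁻¹ * s.fld 3 (b * D + z)) ∧
      (∀ x < K * p, s'.nat 3 x = s.nat 3 x) ∧ (∀ i < p, s'.nat 3 (K * p + i) = s.nat 4 (b * p + i)) ∧
      (∀ k < K, s'.real 1 k = s.real 1 k) ∧ s'.real 1 K = s.real 2 b := by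
  have hD1 : 1 ≤ D := by omega
  have hND : D ≤ N * D := Nat.le_mul_of_pos_left D hN1
  refine Spec.seq (copyNat_spec (o := K * p) (o' := b * p) h12 rfl rfl (by norm_num) ?_ ?_ le_rfl)
    (T₂ := 217 * (N * D)) (by simp only [NatExp.cost, NatExp.var]; omega) ?_
  · intro s' hf
    simp only [NatExp.eval, NatExp.var]
    rw [hf.nat 38 rfl, h38]
  · intro s' hf
    simp only [NatExp.eval, NatExp.var]
    rw [hf.nat 34 rfl, h34]
  intro s₁ hf₁ hI₁
  have e2 : s₁.nat 2 0 = K := by rw [hf₁.nat 2 rfl, h2]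
  have e12 : s₁.nat 12 0 = p := by rw [hf₁.nat 12 rfl, h12]
  have e32 : s₁.nat 32 0 = b := by rw [hf₁.nat 32 rfl, h32]
  have e38 : s₁.nat 38 0 = K * p := by rw [hf₁.nat 38 rfl, h38]
  refine Spec.setReal_seq (T₂ := 205 * (N * D))
    (by simp only [NatExp.cost, NatExp.var, RealExp.cost]; omega) ?_
  refine Spec.assign_seq (T₂ := 190 * (N * D)) (by simp only [NatExp.cost, NatExp.var]; omega) ?_
  refine Spec.assign_seq (T₂ := 175 * (N * D)) (by simp only [NatExp.cost, NatExp.var]; omega) ?_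
  simp only [NatExp.eval, NatExp.var, RealExp.eval, e2, e32, setR_nat]
  -- The pivot vector is copied out because the elimination also runs over the pivot itself and
  -- turns it into zero.
  refine Spec.seq (copyFld_spec (o := 0) (o' := b * D) (N := D) ?_ rfl rfl (fun _ _ => rfl) ?_
    le_rfl) (T₂ := 120 * (N * D)) (by simp only [NatExp.cost]; omega) ?_
  · simp only [setN_nat_ne, setR_nat, ne_eq, OfNat.zero_ne_ofNat, not_false_eq_true]
    rw [hf₁.nat 0 rfl, hD]
  · intro s' hf
    simp only [NatExp.eval]
    rw [hf.nat 33 rfl]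
    simp only [setN_nat_ne, setR_nat, ne_eq, Nat.reduceEqDiff, not_false_eq_true]
    rw [hf₁.nat 33 rfl, h33]
  intro s₂ hf₂ hI₂
  have eV : s₂.fld 3 = s.fld 3 := by
    rw [hf₂.fld 3 rfl]
    simp only [setN_fld, setR_fld]
    exact hf₁.fld 3 rfl
  have eP : ∀ z < D, s₂.fld 4 z = s.fld 3 (b * D + z) := by
    intro z hz
    rw [hI₂ z, if_pos (by omega)]
    simp only [setN_fld, setR_fld, Nat.sub_zero]
    rw [hf₁.fld 3 rfl]
  refine (reduceAll_spec (q := q) (D := D) (N := N) ?_ ?_ ?_ hN1 hqD).conseq (by omega) ?_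
  · rw [hf₂.nat 0 rfl]
    simp only [setN_nat_ne, setR_nat, ne_eq, OfNat.zero_ne_ofNat, not_false_eq_true]
    rw [hf₁.nat 0 rfl, hD]
  · rw [hf₂.nat 19 rfl]
    simp only [setN_nat_ne, setR_nat, ne_eq, Nat.reduceEqDiff, not_false_eq_true]
    rw [hf₁.nat 19 rfl, h19]
  · rw [hf₂.nat 30 rfl]
    simp only [setN_nat_ne, setR_nat, ne_eq, Nat.reduceEqDiff, not_false_eq_true]
    rw [hf₁.nat 30 rfl, h30]
  · intro s₃ hf₃ hI₃
    have e3 : s₃.nat 3 = s₁.nat 3 := by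
      rw [hf₃.nat 3 rfl, hf₂.nat 3 rfl]; simp
    have eR : ∀ k, s₃.real 1 k = if k = K then s.real 2 b else s.real 1 k := by
      intro k
      rw [hf₃.real 1 rfl, hf₂.real 1 rfl]
      simp only [setN_real, setR_real_self, Function.update_apply]
      rw [hf₁.real 2 rfl, hf₁.real 1 rfl]
    refine ⟨?_, ?_, ?_, ?_, ?_, ?_, ?_⟩
    · rw [hf₃.nat 2 rfl, hf₂.nat 2 rfl]; simp
    · rw [hf₃.nat 38 rfl, hf₂.nat 38 rfl]; simp [e38, e12]; ring
    · intro c hc z hz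
      rw [hI₃ c hc z hz, eV, eP q hqD, eP z hz]
    · intro x hx
      rw [e3, hI₁, if_neg (by omega)]
    · intro i hi
      rw [e3, hI₁, if_pos (by omega), Nat.add_sub_cancel_left]
    · intro k hk
      rw [eR, if_neg (by omega)]
    · rw [eR, if_pos rfl]

/-- Selects candidates of maximum weight by elimination. -/
def eliminate : Program :=
  .seq (.assign 2 (.lit 0)) <| .seq (.assign 38 (.lit 0)) <|
  .forLoop 30 0 8 <| .seq search (.cond (.natLe (.lit 1) (.var 31)) select .skip)

/-- Realizes `ElimInv.step` when the search succeeds and `ElimInv.skip` when it does not; all D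
coordinates are scanned, those outside the masks of degree e being zero throughout. The kept sets of
the previous layer may be overwritten, as the candidates hold full copies. -/
lemma eliminate_spec {a : ℕ → F} {n m r d D N B p e : ℕ} {cl : ℕ → List ℕ} {cw : ℕ → ℝ}
    (hD : s.nat 0 8 = D) (hd : D = 2 ^ d) (h12 : s.nat 12 0 = p) (h19 : s.nat 19 0 = N)
    (hNB : N ≤ B) (hB : 1 ≤ B) (hpD : p ≤ D) (hC : Cands s a n r m p D cl cw N)
    (hom : ∀ c < N, colProd a n r m (cl c) ∈ homogeneous F d e) :
    Spec O eliminate s (500 * (D * (B * D))) fun s' => ∃ K sel cur,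
      ElimInv (masks d e) (fun c => colProd a n r m (cl c)) cw N D K sel cur ∧ s'.nat 2 0 = K ∧
      ∀ k < K, listAt (s'.nat 3) (k * p) p = cl (sel k) ∧ s'.real 1 k = cw (sel k) := by
  have hD1 : 1 ≤ D := by rw [hd]; exact Nat.one_le_two_pow
  have hND : 1 ≤ B * D := Nat.mul_pos hB hD1
  have hNN : B ≤ B * D := Nat.le_mul_of_pos_right B hD1
  have hNBD : N * D ≤ B * D := Nat.mul_le_mul_right D hNB
  have hDND : 1 ≤ D * (B * D) := Nat.mul_pos hD1 hND
  have hmask : ∀ z ∈ masks d e, z < D := by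
    intro z hz
    rw [hd]
    exact Finset.mem_range.1 (Finset.filter_subset _ _ hz)
  refine Spec.assign_seq (T₂ := 497 * (D * (B * D))) (by simp only [NatExp.cost]; omega) ?_
  refine Spec.assign_seq (T₂ := 494 * (D * (B * D))) (by simp only [NatExp.cost]; omega) ?_
  simp only [NatExp.eval]
  refine Spec.forLoop (N := D) (B := 450 * (B * D)) (fun q s' => ∃ K sel cur,
      ElimInv (masks d e) (fun c => colProd a n r m (cl c)) cw N q K sel cur ∧ s'.nat 2 0 = K ∧
      s'.nat 38 0 = K * p ∧ (∀ c < N, ∀ z < D, s'.fld 3 (c * D + z) = cur c z) ∧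
      ∀ k < K, listAt (s'.nat 3) (k * p) p = cl (sel k) ∧ s'.real 1 k = cw (sel k))
      (by simpa using hD) rfl rfl ?_ ?_ ?_ ?_
  · exact ⟨0, id, _, ElimInv.init hom, by simp, by simp, by simpa using hC.prod, by simp⟩
  · rintro q hq s₁ hf hq' ⟨K, sel, cur, hE, h2, h38, hV, hS⟩
    have hn : s₁.nat 0 = s.nat 0 ∧ s₁.nat 12 = s.nat 12 ∧ s₁.nat 19 = s.nat 19 ∧
        s₁.nat 4 = s.nat 4 := by
      refine ⟨?_, ?_, ?_, ?_⟩ <;> rw [hf.nat _ rfl] <;> simp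
    have eR : s₁.real 2 = s.real 2 := by rw [hf.real 2 rfl]; simp
    refine Spec.seq (search_spec (q := q) (D := D) (p := p) (N := N) (by rw [hn.1, hD])
      (by rw [hn.2.1, h12]) (by rw [hn.2.2.1, h19]) hq' hNB hB) (T₂ := 330 * (B * D)) (by omega) ?_
    intro s₂ hf₂ hF
    have e3 : s₂.fld 3 = s₁.fld 3 := hf₂.fld 3 rfl
    refine Spec.cond (T₁ := 300 * (B * D))
      (by simp only [Test.cost, NatExp.cost, NatExp.var]; omega) ?_ ?_
    · intro hb
      simp only [Test.holds, NatExp.eval, NatExp.var] at hb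
      rcases hF with ⟨h31, -⟩ | ⟨-, b, hbN, h32, h33, h34, hv, hmax⟩
      · omega
      refine (select_spec (q := q) (D := D) (N := N) (p := p) (K := K) (b := b) ?_ ?_ ?_ ?_ ?_ (by omega)
        hq hpD h32 h33 h34 ?_).conseq (by omega) ?_
      · rw [hf₂.nat 0 rfl, hn.1, hD]
      · rw [hf₂.nat 2 rfl, h2]
      · rw [hf₂.nat 12 rfl, hn.2.1, h12]
      · rw [hf₂.nat 19 rfl, hn.2.2.1, h19]
      · rw [hf₂.nat 30 rfl, hq']
      · rw [hf₂.nat 38 rfl, h38]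
      · rintro s₃ hf₃ ⟨g2, g38, gV, gS, gS', gR, gR'⟩
        rw [hV b hbN q hq] at hv
        refine ⟨K + 1, Function.update sel K b, _, hE.step hbN hv ?_, by simpa using g2,
          by simpa using g38, ?_, ?_⟩
        · intro c hc hcq
          have := hmax c hc (by rw [hV c hc q hq]; exact hcq)
          rwa [eR, hC.weight c hc, hC.weight b hbN] at this
        · intro c hc z hz
          rw [setN_fld, gV c hc z hz, e3, hV c hc z hz, hV c hc q hq, hV b hbN q hq,
            hV b hbN z hz]
        · intro k hk
          simp only [setN_real, setN_nat_ne, ne_eq, Nat.reduceEqDiff, not_false_eq_true]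
          rcases Nat.lt_succ_iff_lt_or_eq.1 hk with hk | rfl
          · rw [Function.update_of_ne (by omega), gR k hk, hf₂.real 1 rfl, ← (hS k hk).1]
            refine ⟨listAt_congr fun i hi => ?_, (hS k hk).2⟩
            rw [gS _ (block_lt hk hi), hf₂.nat 3 rfl]
          · rw [Function.update_self, gR', hf₂.real 2 rfl, eR, hC.weight b hbN,
              ← hC.list b hbN]
            refine ⟨listAt_congr fun i hi => ?_, rfl⟩
            rw [gS' i hi, hf₂.nat 4 rfl, hn.2.2.2]
    · intro hb
      simp only [Test.holds, NatExp.eval, NatExp.var] at hb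
      refine Spec.skip (by omega) ?_
      rcases hF with ⟨-, h0⟩ | ⟨h31, -⟩
      · refine ⟨K, sel, cur, hE.skip ?_, ?_, ?_, ?_, ?_⟩
        · intro c hc
          rw [← hV c hc q hq, h0 c hc]
        · rw [setN_nat_ne _ _ _ _ _ (by norm_num), hf₂.nat 2 rfl, h2]
        · rw [setN_nat_ne _ _ _ _ _ (by norm_num), hf₂.nat 38 rfl, h38]
        · rw [setN_fld, e3]
          exact hV
        · rw [setN_real, setN_nat_ne _ _ _ _ _ (by norm_num), hf₂.nat 3 rfl, hf₂.real 1 rfl]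
          exact hS
      · omega
  · have := loop_time (N := D) (B := 450 * (B * D)) (c := 450) (X := B * D) (Y := D) le_rfl le_rfl
      hND hD1
    omega
  · rintro s' - ⟨K, sel, cur, hE, h2, -, -, hS⟩
    exact ⟨K, sel, cur, hE, h2, hS⟩

end Elimination

/-! ## The algorithm -/

section Algorithm

variable {F : Type*} {O : ℝ → ℕ → ℝ} {s : State F}

lemma block_eq (a : ℕ → ℕ) (q j : ℕ) : block a q j = (listAt a (j * q) q).toFinset := by
  ext x
  simp [block, listAt]

lemma listsOracle_of_isInput {n m r α β γ t : ℕ} {A : Fin m → Matrix (Fin r) (Fin n) F}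
    {𝓗 : Finset (Finset (Fin n))} {w₀ : ℝ} {g : ℝ → Finset (Fin n) → ℝ}
    (h : IsInput s α β γ t A 𝓗 w₀) (hO : Answers O s γ t 𝓗 g) :
    ListsOracle 𝓗 g O t γ fun j => listAt (s.nat 1) (j * γ) γ where
  length j _ := by simp [listAt]
  mem j hj := by
    have : block (s.nat 1) γ j ∈ 𝓗.image fun X => X.image Fin.val := by
      rw [h.family.blocks]
      exact Finset.mem_image_of_mem _ (Finset.mem_range.2 hj)
    obtain ⟨H, hH, he⟩ := Finset.mem_image.1 this
    exact ⟨H, hH, by rw [Lists, ← block_eq, ← he], hO j hj H hH he⟩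
  surj H hH := by
    have : H.image Fin.val ∈ (Finset.range t).image (block (s.nat 1) γ) := by
      rw [← h.family.blocks]
      exact Finset.mem_image_of_mem _ hH
    obtain ⟨j, hj, he⟩ := Finset.mem_image.1 this
    have hj := Finset.mem_range.1 hj
    refine ⟨j, hj, ?_, by rw [Lists, ← block_eq, ← he], hO j hj H hH he.symm⟩
    -- A list of length γ with γ distinct entries has no repetition.
    rw [← Multiset.coe_nodup, ← Multiset.toFinset_card_eq_card_iff_nodup]
    have h1 : (listAt (s.nat 1) (j * γ) γ).toFinset.card = γ := by
      rw [← block_eq, he, Finset.card_image_of_injective _ Fin.val_injective,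
        h.family.card_mem H hH]
    have h2 : (listAt (s.nat 1) (j * γ) γ).length = γ := by simp [listAt]
    exact h1.trans h2.symm

variable [Field F]

lemma LayerInv.congr {n m r γ : ℕ} {M : Fin m → Matroid (Fin n)} {a : ℕ → F}
    {𝓗 : Finset (Finset (Fin n))} {w : Finset (Fin n) → ℝ} {i K : ℕ} {S S' : ℕ → List ℕ}
    {wt wt' : ℕ → ℝ} (h : LayerInv M a r γ 𝓗 w i K S wt) (hS : ∀ k < K, S' k = S k)
    (hwt : ∀ k < K, wt' k = wt k) : LayerInv M a r γ 𝓗 w i K S' wt' where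
  length k hk := by rw [hS k hk]; exact h.length k hk
  ne_zero k hk := by rw [hS k hk]; exact h.ne_zero k hk
  sound k hk := by rw [hS k hk, hwt k hk]; exact h.sound k hk
  distinct k hk j hj := by rw [hS k hk, hS j (hj.trans hk)]; exact h.distinct k hk j hj
  complete X hX Y l hl hlY hd hi := by
    obtain ⟨k, hk, h1, h2⟩ := h.complete X hX Y l hl hlY hd hi
    exact ⟨k, hk, by rwa [hS k hk], by rwa [hwt k hk]⟩
  bound := h.bound

/-- One layer of the dynamic program. -/
def layer : Program :=
  .seq (.assign 12 (.add (.var 11) (.get 0 (.lit 5)))) <| .seq build <| .seq eliminate <|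
    .assign 11 (.var 12)

lemma layer_spec {n m r γ t D i K : ℕ} {M : Fin m → Matroid (Fin n)}
    {A : Fin m → Matrix (Fin r) (Fin n) F} {𝓗 : Finset (Finset (Fin n))}
    {w : Finset (Fin n) → ℝ} {g : ℝ → Finset (Fin n) → ℝ}
    (hp : Params s n m r γ t (r * m) D) (hD : D = 2 ^ (r * m)) (hm1 : 1 ≤ m) (hm : m ≤ D)
    (hγ : 1 ≤ γ) (hiD : (i + 1) * γ ≤ D) (ht1 : 1 ≤ t)
    (hA : HoldsMatrices (s.fld 0) A) (hM : ∀ i, Represents (A i) (M i))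
    (h𝓗 : ∀ H ∈ 𝓗, H.card = γ) (hg : Generates 𝓗 g w)
    (hO : ListsOracle 𝓗 g O t γ fun j => listAt (s.nat 1) (j * γ) γ)
    (h2 : s.nat 2 0 = K) (h11 : s.nat 11 0 = i * γ)
    (h : LayerInv M (s.fld 0) r γ 𝓗 w i K (fun k => listAt (s.nat 3) (k * (i * γ)) (i * γ))
      (s.real 1)) :
    Spec O layer s (1300 * (D ^ 5 * t)) fun s' => ∃ K', s'.nat 2 0 = K' ∧
      s'.nat 11 0 = (i + 1) * γ ∧ LayerInv M (s.fld 0) r γ 𝓗 w (i + 1) K'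
        (fun k => listAt (s'.nat 3) (k * ((i + 1) * γ)) ((i + 1) * γ)) (s'.real 1) := by
  have hD1 : 1 ≤ D := by rw [hD]; exact Nat.one_le_two_pow
  have hdD : r * m ≤ D := by rw [hD]; exact Nat.lt_two_pow_self.le
  -- The size bound of the invariant also keeps the running time under control: a binomial
  -- coefficient is at most 2^(rm).
  have hKD : K ≤ D := by rw [hD]; exact h.bound.trans (Nat.choose_le_two_pow _ _)
  have hX : 1 ≤ D ^ 5 * t := Nat.mul_pos (Nat.pow_pos hD1) ht1
  have hp' : i * γ + γ = (i + 1) * γ := by ring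
  -- Division by t with remainder recovers the kept set and the member from the number of a
  -- candidate.
  set cl : ℕ → List ℕ := fun c => listAt (s.nat 3) (c / t * (i * γ)) (i * γ) ++
    listAt (s.nat 1) (c % t * γ) γ with hcl
  set cw : ℕ → ℝ := fun c => O (s.real 1 (c / t)) (c % t) with hcw
  have hdiv : ∀ k j, j < t → (k * t + j) / t = k ∧ (k * t + j) % t = j := by
    intro k j hj
    rw [Nat.add_comm, Nat.add_mul_div_right _ _ ht1, Nat.add_mul_mod_self_right,
      Nat.div_eq_of_lt hj, Nat.mod_eq_of_lt hj, Nat.zero_add]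
    exact ⟨rfl, rfl⟩
  have hcl' : ∀ k < K, ∀ j < t, cl (k * t + j) =
      listAt (s.nat 3) (k * (i * γ)) (i * γ) ++ listAt (s.nat 1) (j * γ) γ := by
    intro k _ j hj
    simp only [hcl, (hdiv k j hj).1, (hdiv k j hj).2]
  have hcw' : ∀ k < K, ∀ j < t, cw (k * t + j) = O (s.real 1 k) j := by
    intro k _ j hj
    simp only [hcw, (hdiv k j hj).1, (hdiv k j hj).2]
  refine Spec.assign_seq (T₂ := 1290 * (D ^ 5 * t))
    (by simp only [NatExp.cost, NatExp.var]; omega) ?_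
  simp only [NatExp.eval, NatExp.var, h11, hp.γ_eq]
  have hp₁ : Params (s.setN 12 0 (i * γ + γ)) n m r γ t (r * m) D := by
    constructor <;> simp only [setN_nat_ne, ne_eq, OfNat.zero_ne_ofNat, not_false_eq_true]
    exacts [hp.n_eq, hp.m_eq, hp.r_eq, hp.γ_eq, hp.t_eq, hp.d_eq, hp.D_eq]
  refine Spec.seq (build_spec (K := K) (p := i * γ) (cl := cl) (cw := cw) hp₁ hdD hm (by omega)
    hD1 ht1 hKD (by simpa using h2) (by simpa using h11) (by simp) (by simpa using hcl')
    (by simpa using hcw')) (T₂ := 590 * (D ^ 5 * t)) (by omega) ?_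
  rintro s₁ hf₁ ⟨hC, h19⟩
  rw [setN_fld] at hC
  have e12 : s₁.nat 12 0 = i * γ + γ := by rw [hf₁.nat 12 rfl]; simp
  have hKt : K * t ≤ D * t := Nat.mul_le_mul_right _ hKD
  have hlen : ∀ c, (cl c).length = (i + 1) * γ := by
    intro c
    simp [hcl, listAt, hp']
  refine Spec.seq (eliminate_spec (d := r * m) (e := (i + 1) * γ * m) (B := D * t)
    (by rw [hf₁.nat 0 rfl]; exact hp₁.D_eq) hD e12 h19 hKt (Nat.mul_pos hD1 ht1) (by omega) hC ?_)
    (T₂ := 80 * (D ^ 5 * t)) ?_ ?_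
  · intro c _
    have := colProd_mem_homogeneous (s.fld 0) n r m (cl c)
    rwa [hlen] at this
  · have h1 : D * (D * t * D) ≤ D ^ 5 * t := by
      calc D * (D * t * D) = D ^ 3 * t := by ring
        _ ≤ D ^ 5 * t := Nat.mul_le_mul_right _ (Nat.pow_le_pow_right hD1 (by norm_num))
    omega
  · rintro s₂ hf₂ ⟨K', sel, cur, hE, g2, gS⟩
    refine Spec.assign (by simp only [NatExp.cost]; omega) ?_
    refine ⟨K', by simpa using g2, ?_, ?_⟩
    · simp only [setN_nat_self, Function.update_self, NatExp.eval]
      rw [hf₂.nat 12 rfl, e12, hp']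
    · simp only [setN_real, setN_nat_ne, ne_eq, Nat.reduceEqDiff, not_false_eq_true]
      rw [hp'] at gS
      rw [hD] at hE
      exact (h.step hA hm1 hM hγ h𝓗 hg hO hcl' hcw' hE).congr (fun k hk => (gS k hk).1)
        fun k hk => (gS k hk).2

/-- Computes the number `r * m` of coordinates and the number of masks, and stores the empty set as
the only selected set. -/
def setup : Program :=
  .seq (.assign 19 (.get 0 (.lit 1))) <| .seq (.assign 35 (.lit 0)) <|
  .seq (.forLoop 20 19 0 (.incr 35 (.get 0 (.lit 2)))) <|
  .seq (.setNat 0 (.lit 7) (.var 35)) <| .seq (.assign 36 (.lit 1)) <|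
  .seq (.forLoop 20 35 0 (.incr 36 (.var 36))) <|
  .seq (.setNat 0 (.lit 8) (.var 36)) <| .seq (.assign 2 (.lit 1)) <|
  .seq (.assign 11 (.lit 0)) (.setReal 1 (.lit 0) (.get 0 (.lit 0)))

/-- The product r·m is formed by repeated addition and D by repeated doubling. Both are written into
the parameter array, so the preservation of its first seven cells has to be stated. -/
lemma setup_spec {m r D : ℕ} (hm : s.nat 0 1 = m) (hr : s.nat 0 2 = r) (hD : D = 2 ^ (r * m))
    (hmD : m ≤ D) (hdD : r * m ≤ D) : Spec O setup s (200 * D) fun s' =>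
      s'.nat 0 7 = r * m ∧ s'.nat 0 8 = D ∧ (∀ x < 7, s'.nat 0 x = s.nat 0 x) ∧
      s'.nat 2 0 = 1 ∧ s'.nat 11 0 = 0 ∧ s'.real 1 0 = s.real 0 0 := by
  have hD1 : 1 ≤ D := by rw [hD]; exact Nat.one_le_two_pow
  refine Spec.assign_seq (T₂ := 190 * D) (by simp only [NatExp.cost]; omega) ?_
  refine Spec.assign_seq (T₂ := 180 * D) (by simp only [NatExp.cost]; omega) ?_
  simp only [NatExp.eval, hm]
  refine Spec.seq (T₁ := 41 * D) (T₂ := 139 * D) (Q₁ := fun s' => s'.nat 35 0 = r * m ∧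
    s'.nat 0 = s.nat 0 ∧ s'.real = s.real) ?_ (by omega) ?_
  · refine Spec.forLoop (N := m) (B := 20) (fun k s' => s'.nat 35 0 = r * k) (by simp) rfl rfl
      (by simp) ?_ ?_ ?_
    · intro k hk s' hf hk' hI
      refine Spec.assign (by simp [NatExp.cost, NatExp.var]) ?_
      have e0 : s'.nat 0 2 = r := by rw [hf.nat 0 rfl]; simpa using hr
      simp [NatExp.eval, NatExp.var, hI, e0]
      ring
    · have := loop_time (N := m) (B := 20) (c := 20) (X := 1) (Y := D) hmD le_rfl le_rfl hD1
      omega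
    · intro s' hf h
      refine ⟨h, by rw [hf.nat 0 rfl]; simp, ?_⟩
      ext a i
      rw [hf.real a rfl]
      simp
  rintro s₁ - ⟨h35, h0, hR⟩
  refine Spec.seq (T₁ := 4) (T₂ := 135 * D) (Q₁ := fun s' => s' = s₁.setN 0 7 (r * m))
    (Spec.setNat (by simp [NatExp.cost, NatExp.var])
      (by simp [NatExp.eval, NatExp.var, h35])) (by omega) ?_
  rintro _ - rfl
  refine Spec.assign_seq (T₂ := 130 * D) (by simp only [NatExp.cost]; omega) ?_
  simp only [NatExp.eval]
  refine Spec.seq (T₁ := 41 * D) (T₂ := 89 * D) (Q₁ := fun s' => s'.nat 36 0 = D ∧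
    s'.nat 0 = Function.update (s.nat 0) 7 (r * m) ∧ s'.real = s.real) ?_ (by omega) ?_
  · refine Spec.forLoop (N := r * m) (B := 20) (fun k s' => s'.nat 36 0 = 2 ^ k)
      (by simp [h35]) rfl rfl (by simp) ?_ ?_ ?_
    · intro k hk s' hf hk' hI
      refine Spec.assign (by simp [NatExp.cost, NatExp.var]) ?_
      simp [NatExp.eval, NatExp.var, hI]
      ring
    · have := loop_time (N := r * m) (B := 20) (c := 20) (X := 1) (Y := D) hdD le_rfl le_rfl hD1
      omega
    · intro s' hf h
      refine ⟨h.trans hD.symm, by rw [hf.nat 0 rfl]; simp [h0], ?_⟩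
      ext a i
      rw [hf.real a rfl]
      simp [hR]
  rintro s₂ - ⟨h36, h0', hR'⟩
  refine Spec.seq (T₁ := 4) (T₂ := 80 * D) (Q₁ := fun s' => s' = s₂.setN 0 8 D)
    (Spec.setNat (by simp [NatExp.cost, NatExp.var])
      (by simp [NatExp.eval, NatExp.var, h36])) (by omega) ?_
  rintro _ - rfl
  refine Spec.assign_seq (T₂ := 70 * D) (by simp only [NatExp.cost]; omega) ?_
  refine Spec.assign_seq (T₂ := 60 * D) (by simp only [NatExp.cost]; omega) ?_
  refine Spec.setReal (by simp only [NatExp.cost, RealExp.cost]; omega) ?_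
  refine ⟨?_, ?_, ?_, ?_, ?_, ?_⟩
  · simp [h0']
  · simp
  · intro x hx
    simp only [setR_nat, setN_nat_ne, setN_nat_self, ne_eq, OfNat.zero_ne_ofNat,
      not_false_eq_true, h0']
    rw [Function.update_of_ne (by omega), Function.update_of_ne (by omega)]
  · simp [NatExp.eval]
  · simp [NatExp.eval]
  · simp [NatExp.eval, RealExp.eval, hR']

/-- The algorithm. -/
def algorithm : Program :=
  .cond (.natLe (.get 0 (.lit 6)) (.lit 0))
    (.cond (.natLe (.get 0 (.lit 3)) (.lit 0))
      (.seq (.setReal 1 (.lit 0) (.get 0 (.lit 0))) (.assign 2 (.lit 1))) (.assign 2 (.lit 0)))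
    (.seq setup (.forLoop 10 0 3 layer))

/-- For t ≥ 1 the α ≤ D layers together cost a multiple of D^6·t. For t = 0 the first term of the
bound vanishes, and the constant cost is charged to the second, which is positive. -/
lemma algorithm_spec {n m r α β γ t : ℕ} {M : Fin m → Matroid (Fin n)}
    {A : Fin m → Matrix (Fin r) (Fin n) F} {𝓗 : Finset (Finset (Fin n))}
    {w : Finset (Fin n) → ℝ} {g : ℝ → Finset (Fin n) → ℝ} (hm1 : 1 ≤ m)
    (hr : r = (α + β) * γ) (hr1 : 1 ≤ r) (hn : 1 ≤ n) (hM : ∀ i, Represents (A i) (M i))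
    (h𝓗 : ∀ H ∈ 𝓗, H.card = γ) (hg : Generates 𝓗 g w) (hI : IsInput s α β γ t A 𝓗 (w ∅))
    (hO : Answers O s γ t 𝓗 g) :
    Spec O algorithm s (2 ^ (40 * (r * m)) * t + 40 * (m ^ 2 * r * n)) fun s' => ∃ K,
      s'.nat 2 0 = K ∧ LayerInv M (s.fld 0) r γ 𝓗 w α K
        (fun k => listAt (s'.nat 3) (k * (α * γ)) (α * γ)) (s'.real 1) := by
  have hA : HoldsMatrices (s.fld 0) A := hI.matrices
  have hmrn : 1 ≤ m ^ 2 * r * n := Nat.mul_pos (Nat.mul_pos (Nat.pow_pos hm1) hr1) hn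
  have hγ : 1 ≤ γ := by
    rcases Nat.eq_zero_or_pos γ with rfl | h
    · simp at hr; omega
    · exact h
  unfold algorithm
  rcases Nat.eq_zero_or_pos t with ht | ht1
  -- With 𝓗 empty, the only disjoint union is the empty set if α = 0, and there is none if α > 0.
  · refine Spec.cond (T₁ := 12) (by simp only [Test.cost, NatExp.cost]; omega) (fun _ => ?_)
      (fun hb => absurd (by simp [Test.holds, NatExp.eval, hI.t_eq, ht]) hb)
    refine Spec.cond (T₁ := 8) (by simp [Test.cost, NatExp.cost]) (fun hb => ?_) (fun hb => ?_)
    · have hα : α = 0 := by simpa [Test.holds, NatExp.eval, hI.α_eq] using hb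
      subst hα
      refine Spec.setReal_seq (T₂ := 3) (by simp [NatExp.cost, RealExp.cost]) ?_
      refine Spec.assign (by simp [NatExp.cost]) ⟨1, by simp [NatExp.eval], ?_⟩
      exact LayerInv.init hA hm1 hM (by simp [listAt])
        (by simp [NatExp.eval, RealExp.eval, hI.weight])
    · have hα : 0 < α := by simpa [Test.holds, NatExp.eval, hI.α_eq, Nat.pos_iff_ne_zero] using hb
      refine Spec.assign (by simp [NatExp.cost]) ⟨0, by simp [NatExp.eval], ?_⟩
      refine ⟨by simp, by simp, by simp, by simp, ?_, Nat.zero_le _⟩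
      rintro X ⟨H, hH, -⟩
      have : 𝓗 = ∅ := by rw [← Finset.card_eq_zero, hI.family.card_eq, ht]
      have := hH ⟨0, hα⟩
      simp_all
  · set D := 2 ^ (r * m) with hD
    have hrm : 1 ≤ r * m := Nat.mul_pos hr1 hm1
    have hrD : r ≤ D := (Nat.le_mul_of_pos_right r hm1).trans Nat.lt_two_pow_self.le
    have hmD : m ≤ D := (Nat.le_mul_of_pos_left m hr1).trans Nat.lt_two_pow_self.le
    have hdD : r * m ≤ D := Nat.lt_two_pow_self.le
    have hD2 : 2 ≤ D := by
      calc 2 = 2 ^ 1 := rfl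
        _ ≤ D := Nat.pow_le_pow_right (by norm_num) hrm
    have hαr : α * γ ≤ r := by rw [hr]; exact Nat.mul_le_mul_right _ (by omega)
    have hαD : α ≤ D := ((Nat.le_mul_of_pos_right α hγ).trans hαr).trans hrD
    have hDt : 1 ≤ D ^ 5 * t := Nat.mul_pos (Nat.pow_pos (by omega)) ht1
    have hD6 : D ≤ D ^ 6 * t :=
      (Nat.le_self_pow (by norm_num) D).trans (Nat.le_mul_of_pos_right _ ht1)
    -- From D ≥ 2 follows 2000 ≤ 2^11 ≤ D^11, so D^17·t would already be enough; the exponent 40 is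
    -- a generous choice.
    have htime : 2000 * (D ^ 6 * t) ≤ 2 ^ (40 * (r * m)) * t := by
      have h1 : 2000 ≤ D ^ 11 := le_trans (by norm_num) (Nat.pow_le_pow_left hD2 11)
      calc 2000 * (D ^ 6 * t) = 2000 * D ^ 6 * t := by ring
        _ ≤ D ^ 11 * D ^ 6 * t := Nat.mul_le_mul_right _ (Nat.mul_le_mul_right _ h1)
        _ = D ^ 17 * t := by ring
        _ ≤ D ^ 40 * t := Nat.mul_le_mul_right _ (Nat.pow_le_pow_right (by omega) (by norm_num))
        _ = _ := by rw [hD, ← pow_mul, mul_comm (r * m)]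
    refine Spec.cond (T₁ := 1990 * (D ^ 6 * t)) (by simp only [Test.cost, NatExp.cost]; omega)
      (fun hb => ?_) (fun _ => ?_)
    · simp only [Test.holds, NatExp.eval, hI.t_eq] at hb
      omega
    refine Spec.seq (setup_spec hI.m_eq hI.r_eq hD hmD hdD) (T₂ := 1500 * (D ^ 6 * t)) (by omega) ?_
    rintro s₁ hf₁ ⟨h7, h8, h0, h2, h11, hR⟩
    have hp₁ : Params s₁ n m r γ t (r * m) D := by
      refine ⟨?_, ?_, ?_, ?_, ?_, h7, h8⟩ <;> rw [h0 _ (by norm_num)]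
      exacts [hI.n_eq, hI.m_eq, hI.r_eq, hI.γ_eq, hI.t_eq]
    refine Spec.forLoop (N := α) (B := 1300 * (D ^ 5 * t)) (fun i s' => ∃ K, s'.nat 2 0 = K ∧
      s'.nat 11 0 = i * γ ∧ LayerInv M (s.fld 0) r γ 𝓗 w i K
        (fun k => listAt (s'.nat 3) (k * (i * γ)) (i * γ)) (s'.real 1))
      (by rw [h0 3 (by norm_num), hI.α_eq]) rfl rfl ?_ ?_ ?_ ?_
    · refine ⟨1, by simpa using h2, by simpa using h11, ?_⟩
      exact LayerInv.init hA hm1 hM (by simp [listAt]) (by rw [setN_real, hR, hI.weight])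
    · rintro i hi s₂ hf₂ - ⟨K, g2, g11, hL⟩
      have eA : s₂.fld 0 = s.fld 0 := by rw [hf₂.fld 0 rfl, hf₁.fld 0 rfl]
      have e1 : s₂.nat 1 = s.nat 1 := by rw [hf₂.nat 1 rfl, hf₁.nat 1 rfl]
      have hiD : (i + 1) * γ ≤ D := (Nat.mul_le_mul_right γ hi).trans (hαr.trans hrD)
      rw [← eA] at hL hA
      refine (layer_spec (hp₁.of_frame hf₂ rfl) hD hm1 hmD hγ hiD ht1 hA hM h𝓗 hg
        (by rw [e1]; exact listsOracle_of_isInput hI hO) g2 g11 hL).conseq le_rfl ?_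
      rintro s₃ - ⟨K', i2, i11, hL'⟩
      rw [eA] at hL'
      exact ⟨K', by simpa using i2, by simpa using i11, by simpa using hL'⟩
    · have := loop_time (N := α) (B := 1300 * (D ^ 5 * t)) (c := 1300) (X := D ^ 5 * t) (Y := D)
        hαD le_rfl hDt (by omega)
      rw [show D * (D ^ 5 * t) = D ^ 6 * t by ring] at this
      omega
    · rintro s' - ⟨K, i2, -, hL⟩
      exact ⟨K, i2, hL⟩

end Algorithm

end RepFam

theorem mainTheorem3 :
    ∃ (P : Program) (C : ℕ),
      ∀ (F : Type*) [Field F] (n m r α β γ t : ℕ),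
        1 ≤ m → r = (α + β) * γ → 1 ≤ r →
      ∀ (M : Fin m → Matroid (Fin n)) (A : Fin m → Matrix (Fin r) (Fin n) F),
        (∀ i, Represents (A i) (M i)) → (∀ i, (M i).eRank = r) →
      ∀ 𝓗 : Finset (Finset (Fin n)), (∀ H ∈ 𝓗, H.card = γ) → 𝓗.card = t →
      ∀ (w : Finset (Fin n) → ℝ) (g : ℝ → Finset (Fin n) → ℝ), Generates 𝓗 g w →
      ∀ (s : State F) (O : ℝ → ℕ → ℝ),
        IsInput s α β γ t A 𝓗 (w ∅) → Answers O s γ t 𝓗 g →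
      ∃ (s' : State F) (T : ℕ) (𝓡 : Finset (Finset (Fin n))),
        Runs O P s s' T ∧
        T ≤ 2 ^ (C * (r * m)) * t + C * (m ^ 2 * r * n) ∧
        IsOutput s' (α * γ) 𝓡 ∧
        𝓡.card ≤ (r * m).choose (α * γ * m) ∧
        IsMaxIntersectionRep M (β * γ) w (commonIndepUnions M 𝓗 α) (𝓡 : Set (Finset (Fin n))) := by
  refine ⟨algorithm, 40, ?_⟩
  intro F _ n m r α β γ t hm1 hr hr1 M A hM hrank 𝓗 h𝓗 _ w g hg s O hI hO
  -- A matroid of positive rank has a nonempty ground set; this makes m²rn positive, as the time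
  -- bound for t = 0 requires.
  have hn : 1 ≤ n := by
    by_contra hn
    obtain rfl : n = 0 := by omega
    have h1 := (M ⟨0, hm1⟩).eRank_le_encard_ground
    rw [hrank, Set.eq_empty_of_isEmpty (M ⟨0, hm1⟩).E, Set.encard_empty] at h1
    have : r = 0 := by simpa using h1
    omega
  obtain ⟨s', T, hrun, hT, K, hK, hL⟩ := algorithm_spec hm1 hr hr1 hn hM h𝓗 hg hI hO
  obtain ⟨𝓡, hcard, hmem, hblocks, hrep⟩ :=
    hL.isMaxIntersectionRep (q := β * γ) hI.matrices hm1 hM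
  refine ⟨s', T, 𝓡, hrun, hT, ⟨hmem, by rw [hcard, hK], ?_⟩, hcard ▸ hL.bound, hrep⟩
  rw [hblocks, hK]
  exact Finset.image_congr fun k _ => (block_eq _ _ _).symm
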